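/- Let $d\ge 2$ and let $p,q\in(1,\infty]$ satisfy $\frac1p+\frac1q<\frac{2}{d-1}$ (with $\frac1\infty=0$). Let $\mathbb B^d$ be the set of unoriented nearest-neighbour bonds of $\mathbb Z^d$. For $\omega\in(0,\infty)^{\mathbb B^d}$ and $u:\mathbb Z^d\to\mathbb R$ set $(\mathcal L^\omega u)(x)=\sum_{y:\{x,y\}\in\mathbb B^d}\omega(\{x,y\})(u(y)-u(x))$. Let $B(n)=\{-n,\dots,n\}^d$. For a finite $S\subset\mathbb Z^d$, let $S_{\mathbb B}$ be the set of bonds with both end-points in $S$; for $F:\mathbb B^d\to\mathbb R$ let $\|F\|_{\underline L^r(S)}=\bigl(|S_{\mathbb B}|^{-1}\sum_{e\in S_{\mathbb B}}|F(e)|^r\bigr)^{1/r}$ for $1\le r<\infty$ and $\|F\|_{\underline L^\infty(S)}=\max_{e\in S_{\mathbb B}}|F(e)|$, and set $\Lambda^\omega_{p,q}(S)=\|\omega\|_{\underline L^p(S)}\,\|\omega^{-1}\|_{\underline L^q(S)}$. Then there exists a constant $c=c(d,p,q)\in[1,\infty)$ such that for every $\omega\in(0,\infty)^{\mathbb B^d}$,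 every integer $n\ge1$, every $u:\mathbb Z^d\to\mathbb R$ with $u\ge0$ and $-\mathcal L^\omega u\ge0$ in $B(4n)$, and all $\varepsilon>0$ and $\lambda\in(0,1)$ with $$|\{x\in B(2n): u(x)\ge\varepsilon\}|\ \ge\ \lambda\,|B(2n)|,$$ it holds that $u(x)\ge\gamma$ for all $x\in B(n)$, where $$\gamma=\varepsilon\begin{cases}\exp\bigl(-c\lambda^{-1}\Lambda^\omega_{1,1}(B(4n))^{\frac12}\bigr)&\text{if }d=2,\\[2pt] \exp\bigl(-c\lambda^{-1}\Lambda^\omega_{p,q}(B(4n))^{\frac12+\frac{\delta+1}{\delta}p'(\frac12+\frac1q-\frac1d)}\bigr)&\text{if }d\ge3,\end{cases}$$ with $\delta=\frac1{d-1}-\frac1{2p}-\frac1{2q}$ and $p'=\frac{p}{p-1}$ ($p'=1$ if $p=\infty$). -/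

import Mathlib

open scoped ENNReal

namespace RandomConductance

/-- The vertices of the lattice `ℤ^d`. -/
abbrev Vertex (d : ℕ) : Type := Fin d → ℤ

/-- The unoriented nearest-neighbour bonds of `ℤ^d`. The pair `(x, i)` stands for the bond
`{x, x + e_i}`; every unoriented bond is obtained from exactly one such pair, see
`Bond.toSym2_injective` and `Bond.range_toSym2`. -/
abbrev Bond (d : ℕ) : Type := Vertex d × Fin d

/-- The end-point `x` of the bond `{x, x + e_i}`. -/
def Bond.lower {d : ℕ} (b : Bond d) : Vertex d := b.1

/-- The end-point `x + e_i` of the bond `{x, x + e_i}`. -/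
def Bond.upper {d : ℕ} (b : Bond d) : Vertex d := b.1 + Pi.single b.2 1

/-- The unordered pair of end-points of a bond. -/
def Bond.toSym2 {d : ℕ} (b : Bond d) : Sym2 (Vertex d) := s(b.lower, b.upper)

theorem Bond.toSym2_injective {d : ℕ} : Function.Injective (Bond.toSym2 (d := d)) := by
  rintro ⟨x, i⟩ ⟨y, j⟩ h
  simp only [Bond.toSym2, Bond.lower, Bond.upper, Sym2.eq_iff] at h
  rcases h with ⟨rfl, h⟩ | ⟨h1, h2⟩
  · have h' := congrFun (add_left_cancel h) i
    by_cases hij : i = j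
    · rw [hij]
    · simp [hij] at h'
  · have hi := congrFun h2 i
    have hi' := congrFun h1 i
    by_cases hij : i = j
    · subst hij
      simp at hi hi'
      omega
    · simp [hij] at hi hi'
      omega

theorem Bond.range_toSym2 {d : ℕ} :
    Set.range (Bond.toSym2 (d := d)) =
      {e | ∃ x y : Vertex d, e = s(x, y) ∧ ∑ i, (x i - y i) ^ 2 = 1} := by
  ext e
  constructor
  · rintro ⟨⟨x, i⟩, rfl⟩
    refine ⟨x, x + Pi.single i 1, rfl, ?_⟩
    rw [Finset.sum_eq_single i]
    · simp
    · intro j _ hj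
      simp [hj]
    · simp
  · rintro ⟨x, y, rfl, h⟩
    have hex : ∃ i, x i - y i ≠ 0 := by
      by_contra! hc
      simp [hc] at h
    obtain ⟨i, hi⟩ := hex
    have h1 : 1 ≤ (x i - y i) ^ 2 := by
      have : 0 < (x i - y i) ^ 2 := by positivity
      omega
    rw [← Finset.add_sum_erase _ _ (Finset.mem_univ i)] at h
    have hnn : ∀ j ∈ Finset.univ.erase i, 0 ≤ (x j - y j) ^ 2 := fun j _ => sq_nonneg _
    have h2 := Finset.sum_nonneg hnn
    have h3 : (x i - y i) ^ 2 = 1 := by omega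
    have h4 : ∑ j ∈ Finset.univ.erase i, (x j - y j) ^ 2 = 0 := by omega
    have h5 : ∀ j, j ≠ i → x j = y j := by
      intro j hj
      have := (Finset.sum_eq_zero_iff_of_nonneg hnn).1 h4 j (by simp [hj])
      have := pow_eq_zero_iff (two_ne_zero) |>.1 this
      omega
    have h6 : (x i - y i - 1) * (x i - y i + 1) = 0 := by linarith
    rcases mul_eq_zero.1 h6 with h6 | h6
    · refine ⟨(y, i), ?_⟩
      have : y + Pi.single i 1 = x := by
        funext j
        by_cases hj : j = i
        · subst hj; simp; omega
        · simp [hj, h5 j hj]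
      simp [Bond.toSym2, Bond.lower, Bond.upper, this, Sym2.eq_swap]
    · refine ⟨(x, i), ?_⟩
      have : x + Pi.single i 1 = y := by
        funext j
        by_cases hj : j = i
        · subst hj; simp; omega
        · simp [hj, h5 j hj]
      simp [Bond.toSym2, Bond.lower, Bond.upper, this]

/-- The cube `B(y, n) = y + {-n, …, n}^d`. -/
noncomputable def cube {d : ℕ} (y : Vertex d) (n : ℕ) : Finset (Vertex d) :=
  Fintype.piFinset fun i => Finset.Icc (y i - n) (y i + n)

/-- The set of bonds with both end-points in `S`. -/
noncomputable def bondsIn {d : ℕ} (S : Finset (Vertex d)) : Finset (Bond d) :=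
  (S ×ˢ (Finset.univ : Finset (Fin d))).filter fun b => b.upper ∈ S

/-- The normalized norm of a function on the bonds with both end-points in `S`:
`(|S_𝔹|⁻¹ ∑_{e ∈ S_𝔹} |F e| ^ p) ^ (1 / p)` for finite `p`, and the maximum of `|F|` for
`p = ∞`. -/
noncomputable def avgNorm {d : ℕ} (p : ℝ≥0∞) (S : Finset (Vertex d)) (F : Bond d → ℝ) : ℝ :=
  if p = ∞ then ((bondsIn S).sup fun e => ‖F e‖₊ : NNReal)
  else (((bondsIn S).card : ℝ)⁻¹ * ∑ e ∈ bondsIn S, |F e| ^ p.toReal) ^ (1 / p.toReal)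

/-- The quantity `Λ_{p,q}(S) = ‖ω‖_{L^p(S)} ‖ω⁻¹‖_{L^q(S)}`, with normalized norms. -/
noncomputable def ellipticity {d : ℕ} (ω : Bond d → ℝ) (p q : ℝ≥0∞) (S : Finset (Vertex d)) : ℝ :=
  avgNorm p S ω * avgNorm q S fun e => (ω e)⁻¹

/-- The operator `(𝓛 u)(x) = ∑_{y ∼ x} ω(x, y) (u y - u x)`; the neighbours of `x` are
`x + e_i` and `x - e_i`. -/
def generator {d : ℕ} (ω : Bond d → ℝ) (u : Vertex d → ℝ) (x : Vertex d) : ℝ :=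
  ∑ i : Fin d, (ω (x, i) * (u (x + Pi.single i 1) - u x)
    + ω (x - Pi.single i 1, i) * (u (x - Pi.single i 1) - u x))

/-- `u` is superharmonic in `V`: `-𝓛 u ≥ 0` in `V`. -/
def IsSuperharmonicOn {d : ℕ} (ω : Bond d → ℝ) (u : Vertex d → ℝ) (V : Finset (Vertex d)) : Prop :=
  ∀ x ∈ V, 0 ≤ -generator ω u x

end RandomConductance

open RandomConductance

namespace RandomConductance

variable {d : ℕ}

/-! Let `w > 0` be superharmonic and let `v` be the positive part of `log (ε / w)`. Concavity of the
logarithm makes `v` subharmonic; moreover `v` vanishes where `w ≥ ε`, and `w ≥ ε exp (-v)`. It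
therefore suffices to bound `v` from above on `B(n)`. A merely nonnegative `u` is handled through `u
+ κ` with `κ → 0` (`mul_exp_le_of_logDefect_le`).

Testing the superharmonicity of `w` with `η² / w` bounds `∑ ω |∇ log w|²` by a multiple of `n⁻² ∑ ω`
(`sum_log_sq_le`). Hölder's inequality against `ω⁻¹` in `L^q` turns this into an `L^s` bound for
`∇v`, where `1/s = 1/2 + 1/(2q)`. The Poincaré inequality for functions vanishing on a proportion
`λ` of the cube then bounds the scale-invariant `W^{1,s}` norm of `v` by `C λ⁻¹ Λ^(1/2)`
(`energy_logDefect_le`).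

It remains to bound the maximum of `v` by this norm. For `d = 2` the maximum principle moves the
point to spheres of radius between `n` and `2n`; on each of them the one-dimensional Sobolev
inequality holds, and the radii are averaged (`le_energy_two`).

For `d ≥ 3` a Moser iteration controls the `W^{1,s}` norms of `v ^ (χ ^ j)` (`moser_step`,
`local_boundedness`). Its cutoff is adapted to the function: it decreases only across layers between
consecutive spheres on which both the weight and the energy are at most four times their mean
(`exists_cutoff_energy_le`). Hence the Sobolev inequality is needed only on spheres, of dimension `d
- 1`, and this is the source of the condition `1/p + 1/q < 2/(d - 1)`. The iteration costs a factor
`Λ^(1/(2(χ - 1)))`. `exists_exponents` chooses `χ` so that this is exactly the claimed power, with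
enough room left to replace `p` and `q` by smaller finite exponents. -/

/-! ### Cubes and sums along coordinate lines -/

/-- The forward difference of `f` in the direction `i`. -/
def fdiff (f : Vertex d → ℝ) (i : Fin d) (x : Vertex d) : ℝ := f (x + Pi.single i 1) - f x

theorem mem_cube_zero {k : ℕ} {x : Vertex d} :
    x ∈ cube (0 : Vertex d) k ↔ ∀ i, -(k : ℤ) ≤ x i ∧ x i ≤ k := by
  simp [cube, Fintype.mem_piFinset]

theorem card_cube_zero (k : ℕ) : (cube (0 : Vertex d) k).card = (2 * k + 1) ^ d := by
  simp only [cube, Fintype.card_piFinset, Pi.zero_apply, zero_sub, zero_add, Int.card_Icc,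
    Finset.prod_const, Finset.card_univ, Fintype.card_fin]
  congr 1
  omega

theorem cube_mono {k l : ℕ} (h : k ≤ l) : cube (0 : Vertex d) k ⊆ cube 0 l := by
  intro x hx
  rw [mem_cube_zero] at *
  intro i
  have := hx i
  omega

theorem zero_mem_cube (k : ℕ) : (0 : Vertex d) ∈ cube (0 : Vertex d) k := by
  rw [mem_cube_zero]
  intro i
  simp

theorem add_single_mem_cube {k l : ℕ} (h : k + 1 ≤ l) {x : Vertex d} (hx : x ∈ cube 0 k)
    (i : Fin d) : x + Pi.single i 1 ∈ cube 0 l := by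
  rw [mem_cube_zero] at *
  intro j
  have := hx j
  by_cases hj : j = i
  · subst hj; simp; omega
  · simp [hj]; omega

theorem sub_single_mem_cube {k l : ℕ} (h : k + 1 ≤ l) {x : Vertex d} (hx : x ∈ cube 0 k)
    (i : Fin d) : x - Pi.single i 1 ∈ cube 0 l := by
  rw [mem_cube_zero] at *
  intro j
  have := hx j
  by_cases hj : j = i
  · subst hj; simp; omega
  · simp [hj]; omega

theorem update_mem_cube {k : ℕ} {x : Vertex d} (hx : x ∈ cube 0 k) (i : Fin d) {t : ℤ}
    (ht : t ∈ Finset.Icc (-(k : ℤ)) k) : Function.update x i t ∈ cube 0 k := by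
  rw [mem_cube_zero] at *
  intro j
  rw [Finset.mem_Icc] at ht
  by_cases hj : j = i
  · subst hj; simpa using ht
  · simpa [hj] using hx j

/-- The involution `(x, t) ↦ (update x i t, x i)` of the product of the cube with the interval
removes the update. -/
theorem sum_update_cube (k : ℕ) (i : Fin d) (h : Vertex d → ℝ) :
    ∑ x ∈ cube (0 : Vertex d) k, ∑ t ∈ Finset.Icc (-(k : ℤ)) k, h (Function.update x i t)
      = (2 * k + 1) * ∑ x ∈ cube (0 : Vertex d) k, h x := by
  have h1 : ∑ x ∈ cube (0 : Vertex d) k, ∑ t ∈ Finset.Icc (-(k : ℤ)) k, h (Function.update x i t)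
      = ∑ x ∈ cube (0 : Vertex d) k, ∑ t ∈ Finset.Icc (-(k : ℤ)) k, h x := by
    rw [← Finset.sum_product', ← Finset.sum_product']
    refine Finset.sum_nbij' (fun z => (Function.update z.1 i z.2, z.1 i))
      (fun z => (Function.update z.1 i z.2, z.1 i)) ?_ ?_ ?_ ?_ ?_
    · rintro ⟨x, t⟩ hz
      rw [Finset.mem_product] at *
      exact ⟨update_mem_cube hz.1 i hz.2, Finset.mem_Icc.2 (mem_cube_zero.1 hz.1 i)⟩
    · rintro ⟨x, t⟩ hz
      rw [Finset.mem_product] at *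
      exact ⟨update_mem_cube hz.1 i hz.2, Finset.mem_Icc.2 (mem_cube_zero.1 hz.1 i)⟩
    · rintro ⟨x, t⟩ _; simp
    · rintro ⟨x, t⟩ _; simp
    · rintro ⟨x, t⟩ _; simp
  rw [h1, Finset.mul_sum]
  refine Finset.sum_congr rfl fun x _ => ?_
  rw [Finset.sum_const, nsmul_eq_mul, Int.card_Icc]
  congr 1
  have : ((k : ℤ) + 1 - -(k : ℤ)).toNat = 2 * k + 1 := by omega
  rw [this]; push_cast; ring

theorem abs_sub_le_sum_Ico (φ : ℤ → ℝ) {k l a b : ℤ} (ha : k ≤ a) (ha' : a ≤ l) (hb : k ≤ b)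
    (hb' : b ≤ l) : |φ a - φ b| ≤ ∑ t ∈ Finset.Ico k l, |φ (t + 1) - φ t| := by
  have key : ∀ N : ℕ, ∀ a : ℤ, k ≤ a → a + N ≤ l →
      |φ (a + N) - φ a| ≤ ∑ t ∈ Finset.Ico a (a + N), |φ (t + 1) - φ t| := by
    intro N
    induction N with
    | zero => intro a _ _; simp
    | succ N ih =>
      intro a ha hl
      have h1 := ih a ha (by push_cast at hl; omega)
      have h2 : Finset.Ico a (a + ((N + 1 : ℕ) : ℤ)) = insert (a + N) (Finset.Ico a (a + N)) := by
        ext t; simp only [Finset.mem_Ico, Finset.mem_insert]; push_cast; omega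
      rw [h2, Finset.sum_insert (by simp)]
      have h3 : a + ((N + 1 : ℕ) : ℤ) = a + N + 1 := by push_cast; ring
      rw [h3]
      calc |φ (a + N + 1) - φ a| = |(φ (a + N + 1) - φ (a + N)) + (φ (a + N) - φ a)| := by ring_nf
        _ ≤ _ := abs_add_le _ _
        _ ≤ _ := by linarith
  have main : ∀ a b : ℤ, k ≤ a → a ≤ b → b ≤ l →
      |φ b - φ a| ≤ ∑ t ∈ Finset.Ico k l, |φ (t + 1) - φ t| := by
    intro a b ha hab hb
    obtain ⟨N, rfl⟩ : ∃ N : ℕ, b = a + N := ⟨(b - a).toNat, by omega⟩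
    refine (key N a ha hb).trans (Finset.sum_le_sum_of_subset_of_nonneg ?_ fun _ _ _ => abs_nonneg _)
    intro t; simp only [Finset.mem_Ico]; omega
  rcases le_total a b with h | h
  · rw [abs_sub_comm]; exact main a b ha h hb'
  · exact main b a hb h ha'

theorem update_add_single (x : Vertex d) (i : Fin d) (t : ℤ) :
    Function.update x i t + Pi.single i 1 = Function.update x i (t + 1) := by
  ext j
  by_cases hj : j = i
  · subst hj; simp
  · simp [hj]

theorem abs_sub_update_le (f : Vertex d → ℝ) {k : ℕ} {x : Vertex d} (hx : x ∈ cube 0 k)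
    (i : Fin d) {t : ℤ} (ht : t ∈ Finset.Icc (-(k : ℤ)) k) :
    |f x - f (Function.update x i t)|
      ≤ ∑ t ∈ Finset.Ico (-(k : ℤ)) k, |fdiff f i (Function.update x i t)| := by
  have h := abs_sub_le_sum_Ico (fun t => f (Function.update x i t)) (mem_cube_zero.1 hx i).1
    (mem_cube_zero.1 hx i).2 (Finset.mem_Icc.1 ht).1 (Finset.mem_Icc.1 ht).2
  simp only [Function.update_eq_self] at h
  simpa only [fdiff, update_add_single] using h

theorem sum_Ico_le_sum_Icc (k : ℕ) (h : ℤ → ℝ) (hh : ∀ t, 0 ≤ h t) :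
    ∑ t ∈ Finset.Ico (-(k : ℤ)) k, h t ≤ ∑ t ∈ Finset.Icc (-(k : ℤ)) k, h t :=
  Finset.sum_le_sum_of_subset_of_nonneg Finset.Ico_subset_Icc_self fun t _ _ => hh t

/-! ### Summation by parts and the Caccioppoli inequality -/

theorem sum_cube_shift {K : ℕ} {h : Vertex d → ℝ} (hh : ∀ x, x ∉ cube (0 : Vertex d) K → h x = 0)
    (i : Fin d) : ∑ x ∈ cube (0 : Vertex d) (K + 1), h (x + Pi.single i 1)
      = ∑ x ∈ cube (0 : Vertex d) (K + 1), h x := by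
  have h1 : ∑' x : Vertex d, h x = ∑ x ∈ cube (0 : Vertex d) (K + 1), h x :=
    tsum_eq_sum fun x hx => hh x fun h' => hx (cube_mono (Nat.le_succ K) h')
  have h2 : ∑' x : Vertex d, h (x + Pi.single i 1)
      = ∑ x ∈ cube (0 : Vertex d) (K + 1), h (x + Pi.single i 1) := by
    refine tsum_eq_sum fun x hx => hh _ fun h' => hx ?_
    simpa using sub_single_mem_cube (le_refl (K + 1)) h' i
  rw [← h1, ← h2]
  exact (Equiv.addRight (Pi.single i 1 : Vertex d)).tsum_eq h

/-- Shifting the backward half of the generator by `e_i` brings it onto the forward bonds. Radius `K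
+ 1` is needed to include the lower end-point of every bond on which a `φ` supported in radius `K`
varies. -/
theorem sum_mul_generator (ω : Bond d → ℝ) (w φ : Vertex d → ℝ) {K : ℕ}
    (hφ : ∀ x, x ∉ cube (0 : Vertex d) K → φ x = 0) :
    ∑ x ∈ cube (0 : Vertex d) (K + 1), φ x * generator ω w x
      = -∑ x ∈ cube (0 : Vertex d) (K + 1), ∑ i, ω (x, i) * (fdiff w i x * fdiff φ i x) := by
  have h1 : ∀ i : Fin d, ∑ x ∈ cube (0 : Vertex d) (K + 1),
      φ x * (ω (x - Pi.single i 1, i) * (w (x - Pi.single i 1) - w x))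
      = ∑ x ∈ cube (0 : Vertex d) (K + 1),
        φ (x + Pi.single i 1) * (ω (x, i) * (w x - w (x + Pi.single i 1))) := by
    intro i
    have := sum_cube_shift (K := K)
      (h := fun x => φ x * (ω (x - Pi.single i 1, i) * (w (x - Pi.single i 1) - w x)))
      (fun x hx => by simp [hφ x hx]) i
    rw [← this]
    simp
  simp only [generator, Finset.mul_sum, mul_add, Finset.sum_add_distrib]
  have h2 : ∑ x ∈ cube (0 : Vertex d) (K + 1), ∑ i : Fin d,
      φ x * (ω (x - Pi.single i 1, i) * (w (x - Pi.single i 1) - w x))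
      = ∑ x ∈ cube (0 : Vertex d) (K + 1), ∑ i : Fin d,
        φ (x + Pi.single i 1) * (ω (x, i) * (w x - w (x + Pi.single i 1))) := by
    rw [Finset.sum_comm, Finset.sum_congr rfl fun i _ => h1 i, Finset.sum_comm]
  rw [h2, ← Finset.sum_add_distrib, ← Finset.sum_neg_distrib]
  refine Finset.sum_congr rfl fun x _ => ?_
  rw [← Finset.sum_add_distrib, ← Finset.sum_neg_distrib]
  refine Finset.sum_congr rfl fun i _ => ?_
  simp only [fdiff]
  ring

/-- The Caccioppoli inequality for nonnegative subharmonic functions. -/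
theorem caccioppoli {ω : Bond d → ℝ} {w η : Vertex d → ℝ} {K : ℕ}
    (hw : ∀ x, 0 ≤ w x) (hη : ∀ x, x ∉ cube (0 : Vertex d) K → η x = 0)
    (hsub : ∀ x ∈ cube (0 : Vertex d) K, 0 ≤ generator ω w x) :
    ∑ x ∈ cube (0 : Vertex d) (K + 1), ∑ i, ω (x, i) * (fdiff (fun x => η x * w x) i x) ^ 2
      ≤ ∑ x ∈ cube (0 : Vertex d) (K + 1), ∑ i,
        ω (x, i) * (w x * w (x + Pi.single i 1) * (fdiff η i x) ^ 2) := by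
  have h1 := sum_mul_generator ω w (fun x => η x ^ 2 * w x) (K := K)
    (fun x hx => by simp [hη x hx])
  have h2 : 0 ≤ ∑ x ∈ cube (0 : Vertex d) (K + 1), η x ^ 2 * w x * generator ω w x := by
    refine Finset.sum_nonneg fun x _ => ?_
    by_cases hx : x ∈ cube (0 : Vertex d) K
    · exact mul_nonneg (mul_nonneg (sq_nonneg _) (hw x)) (hsub x hx)
    · simp [hη x hx]
  rw [h1] at h2
  rw [← sub_nonneg, ← Finset.sum_sub_distrib]
  -- On each bond `(η'w' - ηw)² - w w' (η' - η)² = (w' - w)(η'² w' - η² w)`, so the two sides differ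
  -- exactly by the tested quantity and no constant is lost.
  refine h2.trans_eq ?_
  rw [← Finset.sum_neg_distrib]
  refine Finset.sum_congr rfl fun x _ => ?_
  rw [← Finset.sum_sub_distrib, ← Finset.sum_neg_distrib]
  refine Finset.sum_congr rfl fun i _ => ?_
  simp only [fdiff]
  ring

/-! ### Convex powers -/

theorem rpow_tangent {a b t : ℝ} (ha : 0 ≤ a) (hb : 0 ≤ b) (ht : 1 ≤ t) :
    a ^ t + t * a ^ (t - 1) * (b - a) ≤ b ^ t := by
  rcases ha.eq_or_lt with rfl | ha
  -- At `a = 0` the slope `0 ^ (t - 1)` is `1` for `t = 1` and `0` for `t > 1`.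
  · rcases ht.eq_or_lt with rfl | ht
    · simp
    · rw [Real.zero_rpow (by linarith), Real.zero_rpow (by linarith)]
      simpa using Real.rpow_nonneg hb t
  · have h := one_add_mul_self_le_rpow_one_add (s := b / a - 1) (p := t)
      (by linarith [div_nonneg hb ha.le]) ht
    have h2 : (1 + (b / a - 1)) ^ t = b ^ t / a ^ t := by
      rw [← Real.div_rpow hb ha.le]; ring_nf
    have h3 : a ^ t = a ^ (t - 1) * a := by
      rw [← Real.rpow_add_one ha.ne']; ring_nf
    rw [h2, le_div_iff₀ (Real.rpow_pos_of_pos ha t)] at h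
    calc _ = (1 + t * (b / a - 1)) * a ^ t := by rw [h3]; field_simp
      _ ≤ _ := h

/-- By convexity each increment of `w ^ t` from `x` is at least the increment of `w` times the slope
`t * w x ^ (t - 1)`, which is the same for all neighbours. -/
theorem generator_rpow_nonneg {ω : Bond d → ℝ} (hω : ∀ e, 0 < ω e) {w : Vertex d → ℝ}
    (hw : ∀ x, 0 ≤ w x) {t : ℝ} (ht : 1 ≤ t) {x : Vertex d} (h : 0 ≤ generator ω w x) :
    0 ≤ generator ω (fun x => w x ^ t) x := by
  have h1 : (t * w x ^ (t - 1)) * generator ω w x ≤ generator ω (fun x => w x ^ t) x := by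
    rw [generator, generator, Finset.mul_sum]
    refine Finset.sum_le_sum fun i _ => ?_
    have e1 := rpow_tangent (hw x) (hw (x + Pi.single i 1)) ht
    have e2 := rpow_tangent (hw x) (hw (x - Pi.single i 1)) ht
    have e3 := mul_le_mul_of_nonneg_left e1 (hω (x, i)).le
    have e4 := mul_le_mul_of_nonneg_left e2 (hω (x - Pi.single i 1, i)).le
    linarith
  refine le_trans (mul_nonneg (mul_nonneg (by linarith) (Real.rpow_nonneg (hw x) _)) h) h1

theorem abs_rpow_sub_rpow_le {a b t : ℝ} (ha : 0 ≤ a) (hb : 0 ≤ b) (ht : 1 ≤ t) :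
    |b ^ t - a ^ t| ≤ t * (a ^ (t - 1) + b ^ (t - 1)) * |b - a| := by
  have h1 := rpow_tangent ha hb ht
  have h2 := rpow_tangent hb ha ht
  have ha' := Real.rpow_nonneg ha (t - 1)
  have hb' := Real.rpow_nonneg hb (t - 1)
  have e1 : t * a ^ (t - 1) * (a - b) ≤ t * a ^ (t - 1) * |b - a| :=
    mul_le_mul_of_nonneg_left (by rw [abs_sub_comm]; exact le_abs_self _) (by positivity)
  have e2 : t * b ^ (t - 1) * (b - a) ≤ t * b ^ (t - 1) * |b - a| :=
    mul_le_mul_of_nonneg_left (le_abs_self _) (by positivity)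
  have e3 : 0 ≤ t * a ^ (t - 1) * |b - a| := by positivity
  have e4 : 0 ≤ t * b ^ (t - 1) * |b - a| := by positivity
  rw [abs_le]
  constructor <;> linarith

/-! ### The logarithm of a positive superharmonic function -/

/-- The maximum norm of a lattice point. -/
def supNorm (x : Vertex d) : ℕ := Finset.univ.sup fun i => (x i).natAbs

theorem mem_cube_iff_supNorm_le {k : ℕ} {x : Vertex d} :
    x ∈ cube (0 : Vertex d) k ↔ supNorm x ≤ k := by
  rw [mem_cube_zero, supNorm, Finset.sup_le_iff]
  refine ⟨fun h i _ => ?_, fun h i => ?_⟩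
  · have := h i; omega
  · have := h i (Finset.mem_univ i); omega

theorem supNorm_add_single_le (x : Vertex d) (i : Fin d) :
    supNorm (x + Pi.single i 1) ≤ supNorm x + 1 :=
  mem_cube_iff_supNorm_le.1 (add_single_mem_cube le_rfl (mem_cube_iff_supNorm_le.2 le_rfl) i)

theorem supNorm_le_add_single (x : Vertex d) (i : Fin d) :
    supNorm x ≤ supNorm (x + Pi.single i 1) + 1 := by
  have := mem_cube_iff_supNorm_le.1 (sub_single_mem_cube le_rfl
    (mem_cube_iff_supNorm_le.2 (le_refl (supNorm (x + Pi.single i 1)))) i)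
  simpa using this

/-- This is the contribution of one bond when the test function is `η² / w`. With `z = log (b / a)`
and `α ≤ β`, the main term is `α² (2 - exp z - exp (-z)) = -4 α² sinh² (z / 2) ≤ -α² z²`, and the
rest carries a factor `β - α`. The case `β ≤ α` follows by exchanging the end-points. -/
theorem log_test_inequality {a b α β : ℝ} (ha : 0 < a) (hb : 0 < b) (hα : 0 ≤ α) (hβ : 0 ≤ β) :
    (b - a) * (β ^ 2 / b - α ^ 2 / a)
      ≤ -(min α β ^ 2 * (Real.log b - Real.log a) ^ 2 / 2) + 3 * (β - α) ^ 2 := by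
  have aux : ∀ {a b α β : ℝ}, 0 < a → 0 < b → 0 ≤ α → α ≤ β →
      (b - a) * (β ^ 2 / b - α ^ 2 / a)
      ≤ -(α ^ 2 * (Real.log b - Real.log a) ^ 2 / 2) + 3 * (β - α) ^ 2 := by
    intro a b α β ha hb hα h
    set z := Real.log b - Real.log a with hz
    have e1 : Real.exp z = b / a := by
      rw [hz, Real.exp_sub, Real.exp_log hb, Real.exp_log ha]
    have e2 : Real.exp (-z) = a / b := by
      rw [Real.exp_neg, e1, inv_div]
    have e3 : z ^ 2 ≤ Real.exp z + Real.exp (-z) - 2 := by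
      have h1 : |z / 2| ≤ |Real.sinh (z / 2)| := by
        rcases le_total 0 z with h | h
        · rw [abs_of_nonneg (by linarith), abs_of_nonneg (Real.sinh_nonneg_iff.2 (by linarith))]
          exact Real.self_le_sinh_iff.2 (by linarith)
        · rw [abs_of_nonpos (by linarith), abs_of_nonpos (Real.sinh_nonpos_iff.2 (by linarith))]
          exact neg_le_neg (Real.sinh_le_self_iff.2 (by linarith))
      have h2 := sq_le_sq.2 h1
      have h3 : Real.exp z = Real.exp (z / 2) * Real.exp (z / 2) := by
        rw [← Real.exp_add]; ring_nf
      have h4 : Real.exp (-z) = Real.exp (-(z / 2)) * Real.exp (-(z / 2)) := by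
        rw [← Real.exp_add]; ring_nf
      have h5 : Real.exp (z / 2) * Real.exp (-(z / 2)) = 1 := by
        rw [← Real.exp_add]; simp
      rw [Real.sinh_eq] at h2
      rw [h3, h4]
      nlinarith
    have e4 : 1 - Real.exp (-z) ≤ z := by
      have := Real.add_one_le_exp (-z); linarith
    have e5 : 0 < Real.exp (-z) := Real.exp_pos _
    have e6 : (b - a) * (β ^ 2 / b - α ^ 2 / a)
        = α ^ 2 * (2 - Real.exp z - Real.exp (-z))
          + (2 * α * (β - α) + (β - α) ^ 2) * (1 - Real.exp (-z)) := by
      rw [e1, e2]; field_simp; ring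
    rw [e6]
    have hh : 0 ≤ β - α := by linarith
    have e7 : α ^ 2 * (2 - Real.exp z - Real.exp (-z)) ≤ α ^ 2 * (-z ^ 2) :=
      mul_le_mul_of_nonneg_left (by linarith) (sq_nonneg _)
    have e8 : (2 * α * (β - α)) * (1 - Real.exp (-z)) ≤ (2 * α * (β - α)) * z :=
      mul_le_mul_of_nonneg_left e4 (by positivity)
    have e9 : (β - α) ^ 2 * (1 - Real.exp (-z)) ≤ (β - α) ^ 2 * 1 :=
      mul_le_mul_of_nonneg_left (by linarith) (sq_nonneg _)
    -- Young's inequality `2α(β - α)z ≤ α²z²/2 + 2(β - α)²` spends half of the good term; adding the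
    -- remaining `(β - α)²` gives the constant `3`.
    nlinarith [sq_nonneg (α * z - 2 * (β - α))]
  rcases le_total α β with h | h
  · rw [min_eq_left h]; exact aux ha hb hα h
  · rw [min_eq_right h]
    have := aux hb ha hβ h
    calc _ = (a - b) * (α ^ 2 / a - β ^ 2 / b) := by ring
      _ ≤ _ := this
      _ = _ := by ring

theorem sum_cube_le_sum_bondsIn {K L : ℕ} (h : K + 1 ≤ L) {F : Bond d → ℝ} (hF : ∀ e, 0 ≤ F e) :
    ∑ x ∈ cube (0 : Vertex d) K, ∑ i, F (x, i) ≤ ∑ e ∈ bondsIn (cube (0 : Vertex d) L), F e := by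
  rw [← Finset.sum_product']
  refine Finset.sum_le_sum_of_subset_of_nonneg ?_ fun e _ _ => hF e
  rintro ⟨x, i⟩ hx
  rw [Finset.mem_product] at hx
  simp only [bondsIn, Finset.mem_filter, Finset.mem_product]
  exact ⟨⟨cube_mono (by omega) hx.1, hx.2⟩, add_single_mem_cube h hx.1 i⟩

/-- The Caccioppoli inequality for the logarithm of a positive superharmonic function. -/
theorem sum_log_sq_le {ω : Bond d → ℝ} (hω : ∀ e, 0 < ω e) {n : ℕ} (hn : 1 ≤ n)
    {w : Vertex d → ℝ} (hw : ∀ x ∈ cube (0 : Vertex d) (4 * n), 0 < w x)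
    (hsup : IsSuperharmonicOn ω w (cube 0 (4 * n))) :
    ∑ x ∈ cube (0 : Vertex d) (2 * n), ∑ i, ω (x, i) * fdiff (fun x => Real.log (w x)) i x ^ 2
      ≤ 6 / (n : ℝ) ^ 2 * ∑ e ∈ bondsIn (cube (0 : Vertex d) (4 * n)), ω e := by
  have hn0 : (0 : ℝ) < n := by exact_mod_cast hn
  -- The cutoff is `1` up to radius `3n` and `0` from radius `4n` on, with slope `1/n`. As `2n + 1 ≤
  -- 3n`, both end-points of a bond that starts in radius `2n` have `η = 1`.
  set η : Vertex d → ℝ := fun x => min 1 (max 0 ((4 * n - supNorm x) / n)) with hη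
  have hη0 : ∀ x, 0 ≤ η x := fun x => le_min zero_le_one (le_max_left _ _)
  have hη1 : ∀ x, x ∈ cube (0 : Vertex d) (3 * n) → η x = 1 := by
    intro x hx
    rw [mem_cube_iff_supNorm_le] at hx
    have hx' : (supNorm x : ℝ) ≤ 3 * n := by exact_mod_cast hx
    refine min_eq_left (le_max_of_le_right ?_)
    rw [le_div_iff₀ hn0]; linarith
  have hηz : ∀ x, x ∉ cube (0 : Vertex d) (4 * n - 1) → η x = 0 := by
    intro x hx
    rw [mem_cube_iff_supNorm_le] at hx
    have hx' : (4 * n : ℝ) ≤ supNorm x := by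
      have : 4 * n ≤ supNorm x := by omega
      exact_mod_cast this
    have : (4 * n - supNorm x : ℝ) / n ≤ 0 := div_nonpos_of_nonpos_of_nonneg (by linarith) hn0.le
    simp only [hη, max_eq_left this]
    simp
  have hηd : ∀ x i, fdiff η i x ^ 2 ≤ 1 / (n : ℝ) ^ 2 := by
    intro x i
    have h1 : |fdiff η i x| ≤ 1 / (n : ℝ) := by
      refine (abs_min_sub_min_le_max _ _ _ _).trans ?_
      rw [sub_self, abs_zero]
      refine max_le (by positivity) ((abs_max_sub_max_le_max _ _ _ _).trans ?_)
      rw [sub_self, abs_zero]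
      refine max_le (by positivity) ?_
      rw [← sub_div, abs_div, abs_of_pos hn0]
      refine div_le_div_of_nonneg_right ?_ hn0.le
      have h1 : (supNorm (x + Pi.single i 1) : ℝ) ≤ supNorm x + 1 := by
        exact_mod_cast supNorm_add_single_le x i
      have h2 : (supNorm x : ℝ) ≤ supNorm (x + Pi.single i 1) + 1 := by
        exact_mod_cast supNorm_le_add_single x i
      rw [abs_le]
      constructor <;> linarith
    have := pow_le_pow_left₀ (abs_nonneg _) h1 2
    rwa [sq_abs, div_pow, one_pow] at this
  have hK : 4 * n - 1 + 1 = 4 * n := by omega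
  have h1 := sum_mul_generator ω w (fun x => η x ^ 2 / w x) (K := 4 * n - 1)
    (fun x hx => by simp [hηz x hx])
  rw [hK] at h1
  have h2 : ∑ x ∈ cube (0 : Vertex d) (4 * n), η x ^ 2 / w x * generator ω w x ≤ 0 := by
    refine Finset.sum_nonpos fun x hx => ?_
    have := hsup x hx
    exact mul_nonpos_of_nonneg_of_nonpos (div_nonneg (sq_nonneg _) (hw x hx).le) (by linarith)
  rw [h1] at h2
  have h3 : ∀ x ∈ cube (0 : Vertex d) (4 * n), ∀ i,
      ω (x, i) * (fdiff w i x * fdiff (fun x => η x ^ 2 / w x) i x)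
      ≤ -((if x ∈ cube (0 : Vertex d) (2 * n) then
          ω (x, i) * fdiff (fun x => Real.log (w x)) i x ^ 2 else 0) / 2)
        + 3 / (n : ℝ) ^ 2 *
          (if x + Pi.single i 1 ∈ cube (0 : Vertex d) (4 * n) then ω (x, i) else 0) := by
    intro x hx i
    by_cases hy : x + Pi.single i 1 ∈ cube (0 : Vertex d) (4 * n)
    · have e1 := log_test_inequality (hw x hx) (hw _ hy) (hη0 x) (hη0 (x + Pi.single i 1))
      have e2 := mul_le_mul_of_nonneg_left e1 (hω (x, i)).le
      rw [if_pos hy]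
      have e3 := mul_le_mul_of_nonneg_left (hηd x i) (hω (x, i)).le
      simp only [fdiff] at e3 ⊢
      have e4 : (if x ∈ cube (0 : Vertex d) (2 * n) then
          ω (x, i) * (Real.log (w (x + Pi.single i 1)) - Real.log (w x)) ^ 2 else 0)
          ≤ ω (x, i) * (min (η x) (η (x + Pi.single i 1)) ^ 2 *
            (Real.log (w (x + Pi.single i 1)) - Real.log (w x)) ^ 2) := by
        have := (hω (x, i)).le
        split_ifs with hx2
        · rw [hη1 x (cube_mono (by omega) hx2), hη1 _ (add_single_mem_cube (by omega) hx2 i)]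
          simp
        · positivity
      have e5 : 3 / (n : ℝ) ^ 2 * ω (x, i) = 3 * (ω (x, i) * (1 / (n : ℝ) ^ 2)) := by ring
      rw [e5]
      calc _ ≤ _ := e2
        _ ≤ _ := by linarith
    -- On a bond that leaves the cube of radius `4n` the cutoff vanishes at both ends, so values of
    -- `w` outside the cube, which may be negative, do not enter.
    · have hx' : x ∉ cube (0 : Vertex d) (4 * n - 1) := fun h =>
        hy (add_single_mem_cube (by omega) h i)
      have hy' : x + Pi.single i 1 ∉ cube (0 : Vertex d) (4 * n - 1) := fun h =>
        hy (cube_mono (by omega) h)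
      have hx2 : x ∉ cube (0 : Vertex d) (2 * n) := fun h => hx' (cube_mono (by omega) h)
      simp [fdiff, hηz x hx', hηz _ hy', hx2, hy]
  have h4 : ∑ x ∈ cube (0 : Vertex d) (4 * n), ∑ i,
      ω (x, i) * (fdiff w i x * fdiff (fun x => η x ^ 2 / w x) i x)
      ≤ ∑ x ∈ cube (0 : Vertex d) (4 * n), ∑ i,
      (-((if x ∈ cube (0 : Vertex d) (2 * n) then
          ω (x, i) * fdiff (fun x => Real.log (w x)) i x ^ 2 else 0) / 2)
        + 3 / (n : ℝ) ^ 2 *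
          (if x + Pi.single i 1 ∈ cube (0 : Vertex d) (4 * n) then ω (x, i) else 0)) :=
    Finset.sum_le_sum fun x hx => Finset.sum_le_sum fun i _ => h3 x hx i
  simp only [Finset.sum_add_distrib, ← Finset.mul_sum, Finset.sum_neg_distrib,
    ← Finset.sum_div] at h4
  have h5 : ∑ x ∈ cube (0 : Vertex d) (4 * n), ∑ i : Fin d,
      (if x + Pi.single i 1 ∈ cube (0 : Vertex d) (4 * n) then ω (x, i) else 0)
      = ∑ e ∈ bondsIn (cube (0 : Vertex d) (4 * n)), ω e := by
    rw [bondsIn, Finset.sum_filter, Finset.sum_product]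
    rfl
  have h6 : ∑ x ∈ cube (0 : Vertex d) (4 * n), ∑ i : Fin d,
      (if x ∈ cube (0 : Vertex d) (2 * n) then
          ω (x, i) * fdiff (fun x => Real.log (w x)) i x ^ 2 else 0)
      = ∑ x ∈ cube (0 : Vertex d) (2 * n), ∑ i,
        ω (x, i) * fdiff (fun x => Real.log (w x)) i x ^ 2 := by
    rw [← Finset.sum_subset (cube_mono (by omega : 2 * n ≤ 4 * n))]
    · refine Finset.sum_congr rfl fun x hx => Finset.sum_congr rfl fun i _ => ?_
      rw [if_pos hx]
    · intro x _ hx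
      simp [hx]
  rw [h5, h6] at h4
  have e : 6 / (n : ℝ) ^ 2 = 2 * (3 / (n : ℝ) ^ 2) := by ring
  rw [e, mul_assoc]
  linarith

/-- The positive part of `log (ε / w)`. -/
noncomputable def logDefect (ε : ℝ) (w : Vertex d → ℝ) (x : Vertex d) : ℝ :=
  max 0 (Real.log ε - Real.log (w x))

theorem logDefect_nonneg (ε : ℝ) (w : Vertex d → ℝ) (x : Vertex d) : 0 ≤ logDefect ε w x :=
  le_max_left _ _

theorem logDefect_eq_zero {ε : ℝ} (hε : 0 < ε) {w : Vertex d → ℝ} {x : Vertex d} (h : ε ≤ w x) :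
    logDefect ε w x = 0 :=
  max_eq_left (sub_nonpos.2 (Real.log_le_log hε h))

theorem mul_exp_neg_logDefect_le {ε : ℝ} (hε : 0 < ε) {w : Vertex d → ℝ} {x : Vertex d}
    (h : 0 < w x) : ε * Real.exp (-logDefect ε w x) ≤ w x := by
  have h1 : Real.log ε - Real.log (w x) ≤ logDefect ε w x := le_max_right _ _
  calc ε * Real.exp (-logDefect ε w x) ≤ ε * Real.exp (Real.log (w x) - Real.log ε) :=
        mul_le_mul_of_nonneg_left (Real.exp_le_exp.2 (by linarith)) hε.le
    _ = w x := by rw [Real.exp_sub, Real.exp_log h, Real.exp_log hε]; field_simp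

theorem fdiff_logDefect_sq_le (ε : ℝ) (w : Vertex d → ℝ) (i : Fin d) (x : Vertex d) :
    fdiff (logDefect ε w) i x ^ 2 ≤ fdiff (fun x => Real.log (w x)) i x ^ 2 := by
  rw [sq_le_sq]
  refine (abs_max_sub_max_le_max _ _ _ _).trans ?_
  rw [sub_self, abs_zero]
  refine max_le (abs_nonneg _) (le_of_eq ?_)
  rw [fdiff, abs_sub_comm]
  congr 1
  ring

/-- Where the defect is zero it is minimal. Elsewhere `log w y - log w x ≤ (w y - w x) / w x` bounds
its increments below by `-1 / w x` times those of `w`. -/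
theorem generator_logDefect_nonneg {ω : Bond d → ℝ} (hω : ∀ e, 0 < ω e) (ε : ℝ)
    {w : Vertex d → ℝ} {x : Vertex d} (hx : 0 < w x)
    (hp : ∀ i, 0 < w (x + Pi.single i 1)) (hm : ∀ i, 0 < w (x - Pi.single i 1))
    (h : 0 ≤ -generator ω w x) : 0 ≤ generator ω (logDefect ε w) x := by
  by_cases hz : logDefect ε w x = 0
  · refine Finset.sum_nonneg fun i _ => ?_
    rw [hz]
    have h1 := mul_nonneg (hω (x, i)).le (logDefect_nonneg ε w (x + Pi.single i 1))
    have h2 := mul_nonneg (hω (x - Pi.single i 1, i)).le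
      (logDefect_nonneg ε w (x - Pi.single i 1))
    simpa using add_nonneg h1 h2
  · have hv : logDefect ε w x = Real.log ε - Real.log (w x) := by
      rcases max_choice 0 (Real.log ε - Real.log (w x)) with h' | h'
      · exact absurd h' hz
      · exact h'
    have key : ∀ y, 0 < w y → -(w x)⁻¹ * (w y - w x) ≤ logDefect ε w y - logDefect ε w x := by
      intro y hy
      have h1 : Real.log ε - Real.log (w y) ≤ logDefect ε w y := le_max_right _ _
      have h2 : Real.log (w y) - Real.log (w x) ≤ w y / w x - 1 := by
        rw [← Real.log_div hy.ne' hx.ne']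
        exact Real.log_le_sub_one_of_pos (div_pos hy hx)
      have h3 : -(w x)⁻¹ * (w y - w x) = -(w y / w x - 1) := by field_simp
      rw [h3, hv]
      linarith
    have h1 : -(w x)⁻¹ * generator ω w x ≤ generator ω (logDefect ε w) x := by
      rw [generator, generator, Finset.mul_sum]
      refine Finset.sum_le_sum fun i _ => ?_
      have e3 := mul_le_mul_of_nonneg_left (key _ (hp i)) (hω (x, i)).le
      have e4 := mul_le_mul_of_nonneg_left (key _ (hm i)) (hω (x - Pi.single i 1, i)).le
      linarith
    refine le_trans ?_ h1
    rw [neg_mul_comm]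
    exact mul_nonneg (inv_nonneg.2 hx.le) h

/-! ### Poincaré inequalities -/

theorem abs_sub_update_rpow_le (f : Vertex d → ℝ) {k : ℕ} {x : Vertex d} (hx : x ∈ cube 0 k)
    (i : Fin d) {t : ℤ} (ht : t ∈ Finset.Icc (-(k : ℤ)) k) {s : ℝ} (hs : 1 ≤ s) :
    |f x - f (Function.update x i t)| ^ s ≤ (2 * k + 1 : ℝ) ^ (s - 1) *
      ∑ t ∈ Finset.Icc (-(k : ℤ)) k, |fdiff f i (Function.update x i t)| ^ s := by
  have h1 := (abs_sub_update_le f hx i ht).trans (sum_Ico_le_sum_Icc k _ fun t => abs_nonneg _)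
  have h2 := Real.rpow_le_rpow (abs_nonneg _) h1 (by linarith : 0 ≤ s)
  refine h2.trans ((Real.rpow_sum_le_const_mul_sum_rpow _ _ hs).trans (le_of_eq ?_))
  congr 2
  rw [Int.card_Icc]
  have : ((k : ℤ) + 1 - -(k : ℤ)).toNat = 2 * k + 1 := by omega
  rw [this]; push_cast; ring

/-- Each point is joined along direction `i` to the face `x i = k + 1`, where `f` vanishes. -/
theorem sum_rpow_le_of_zero_boundary {f : Vertex d → ℝ} {k : ℕ}
    (hf : ∀ x, x ∉ cube (0 : Vertex d) k → f x = 0) (i : Fin d) {s : ℝ} (hs : 1 ≤ s) :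
    ∑ x ∈ cube (0 : Vertex d) (k + 1), |f x| ^ s ≤ (2 * (k + 1 : ℕ) + 1 : ℝ) ^ s *
      ∑ x ∈ cube (0 : Vertex d) (k + 1), |fdiff f i x| ^ s := by
  have h1 : ∀ x ∈ cube (0 : Vertex d) (k + 1), |f x| ^ s ≤ (2 * (k + 1 : ℕ) + 1 : ℝ) ^ (s - 1) *
      ∑ t ∈ Finset.Icc (-((k + 1 : ℕ) : ℤ)) (k + 1 : ℕ),
        |fdiff f i (Function.update x i t)| ^ s := by
    intro x hx
    have := abs_sub_update_rpow_le f hx i (t := (k + 1 : ℕ)) (by simp; omega) hs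
    rwa [hf (Function.update x i ((k + 1 : ℕ) : ℤ)), sub_zero] at this
    intro h
    have := (mem_cube_zero.1 h i).2
    simp at this
  refine (Finset.sum_le_sum h1).trans (le_of_eq ?_)
  rw [← Finset.mul_sum, sum_update_cube (k + 1) i (fun x => |fdiff f i x| ^ s), ← mul_assoc,
    ← Real.rpow_add_one (by positivity)]
  ring_nf

/-- The lattice point that agrees with `y` in the first `j` coordinates and with `x` in the
others. -/
def splice (j : ℕ) (x y : Vertex d) : Vertex d := fun l => if (l : ℕ) < j then y l else x l

theorem splice_mem_cube {k : ℕ} {x y : Vertex d} (hx : x ∈ cube 0 k) (hy : y ∈ cube 0 k) (j : ℕ) :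
    splice j x y ∈ cube 0 k := by
  rw [mem_cube_zero] at *
  intro l
  unfold splice
  split_ifs
  · exact hy l
  · exact hx l

theorem splice_splice (j : ℕ) (x y : Vertex d) : splice j (splice j x y) (splice j y x) = x := by
  funext l
  unfold splice
  split_ifs <;> rfl

theorem splice_succ (i : Fin d) (x y : Vertex d) :
    splice ((i : ℕ) + 1) x y = Function.update (splice i x y) i (splice i y x i) := by
  funext l
  by_cases h : l = i
  · subst h; simp [splice]
  · have : (l : ℕ) ≠ i := fun h' => h (Fin.ext h')
    have e : (l : ℕ) < i + 1 ↔ (l : ℕ) < i := by omega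
    simp [splice, h, e]

/-- Coordinates of `x` are changed into those of `y` one at a time. The involution `(x, y) ↦ (splice
i x y, splice i y x)` of pairs turns the `i`-th increment into a difference along a single
coordinate line through `x`. -/
theorem sum_sum_abs_sub_rpow_le (f : Vertex d → ℝ) (k : ℕ) {s : ℝ} (hs : 1 ≤ s) :
    ∑ x ∈ cube (0 : Vertex d) k, ∑ y ∈ cube (0 : Vertex d) k, |f x - f y| ^ s
      ≤ (d : ℝ) ^ (s - 1) * ((cube (0 : Vertex d) k).card * ((2 * k + 1 : ℝ) ^ s *
        ∑ x ∈ cube (0 : Vertex d) k, ∑ i, |fdiff f i x| ^ s)) := by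
  have h1 : ∀ x y : Vertex d, |f x - f y| ^ s ≤ (d : ℝ) ^ (s - 1) *
      ∑ i : Fin d, |f (splice i x y) - f (splice ((i : ℕ) + 1) x y)| ^ s := by
    intro x y
    have e1 : f x - f y = ∑ i : Fin d, (f (splice i x y) - f (splice ((i : ℕ) + 1) x y)) := by
      rw [Fin.sum_univ_eq_sum_range (fun i => f (splice i x y) - f (splice (i + 1) x y)),
        Finset.sum_range_sub']
      congr 2
      · funext l
        simp [splice]
    rw [e1]
    have e2 := Real.rpow_le_rpow (abs_nonneg _) (Finset.abs_sum_le_sum_abs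
      (fun i : Fin d => f (splice i x y) - f (splice ((i : ℕ) + 1) x y)) Finset.univ)
      (by linarith : 0 ≤ s)
    refine e2.trans ((Real.rpow_sum_le_const_mul_sum_rpow _ _ hs).trans (le_of_eq ?_))
    simp
  have h2 : ∀ i : Fin d, ∑ x ∈ cube (0 : Vertex d) k, ∑ y ∈ cube (0 : Vertex d) k,
      |f (splice i x y) - f (splice ((i : ℕ) + 1) x y)| ^ s
      ≤ (cube (0 : Vertex d) k).card * ((2 * k + 1 : ℝ) ^ s *
        ∑ x ∈ cube (0 : Vertex d) k, |fdiff f i x| ^ s) := by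
    intro i
    have e1 : ∑ x ∈ cube (0 : Vertex d) k, ∑ y ∈ cube (0 : Vertex d) k,
        |f (splice i x y) - f (splice ((i : ℕ) + 1) x y)| ^ s
        = ∑ x ∈ cube (0 : Vertex d) k, ∑ y ∈ cube (0 : Vertex d) k,
        |f x - f (Function.update x i (y i))| ^ s := by
      rw [← Finset.sum_product', ← Finset.sum_product']
      refine Finset.sum_nbij' (fun z => (splice i z.1 z.2, splice i z.2 z.1))
        (fun z => (splice i z.1 z.2, splice i z.2 z.1)) ?_ ?_ ?_ ?_ ?_
      · rintro ⟨x, y⟩ hz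
        rw [Finset.mem_product] at *
        exact ⟨splice_mem_cube hz.1 hz.2 i, splice_mem_cube hz.2 hz.1 i⟩
      · rintro ⟨x, y⟩ hz
        rw [Finset.mem_product] at *
        exact ⟨splice_mem_cube hz.1 hz.2 i, splice_mem_cube hz.2 hz.1 i⟩
      · rintro ⟨x, y⟩ _; simp [splice_splice]
      · rintro ⟨x, y⟩ _; simp [splice_splice]
      · rintro ⟨x, y⟩ _; simp only [splice_succ]
    rw [e1]
    have e2 : ∀ x ∈ cube (0 : Vertex d) k, ∀ y ∈ cube (0 : Vertex d) k,
        |f x - f (Function.update x i (y i))| ^ s ≤ (2 * k + 1 : ℝ) ^ (s - 1) *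
        ∑ t ∈ Finset.Icc (-(k : ℤ)) k, |fdiff f i (Function.update x i t)| ^ s := fun x hx y hy =>
      abs_sub_update_rpow_le f hx i (Finset.mem_Icc.2 (mem_cube_zero.1 hy i)) hs
    refine (Finset.sum_le_sum fun x hx => Finset.sum_le_sum fun y hy => e2 x hx y hy).trans
      (le_of_eq ?_)
    simp only [Finset.sum_const, nsmul_eq_mul]
    rw [← Finset.mul_sum, ← Finset.mul_sum,
      sum_update_cube k i (fun x => |fdiff f i x| ^ s), ← mul_assoc ((2 * k + 1 : ℝ) ^ (s - 1)),
      ← Real.rpow_add_one (by positivity)]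
    ring_nf
  calc _ ≤ ∑ x ∈ cube (0 : Vertex d) k, ∑ y ∈ cube (0 : Vertex d) k, (d : ℝ) ^ (s - 1) *
      ∑ i : Fin d, |f (splice i x y) - f (splice ((i : ℕ) + 1) x y)| ^ s :=
        Finset.sum_le_sum fun x _ => Finset.sum_le_sum fun y _ => h1 x y
    _ = (d : ℝ) ^ (s - 1) * ∑ i : Fin d, ∑ x ∈ cube (0 : Vertex d) k,
        ∑ y ∈ cube (0 : Vertex d) k,
        |f (splice i x y) - f (splice ((i : ℕ) + 1) x y)| ^ s := by
        simp only [← Finset.mul_sum]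
        congr 1
        exact (Finset.sum_congr rfl fun x _ => Finset.sum_comm).trans Finset.sum_comm
    _ ≤ (d : ℝ) ^ (s - 1) * ∑ i : Fin d, (cube (0 : Vertex d) k).card * ((2 * k + 1 : ℝ) ^ s *
        ∑ x ∈ cube (0 : Vertex d) k, |fdiff f i x| ^ s) :=
        mul_le_mul_of_nonneg_left (Finset.sum_le_sum fun i _ => h2 i) (by positivity)
    _ = _ := by
        rw [← Finset.mul_sum, ← Finset.mul_sum, Finset.sum_comm]

/-- The Poincaré inequality for functions that vanish on a fixed fraction of the cube. -/
theorem poincare_of_zero_set {f : Vertex d → ℝ} {k : ℕ} {s l : ℝ} (hs : 1 ≤ s) (hl : 0 < l)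
    {A : Finset (Vertex d)} (hA : A ⊆ cube 0 k) (hAz : ∀ x ∈ A, f x = 0)
    (hcard : l * (cube (0 : Vertex d) k).card ≤ A.card) :
    ∑ x ∈ cube (0 : Vertex d) k, |f x| ^ s ≤ l⁻¹ * ((d : ℝ) ^ (s - 1) * ((2 * k + 1 : ℝ) ^ s *
        ∑ x ∈ cube (0 : Vertex d) k, ∑ i, |fdiff f i x| ^ s)) := by
  have h1 := sum_sum_abs_sub_rpow_le f k hs
  have hpos : (0 : ℝ) < (cube (0 : Vertex d) k).card := by
    exact_mod_cast Finset.card_pos.2 ⟨0, zero_mem_cube k⟩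
  have hS : 0 ≤ ∑ x ∈ cube (0 : Vertex d) k, |f x| ^ s :=
    Finset.sum_nonneg fun x _ => by positivity
  have h2 : l * (cube (0 : Vertex d) k).card * ∑ x ∈ cube (0 : Vertex d) k, |f x| ^ s
      ≤ ∑ x ∈ cube (0 : Vertex d) k, ∑ y ∈ cube (0 : Vertex d) k, |f x - f y| ^ s := by
    calc _ ≤ (A.card : ℝ) * ∑ x ∈ cube (0 : Vertex d) k, |f x| ^ s :=
          mul_le_mul_of_nonneg_right hcard hS
      _ = ∑ x ∈ cube (0 : Vertex d) k, ∑ y ∈ A, |f x - f y| ^ s := by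
          rw [Finset.mul_sum]
          refine Finset.sum_congr rfl fun x _ => ?_
          rw [Finset.sum_congr rfl (g := fun _ => |f x| ^ s) fun y hy => by rw [hAz y hy, sub_zero]]
          simp
      _ ≤ _ := Finset.sum_le_sum fun x _ => Finset.sum_le_sum_of_subset_of_nonneg hA
          fun y _ _ => by positivity
  rw [inv_mul_eq_div, le_div_iff₀ hl]
  refine le_of_mul_le_mul_left ?_ hpos
  calc _ = l * (cube (0 : Vertex d) k).card * ∑ x ∈ cube (0 : Vertex d) k, |f x| ^ s := by ring
    _ ≤ _ := h2.trans h1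
    _ = _ := by ring

/-! ### Sobolev inequalities on cubes -/

theorem pi_count_int {ι : Type*} [Fintype ι] :
    MeasureTheory.Measure.pi (fun _ : ι => (MeasureTheory.Measure.count : MeasureTheory.Measure ℤ))
      = MeasureTheory.Measure.count := by
  refine MeasureTheory.Measure.ext_of_singleton fun x => ?_
  rw [MeasureTheory.Measure.pi_singleton]
  simp

/-- The grid-lines inequality behind the Gagliardo-Nirenberg-Sobolev inequality on a cube. -/
theorem sum_rpow_le_of_le_line_sum {m : ℕ} (hm : 2 ≤ m) {k : ℕ} {F H : Vertex m → ℝ}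
    (hF : ∀ x, 0 ≤ F x) (hH : ∀ x, 0 ≤ H x)
    (h : ∀ x ∈ cube (0 : Vertex m) k, ∀ i,
      F x ≤ ∑ t ∈ Finset.Icc (-(k : ℤ)) k, H (Function.update x i t)) :
    ∑ x ∈ cube (0 : Vertex m) k, F x ^ ((m : ℝ) / (m - 1))
      ≤ (∑ x ∈ cube (0 : Vertex m) k, H x) ^ ((m : ℝ) / (m - 1)) := by
  classical
  have hm1 : (0 : ℝ) < m - 1 := by
    have : (2 : ℝ) ≤ m := by exact_mod_cast hm
    linarith
  have hθ : (0 : ℝ) ≤ (m : ℝ) / (m - 1) := by positivity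
  have hconj : Real.HolderConjugate (Fintype.card (Fin m) : ℝ) ((m : ℝ) / (m - 1)) := by
    rw [Fintype.card_fin]
    exact Real.HolderConjugate.conjExponent (by linarith)
  -- Extending `H` by zero turns the integrals over full lattice lines into sums over the cube.
  set f : Vertex m → ℝ≥0∞ := fun x => if x ∈ cube (0 : Vertex m) k then ENNReal.ofReal (H x) else 0
    with hf
  have h1 := MeasureTheory.lintegral_prod_lintegral_pow_le
    (fun _ : Fin m => (MeasureTheory.Measure.count : MeasureTheory.Measure ℤ)) hconj
    (f := f) (measurable_of_countable f)
  rw [pi_count_int, MeasureTheory.lintegral_count, MeasureTheory.lintegral_count,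
    Fintype.card_fin] at h1
  simp only [MeasureTheory.lintegral_count] at h1
  have h2 : ∑' x, f x = ENNReal.ofReal (∑ x ∈ cube (0 : Vertex m) k, H x) := by
    rw [ENNReal.ofReal_sum_of_nonneg fun x _ => hH x, tsum_eq_sum (s := cube (0 : Vertex m) k)]
    · exact Finset.sum_congr rfl fun x hx => by rw [hf]; simp [hx]
    · intro x hx
      simp [hf, hx]
  have h3 : ∀ x ∈ cube (0 : Vertex m) k, ∀ i,
      ENNReal.ofReal (F x) ≤ ∑' t, f (Function.update x i t) := by
    intro x hx i
    refine le_trans (ENNReal.ofReal_le_ofReal (h x hx i)) ?_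
    rw [ENNReal.ofReal_sum_of_nonneg fun t _ => hH _]
    refine le_trans (le_of_eq (Finset.sum_congr rfl fun t ht => ?_)) (ENNReal.sum_le_tsum _)
    simp [hf, update_mem_cube hx i ht]
  -- `F ^ (m / (m - 1))` is a product of `m` factors `F ^ (1 / (m - 1))`; the `i`-th is estimated by
  -- the line sum in direction `i`.
  have h4 : ENNReal.ofReal (∑ x ∈ cube (0 : Vertex m) k, F x ^ ((m : ℝ) / (m - 1)))
      ≤ ∑' x, ∏ i : Fin m, (∑' t, f (Function.update x i t)) ^ ((1 : ℝ) / ((m : ℝ) - 1)) := by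
    rw [ENNReal.ofReal_sum_of_nonneg fun x _ => Real.rpow_nonneg (hF x) _]
    refine le_trans (Finset.sum_le_sum fun x hx => ?_)
      (ENNReal.sum_le_tsum (cube (0 : Vertex m) k))
    calc ENNReal.ofReal (F x ^ ((m : ℝ) / (m - 1)))
        = ∏ i : Fin m, ENNReal.ofReal (F x) ^ ((1 : ℝ) / ((m : ℝ) - 1)) := by
          rw [Finset.prod_const, Finset.card_univ, Fintype.card_fin, ← ENNReal.rpow_mul_natCast,
            ENNReal.ofReal_rpow_of_nonneg (hF x) (by positivity)]
          congr 2
          field_simp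
      _ ≤ _ := Finset.prod_le_prod' fun i _ => ENNReal.rpow_le_rpow (h3 x hx i) (by positivity)
  have h5 := h4.trans h1
  rw [h2, ENNReal.ofReal_rpow_of_nonneg (Finset.sum_nonneg fun x _ => hH x) hθ] at h5
  exact (ENNReal.ofReal_le_ofReal_iff (Real.rpow_nonneg (Finset.sum_nonneg fun x _ => hH x) _)).1 h5

theorem card_Icc_neg_self (k : ℕ) : ((Finset.Icc (-(k : ℤ)) k).card : ℝ) = 2 * k + 1 := by
  rw [Int.card_Icc]
  have : ((k : ℤ) + 1 - -(k : ℤ)).toNat = 2 * k + 1 := by omega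
  rw [this]; push_cast; ring

/-- The inequality `f x ≤ |f x - f y| + f y` is averaged over the points `y` of the line. The mean
value term takes the place of a zero boundary condition. -/
theorem le_line_sum (f : Vertex d → ℝ) {k : ℕ} {x : Vertex d} (hx : x ∈ cube 0 k) (i : Fin d) :
    f x ≤ ∑ t ∈ Finset.Ico (-(k : ℤ)) k, |fdiff f i (Function.update x i t)|
      + (2 * k + 1 : ℝ)⁻¹ * ∑ t ∈ Finset.Icc (-(k : ℤ)) k, f (Function.update x i t) := by
  have hN : (0 : ℝ) < 2 * k + 1 := by positivity
  have h1 : ∑ t ∈ Finset.Icc (-(k : ℤ)) k, f x ≤ ∑ t ∈ Finset.Icc (-(k : ℤ)) k,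
      (∑ t ∈ Finset.Ico (-(k : ℤ)) k, |fdiff f i (Function.update x i t)|
        + f (Function.update x i t)) := by
    refine Finset.sum_le_sum fun t ht => ?_
    have := (abs_le.1 (abs_sub_update_le f hx i ht)).2
    linarith
  rw [Finset.sum_add_distrib, Finset.sum_const, Finset.sum_const, nsmul_eq_mul, nsmul_eq_mul,
    card_Icc_neg_self] at h1
  rw [inv_mul_eq_div, ← sub_le_iff_le_add', le_div_iff₀ hN]
  linarith

/-- The size of the forward difference, set to zero on bonds that leave the cube of radius `k`. -/
noncomputable def innerDiff (k : ℕ) (f : Vertex d → ℝ) (i : Fin d) (x : Vertex d) : ℝ :=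
  if x i < k then |fdiff f i x| else 0

theorem innerDiff_nonneg (k : ℕ) (f : Vertex d → ℝ) (i : Fin d) (x : Vertex d) :
    0 ≤ innerDiff k f i x := by
  unfold innerDiff
  split_ifs
  · exact abs_nonneg _
  · exact le_rfl

theorem innerDiff_le (k : ℕ) (f : Vertex d → ℝ) (i : Fin d) (x : Vertex d) :
    innerDiff k f i x ≤ |fdiff f i x| := by
  unfold innerDiff
  split_ifs
  · exact le_rfl
  · exact abs_nonneg _

/-- The Sobolev inequality from `W^{1,1}` on a cube. -/
theorem sobolev_one {m : ℕ} (hm : 2 ≤ m) {k : ℕ} {f : Vertex m → ℝ} (hf : ∀ x, 0 ≤ f x) :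
    ∑ x ∈ cube (0 : Vertex m) k, f x ^ ((m : ℝ) / (m - 1))
      ≤ (∑ i, ∑ x ∈ cube (0 : Vertex m) k, innerDiff k f i x
        + (2 * k + 1 : ℝ)⁻¹ * ∑ x ∈ cube (0 : Vertex m) k, f x) ^ ((m : ℝ) / (m - 1)) := by
  have h := sum_rpow_le_of_le_line_sum hm (k := k) (F := f)
    (H := fun x => ∑ i, innerDiff k f i x + (2 * k + 1 : ℝ)⁻¹ * f x) hf
    (fun x => add_nonneg (Finset.sum_nonneg fun i _ => innerDiff_nonneg k f i x)
      (mul_nonneg (by positivity) (hf x))) ?_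
  · rwa [Finset.sum_add_distrib, Finset.sum_comm, ← Finset.mul_sum] at h
  · intro x hx i
    refine (le_line_sum f hx i).trans ?_
    rw [Finset.sum_add_distrib, ← Finset.mul_sum]
    refine add_le_add_left ?_ _
    calc ∑ t ∈ Finset.Ico (-(k : ℤ)) k, |fdiff f i (Function.update x i t)|
        = ∑ t ∈ Finset.Ico (-(k : ℤ)) k, innerDiff k f i (Function.update x i t) := by
          refine Finset.sum_congr rfl fun t ht => ?_
          rw [Finset.mem_Ico] at ht
          simp [innerDiff, ht.2]
      _ ≤ ∑ t ∈ Finset.Icc (-(k : ℤ)) k, innerDiff k f i (Function.update x i t) :=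
          sum_Ico_le_sum_Icc k _ fun t => innerDiff_nonneg _ _ _ _
      _ ≤ _ := Finset.sum_le_sum fun t _ => Finset.single_le_sum
          (f := fun i => innerDiff k f i (Function.update x _ t))
          (fun j _ => innerDiff_nonneg _ _ _ _) (Finset.mem_univ i)

theorem rpow_sum_rpow_le {ι : Type*} (S : Finset ι) {a : ι → ℝ} (ha : ∀ i ∈ S, 0 ≤ a i)
    {s t : ℝ} (hs : 0 < s) (hst : s ≤ t) :
    (∑ i ∈ S, a i ^ s) ^ (1 / s)
      ≤ (S.card : ℝ) ^ (1 / s - 1 / t) * (∑ i ∈ S, a i ^ t) ^ (1 / t) := by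
  have ht : 0 < t := hs.trans_le hst
  have h0 : 0 ≤ ∑ i ∈ S, a i ^ s := Finset.sum_nonneg fun i hi => Real.rpow_nonneg (ha i hi) _
  have h0' : 0 ≤ ∑ i ∈ S, a i ^ t := Finset.sum_nonneg fun i hi => Real.rpow_nonneg (ha i hi) _
  have h1 := Real.rpow_sum_le_const_mul_sum_rpow_of_nonneg (s := S) (f := fun i => a i ^ s)
    (p := t / s) ((one_le_div hs).2 hst) (fun i hi => Real.rpow_nonneg (ha i hi) _)
  have h2 : ∑ i ∈ S, (a i ^ s) ^ (t / s) = ∑ i ∈ S, a i ^ t :=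
    Finset.sum_congr rfl fun i hi => by
      rw [← Real.rpow_mul (ha i hi), mul_div_cancel₀ _ hs.ne']
  rw [h2] at h1
  have h3 := Real.rpow_le_rpow (Real.rpow_nonneg h0 _) h1 (by positivity : 0 ≤ 1 / t)
  rw [Real.mul_rpow (by positivity) h0', ← Real.rpow_mul h0,
    ← Real.rpow_mul (by positivity)] at h3
  convert h3 using 2
  · field_simp
  · congr 1; field_simp

/-- Hölder's inequality with exponents `r / (t - 1)` and `s`. The bound `Y` is a separate variable
because the lemma is also used for a shifted function on part of a cube. -/
theorem sum_rpow_mul_le {ι : Type*} (S : Finset ι) {a b : ι → ℝ} (ha : ∀ i, 0 ≤ a i)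
    (hb : ∀ i, 0 ≤ b i) {r s t Y : ℝ} (hs : 1 < s) (ht : 1 < t) (hr : 0 < r)
    (hrs : 1 - 1 / s = (t - 1) / r) (hY : ∑ i ∈ S, a i ^ r ≤ Y) :
    ∑ i ∈ S, a i ^ (t - 1) * b i ≤ Y ^ (1 - 1 / s) * (∑ i ∈ S, b i ^ s) ^ (1 / s) := by
  have ht1 : 0 < t - 1 := by linarith
  have hconj : Real.HolderConjugate (r / (t - 1)) s := by
    rw [Real.holderConjugate_comm, Real.holderConjugate_iff]
    refine ⟨hs, ?_⟩
    rw [inv_div, ← hrs]; ring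
  have h := Real.inner_le_Lp_mul_Lq_of_nonneg S hconj (f := fun i => a i ^ (t - 1)) (g := b)
    (fun i _ => Real.rpow_nonneg (ha i) _) (fun i _ => hb i)
  refine h.trans (mul_le_mul_of_nonneg_right ?_ (Real.rpow_nonneg
    (Finset.sum_nonneg fun i _ => Real.rpow_nonneg (hb i) _) _))
  have e : ∑ i ∈ S, (a i ^ (t - 1)) ^ (r / (t - 1)) = ∑ i ∈ S, a i ^ r :=
    Finset.sum_congr rfl fun i _ => by rw [← Real.rpow_mul (ha i), mul_div_cancel₀ _ ht1.ne']
  rw [e, one_div_div, ← hrs]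
  refine Real.rpow_le_rpow (Finset.sum_nonneg fun i _ => Real.rpow_nonneg (ha i) _) hY ?_
  rw [hrs]; positivity

/-- The Sobolev inequality on a cube. -/
theorem sobolev_cube {m : ℕ} (hm : 2 ≤ m) {r s : ℝ} (hr : 2 < r) (hs : 1 / s = 1 / r + 1 / m)
    {k : ℕ} {f : Vertex m → ℝ} (hf : ∀ x, 0 ≤ f x) :
    (∑ x ∈ cube (0 : Vertex m) k, f x ^ r) ^ (1 / r)
      ≤ 2 * r * ∑ i, (∑ x ∈ cube (0 : Vertex m) k, |fdiff f i x| ^ s) ^ (1 / s)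
        + (2 * k + 1 : ℝ)⁻¹ * (∑ x ∈ cube (0 : Vertex m) k, f x ^ s) ^ (1 / s) := by
  have hm2 : (2 : ℝ) ≤ m := by exact_mod_cast hm
  have hm0 : (0 : ℝ) < m := by linarith
  have hm1 : (0 : ℝ) < m - 1 := by linarith
  have hr0 : 0 < r := by linarith
  have hs0 : 0 < s := by
    have : 0 < 1 / s := by rw [hs]; positivity
    exact one_div_pos.1 this
  have hs1 : 1 < s := by
    have h1 : 1 / r < 1 / 2 := one_div_lt_one_div_of_lt two_pos hr
    have h2 : 1 / (m : ℝ) ≤ 1 / 2 := one_div_le_one_div_of_le two_pos hm2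
    have h3 : 1 / s < 1 / 1 := by rw [hs]; linarith
    exact (one_div_lt_one_div hs0 one_pos).1 h3
  set θ : ℝ := (m : ℝ) / (m - 1) with hθ
  have hθ0 : 0 < θ := by positivity
  have hθ1 : 1 ≤ θ := by rw [hθ, le_div_iff₀ hm1]; linarith
  have hθ2 : θ ≤ 2 := by rw [hθ, div_le_iff₀ hm1]; linarith
  -- The `W^{1,1}` inequality is applied to `f ^ t`, with `t` such that `(f ^ t) ^ θ = f ^ r`.
  set t : ℝ := r / θ with ht
  have ht1 : 1 < t := by rw [ht, lt_div_iff₀ hθ0]; linarith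
  have htr : t ≤ r := by rw [ht, div_le_iff₀ hθ0]; nlinarith
  have hrs : 1 - 1 / s = (t - 1) / r := by
    rw [hs, ht, hθ]; field_simp; ring
  set Y : ℝ := ∑ x ∈ cube (0 : Vertex m) k, f x ^ r with hY
  have hY0 : 0 ≤ Y := Finset.sum_nonneg fun x _ => Real.rpow_nonneg (hf x) _
  have hD0 : ∀ i : Fin m, 0 ≤ ∑ x ∈ cube (0 : Vertex m) k, |fdiff f i x| ^ s := fun i =>
    Finset.sum_nonneg fun x _ => by positivity
  have hF0 : 0 ≤ ∑ x ∈ cube (0 : Vertex m) k, f x ^ s :=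
    Finset.sum_nonneg fun x _ => Real.rpow_nonneg (hf x) _
  set D : Fin m → ℝ := fun i => (∑ x ∈ cube (0 : Vertex m) k, |fdiff f i x| ^ s) ^ (1 / s) with hD
  set Z : ℝ := (∑ x ∈ cube (0 : Vertex m) k, f x ^ s) ^ (1 / s) with hZ
  have hDnn : ∀ i, 0 ≤ D i := fun i => Real.rpow_nonneg (hD0 i) _
  have hZnn : 0 ≤ Z := Real.rpow_nonneg hF0 _
  have hIn : ∀ i, (∑ x ∈ cube (0 : Vertex m) k, innerDiff k f i x ^ s) ^ (1 / s) ≤ D i := by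
    intro i
    refine Real.rpow_le_rpow (Finset.sum_nonneg fun x _ =>
      Real.rpow_nonneg (innerDiff_nonneg _ _ _ _) _) (Finset.sum_le_sum fun x _ => ?_)
      (by positivity)
    exact Real.rpow_le_rpow (innerDiff_nonneg _ _ _ _) (innerDiff_le _ _ _ _) hs0.le
  have h1 := sobolev_one hm (k := k) (f := fun x => f x ^ t) fun x => Real.rpow_nonneg (hf x) _
  have e1 : ∑ x ∈ cube (0 : Vertex m) k, (f x ^ t) ^ θ = Y :=
    Finset.sum_congr rfl fun x _ => by
      rw [← Real.rpow_mul (hf x), ht, div_mul_cancel₀ _ hθ0.ne']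
  rw [← hθ, e1] at h1
  have h2 : ∑ x ∈ cube (0 : Vertex m) k, f x ^ t ≤ Y ^ (1 - 1 / s) * Z := by
    have := sum_rpow_mul_le (cube (0 : Vertex m) k) hf hf hs1 ht1 hr0 hrs le_rfl
    refine le_trans (le_of_eq (Finset.sum_congr rfl fun x _ => ?_)) this
    rcases (hf x).eq_or_lt with h | h
    · rw [← h, Real.zero_rpow (by linarith)]; simp
    · rw [← Real.rpow_add_one h.ne']; ring_nf
  have h3 : ∀ i, ∑ x ∈ cube (0 : Vertex m) k, innerDiff k (fun x => f x ^ t) i x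
      ≤ Y ^ (1 - 1 / s) * (2 * r * D i) := by
    intro i
    have a1 : ∑ x ∈ cube (0 : Vertex m) k, f x ^ (t - 1) * innerDiff k f i x
        ≤ Y ^ (1 - 1 / s) * D i := by
      refine (sum_rpow_mul_le (cube (0 : Vertex m) k) hf (fun x => innerDiff_nonneg k f i x)
        hs1 ht1 hr0 hrs le_rfl).trans ?_
      exact mul_le_mul_of_nonneg_left (hIn i) (Real.rpow_nonneg hY0 _)
    have a2 : ∑ x ∈ cube (0 : Vertex m) k, f (x + Pi.single i 1) ^ (t - 1) * innerDiff k f i x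
        ≤ Y ^ (1 - 1 / s) * D i := by
      -- The sum of the shifted function is at most `Y` only as long as `x + e_i` stays in the cube,
      -- which is why `innerDiff` drops the bonds that leave it.
      have b1 : ∑ x ∈ (cube (0 : Vertex m) k).filter (fun x => x i < (k : ℤ)),
          f (x + Pi.single i 1) ^ r ≤ Y := by
        rw [← Finset.sum_image (s := (cube (0 : Vertex m) k).filter (fun x => x i < (k : ℤ)))
          (g := fun x => x + Pi.single i 1) (f := fun x => f x ^ r)
          (fun x _ y _ h => add_right_cancel h)]
        refine Finset.sum_le_sum_of_subset_of_nonneg ?_ fun x _ _ => Real.rpow_nonneg (hf x) _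
        intro y hy
        obtain ⟨x, hx, rfl⟩ := Finset.mem_image.1 hy
        rw [Finset.mem_filter, mem_cube_zero] at hx
        rw [mem_cube_zero]
        intro j
        have := hx.1 j
        by_cases hj : j = i
        · subst hj; simp; omega
        · simpa [hj] using this
      have b2 := sum_rpow_mul_le ((cube (0 : Vertex m) k).filter (fun x => x i < (k : ℤ)))
        (a := fun x => f (x + Pi.single i 1)) (fun x => hf _)
        (fun x => innerDiff_nonneg k f i x) hs1 ht1 hr0 hrs b1
      have b3 : ∑ x ∈ cube (0 : Vertex m) k, f (x + Pi.single i 1) ^ (t - 1) * innerDiff k f i x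
          = ∑ x ∈ (cube (0 : Vertex m) k).filter (fun x => x i < (k : ℤ)),
            f (x + Pi.single i 1) ^ (t - 1) * innerDiff k f i x := by
        rw [Finset.sum_filter]
        refine Finset.sum_congr rfl fun x _ => ?_
        unfold innerDiff
        split_ifs <;> simp
      rw [b3]
      refine b2.trans (mul_le_mul_of_nonneg_left (le_trans ?_ (hIn i)) (Real.rpow_nonneg hY0 _))
      refine Real.rpow_le_rpow (Finset.sum_nonneg fun x _ =>
        Real.rpow_nonneg (innerDiff_nonneg _ _ _ _) _) ?_ (by positivity)
      exact Finset.sum_le_sum_of_subset_of_nonneg (Finset.filter_subset _ _)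
        fun x _ _ => Real.rpow_nonneg (innerDiff_nonneg _ _ _ _) _
    calc ∑ x ∈ cube (0 : Vertex m) k, innerDiff k (fun x => f x ^ t) i x
        ≤ ∑ x ∈ cube (0 : Vertex m) k, t * (f x ^ (t - 1) * innerDiff k f i x
          + f (x + Pi.single i 1) ^ (t - 1) * innerDiff k f i x) := by
          refine Finset.sum_le_sum fun x _ => ?_
          unfold innerDiff
          split_ifs
          · refine (abs_rpow_sub_rpow_le (hf x) (hf _) ht1.le).trans (le_of_eq ?_)
            simp only [fdiff]; ring
          · simp
      _ = t * (∑ x ∈ cube (0 : Vertex m) k, f x ^ (t - 1) * innerDiff k f i x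
          + ∑ x ∈ cube (0 : Vertex m) k, f (x + Pi.single i 1) ^ (t - 1) * innerDiff k f i x) := by
          rw [← Finset.mul_sum, Finset.sum_add_distrib]
      _ ≤ r * (Y ^ (1 - 1 / s) * D i + Y ^ (1 - 1 / s) * D i) := by
          have := mul_nonneg (Real.rpow_nonneg hY0 (1 - 1 / s)) (hDnn i)
          refine (mul_le_mul_of_nonneg_left (add_le_add a1 a2) (by linarith)).trans
            (mul_le_mul_of_nonneg_right htr (by linarith))
      _ = _ := by ring
  set W : ℝ := 2 * r * ∑ i, D i + (2 * k + 1 : ℝ)⁻¹ * Z with hW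
  have hW0 : 0 ≤ W := add_nonneg (mul_nonneg (by linarith) (Finset.sum_nonneg fun i _ => hDnn i))
    (mul_nonneg (by positivity) hZnn)
  have h4 : Y ≤ (Y ^ (1 - 1 / s) * W) ^ θ := by
    refine h1.trans (Real.rpow_le_rpow ?_ ?_ hθ0.le)
    · exact add_nonneg (Finset.sum_nonneg fun i _ => Finset.sum_nonneg fun x _ =>
        innerDiff_nonneg _ _ _ _) (mul_nonneg (by positivity)
        (Finset.sum_nonneg fun x _ => Real.rpow_nonneg (hf x) _))
    · have c1 := Finset.sum_le_sum fun i (_ : i ∈ Finset.univ) => h3 i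
      have c2 := mul_le_mul_of_nonneg_left h2 (by positivity : (0 : ℝ) ≤ (2 * k + 1 : ℝ)⁻¹)
      rw [← Finset.mul_sum, ← Finset.mul_sum] at c1
      calc _ ≤ _ := add_le_add c1 c2
        _ = _ := by rw [hW]; ring
  -- If `Y > 0`, the factor `Y ^ (1 - 1 / s)` cancels from `Y ^ (1 / θ)` and leaves `Y ^ (1 / r)`.
  rcases hY0.eq_or_lt with h | h
  · rw [← h, Real.zero_rpow (by positivity)]
    exact hW0
  · have h5 := Real.rpow_le_rpow hY0 h4 (by positivity : 0 ≤ 1 / θ)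
    have hYW : 0 ≤ Y ^ (1 - 1 / s) * W := mul_nonneg (Real.rpow_nonneg hY0 _) hW0
    rw [← Real.rpow_mul hYW, mul_one_div_cancel hθ0.ne', Real.rpow_one] at h5
    have h6 : Y ^ (1 / θ) = Y ^ (1 - 1 / s) * Y ^ (1 / r) := by
      rw [← Real.rpow_add h]
      congr 1
      rw [hrs, ht]; field_simp; ring
    rw [h6] at h5
    exact le_of_mul_le_mul_left h5 (Real.rpow_pos_of_pos h _)

/-- The energy density of `f` at scale `n` with exponent `s`. -/
noncomputable def density (n : ℕ) (s : ℝ) (f : Vertex d → ℝ) (x : Vertex d) : ℝ :=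
  (n : ℝ) ^ s * ∑ i, |fdiff f i x| ^ s + |f x| ^ s

theorem density_nonneg (n : ℕ) (s : ℝ) (f : Vertex d → ℝ) (x : Vertex d) :
    0 ≤ density n s f x := by
  unfold density
  have : 0 ≤ ∑ i, |fdiff f i x| ^ s := Finset.sum_nonneg fun i _ => by positivity
  positivity

/-- The scale-invariant subcritical Sobolev inequality on a cube. -/
theorem sobolev_density {m : ℕ} (hm : 2 ≤ m) {r s : ℝ} (hr : 2 < r) (hs0 : 0 < s)
    (hs : 1 / s ≤ 1 / r + 1 / m) :
    ∃ C : ℝ, 0 < C ∧ ∀ n k : ℕ, 1 ≤ n → n ≤ k → k ≤ 2 * n → ∀ f : Vertex m → ℝ, (∀ x, 0 ≤ f x) →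
      ∑ x ∈ cube (0 : Vertex m) k, f x ^ r ≤ C * (n : ℝ) ^ (m : ℝ) *
        ((n : ℝ) ^ (-(m : ℝ)) * ∑ x ∈ cube (0 : Vertex m) k, density n s f x) ^ (r / s) := by
  have hm2 : (2 : ℝ) ≤ m := by exact_mod_cast hm
  have hr0 : 0 < r := by linarith
  -- `σ` is the critical exponent for `r`. Passing from `σ` to the larger `s` by power means costs
  -- `M ^ (1 / σ - 1 / s)`, where `M` is the number of points.
  set σ : ℝ := (1 / r + 1 / m)⁻¹ with hσ
  have hσ0 : 0 < σ := by positivity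
  have hσ' : 1 / σ = 1 / r + 1 / m := by rw [hσ, one_div, inv_inv]
  have hσs : σ ≤ s := by
    rw [← hσ'] at hs
    exact (one_div_le_one_div hs0 hσ0).1 hs
  set e : ℝ := 1 / σ - 1 / s with he
  have he0 : 0 ≤ e := by rw [he, hσ']; linarith
  refine ⟨(2 * r * m + 1) ^ r * ((5 : ℝ) ^ m) ^ (e * r), by positivity, ?_⟩
  intro n k hn hnk hk f hf
  have hn0 : (0 : ℝ) < n := by exact_mod_cast hn
  set X : ℝ := ∑ x ∈ cube (0 : Vertex m) k, density n s f x with hX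
  have hX0 : 0 ≤ X := Finset.sum_nonneg fun x _ => density_nonneg n s f x
  set M : ℝ := ((cube (0 : Vertex m) k).card : ℝ) with hM
  have hM0 : 0 ≤ M := by positivity
  have hMle : M ≤ 5 ^ m * (n : ℝ) ^ (m : ℝ) := by
    rw [hM, card_cube_zero, Real.rpow_natCast, ← mul_pow]
    push_cast
    refine pow_le_pow_left₀ (by positivity) ?_ m
    have h1 : (k : ℝ) ≤ 2 * n := by exact_mod_cast hk
    have h2 : (1 : ℝ) ≤ n := by exact_mod_cast hn
    linarith
  have h1 := sobolev_cube hm hr hσ' (k := k) hf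
  have hD : ∀ i, (∑ x ∈ cube (0 : Vertex m) k, |fdiff f i x| ^ σ) ^ (1 / σ)
      ≤ M ^ e * ((n : ℝ)⁻¹ * X ^ (1 / s)) := by
    intro i
    refine (rpow_sum_rpow_le _ (fun x _ => abs_nonneg _) hσ0 hσs).trans ?_
    refine mul_le_mul_of_nonneg_left ?_ (by positivity)
    have a1 : ∑ x ∈ cube (0 : Vertex m) k, |fdiff f i x| ^ s ≤ (n : ℝ) ^ (-s) * X := by
      rw [hX, Finset.mul_sum]
      refine Finset.sum_le_sum fun x _ => ?_
      have b1 : |fdiff f i x| ^ s ≤ ∑ i, |fdiff f i x| ^ s :=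
        Finset.single_le_sum (f := fun i => |fdiff f i x| ^ s) (fun j _ => by positivity)
          (Finset.mem_univ i)
      have b2 : 0 ≤ (n : ℝ) ^ (-s) * |f x| ^ s := by positivity
      have b3 : (n : ℝ) ^ (-s) * (n : ℝ) ^ s = 1 := by
        rw [← Real.rpow_add hn0]; simp
      rw [density, mul_add, ← mul_assoc, b3, one_mul]
      linarith
    refine (Real.rpow_le_rpow (Finset.sum_nonneg fun x _ => by positivity) a1
      (by positivity)).trans (le_of_eq ?_)
    rw [Real.mul_rpow (by positivity) hX0, ← Real.rpow_mul hn0.le, ← Real.rpow_neg_one (n : ℝ)]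
    congr 2
    field_simp
  have hZ : (2 * k + 1 : ℝ)⁻¹ * (∑ x ∈ cube (0 : Vertex m) k, f x ^ σ) ^ (1 / σ)
      ≤ M ^ e * ((n : ℝ)⁻¹ * X ^ (1 / s)) := by
    have a1 := rpow_sum_rpow_le (cube (0 : Vertex m) k) (fun x _ => hf x) hσ0 hσs
    have a2 : (∑ x ∈ cube (0 : Vertex m) k, f x ^ s) ^ (1 / s) ≤ X ^ (1 / s) := by
      refine Real.rpow_le_rpow (Finset.sum_nonneg fun x _ => Real.rpow_nonneg (hf x) _)
        (Finset.sum_le_sum fun x _ => ?_) (by positivity)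
      have : 0 ≤ (n : ℝ) ^ s * ∑ i, |fdiff f i x| ^ s :=
        mul_nonneg (by positivity) (Finset.sum_nonneg fun i _ => by positivity)
      rw [density, abs_of_nonneg (hf x)]
      linarith
    have a3 : (2 * k + 1 : ℝ)⁻¹ ≤ (n : ℝ)⁻¹ := by
      refine inv_anti₀ hn0 ?_
      have : (n : ℝ) ≤ k := by exact_mod_cast hnk
      linarith
    calc _ ≤ (n : ℝ)⁻¹ * (M ^ e * X ^ (1 / s)) :=
          mul_le_mul a3 (a1.trans (mul_le_mul_of_nonneg_left a2 (by positivity)))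
            (Real.rpow_nonneg (Finset.sum_nonneg fun x _ => Real.rpow_nonneg (hf x) _) _)
            (by positivity)
      _ = _ := by ring
  have h2 : (∑ x ∈ cube (0 : Vertex m) k, f x ^ r) ^ (1 / r)
      ≤ (2 * r * m + 1) * (M ^ e * ((n : ℝ)⁻¹ * X ^ (1 / s))) := by
    refine h1.trans ?_
    have a1 := Finset.sum_le_sum fun i (_ : i ∈ Finset.univ) => hD i
    rw [Finset.sum_const, Finset.card_univ, Fintype.card_fin, nsmul_eq_mul] at a1
    have a2 := mul_le_mul_of_nonneg_left a1 (by linarith : 0 ≤ 2 * r)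
    linarith
  have hY0 : 0 ≤ ∑ x ∈ cube (0 : Vertex m) k, f x ^ r :=
    Finset.sum_nonneg fun x _ => Real.rpow_nonneg (hf x) _
  have h3 := Real.rpow_le_rpow (Real.rpow_nonneg hY0 _) h2 hr0.le
  rw [← Real.rpow_mul hY0, one_div_mul_cancel hr0.ne', Real.rpow_one] at h3
  refine h3.trans ?_
  have h4 : M ^ e ≤ (5 ^ m) ^ e * (n : ℝ) ^ (m * e) := by
    refine (Real.rpow_le_rpow hM0 hMle he0).trans (le_of_eq ?_)
    rw [Real.mul_rpow (by positivity) (by positivity), ← Real.rpow_mul hn0.le]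
  have h5 : (2 * r * m + 1) * (M ^ e * ((n : ℝ)⁻¹ * X ^ (1 / s)))
      ≤ (2 * r * m + 1) * (((5 ^ m) ^ e * (n : ℝ) ^ (m * e)) * ((n : ℝ)⁻¹ * X ^ (1 / s))) := by
    gcongr
  refine (Real.rpow_le_rpow (by positivity) h5 hr0.le).trans (le_of_eq ?_)
  rw [Real.mul_rpow (by positivity) (by positivity), Real.mul_rpow (by positivity) (by positivity),
    Real.mul_rpow (by positivity) (by positivity), Real.mul_rpow (by positivity) (by positivity),
    Real.mul_rpow (x := (n : ℝ) ^ (-(m : ℝ))) (by positivity) hX0,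
    ← Real.rpow_mul (by positivity), ← Real.rpow_mul hn0.le, ← Real.rpow_mul hX0,
    ← Real.rpow_mul hn0.le, ← Real.rpow_neg_one (n : ℝ), ← Real.rpow_mul hn0.le]
  have e1 : (n : ℝ) ^ (m * e * r) * (n : ℝ) ^ (-1 * r)
      = (n : ℝ) ^ (m : ℝ) * (n : ℝ) ^ (-(m : ℝ) * (r / s)) := by
    rw [← Real.rpow_add hn0, ← Real.rpow_add hn0]
    congr 1
    rw [he, hσ']; field_simp; ring
  have e2 : 1 / s * r = r / s := by ring
  rw [e2]
  calc _ = (2 * r * m + 1) ^ r * (5 ^ m) ^ (e * r) *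
        ((n : ℝ) ^ (m * e * r) * (n : ℝ) ^ (-1 * r)) * X ^ (r / s) := by ring
    _ = _ := by rw [e1]; ring

/-! ### Hölder against the inverse weight, good layers and the radial cutoff -/

/-- Hölder's inequality with exponents `2` and `2q` for `|∇φ| = (√ω |∇φ|) · √(ω⁻¹)`. -/
theorem sum_fdiff_rpow_le {ω : Bond d → ℝ} (hω : ∀ e, 0 < ω e) (S : Finset (Vertex d))
    (φ : Vertex d → ℝ) {q s : ℝ} (hq : 0 < q) (hs : 1 / s = 1 / 2 + 1 / (2 * q)) :
    ∑ x ∈ S, ∑ i, |fdiff φ i x| ^ s ≤ (∑ x ∈ S, ∑ i, ω (x, i) * fdiff φ i x ^ 2) ^ (s / 2) *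
      (∑ x ∈ S, ∑ i, (ω (x, i))⁻¹ ^ q) ^ (s / (2 * q)) := by
  have ht : Real.HolderTriple 2 (2 * q) s :=
    ⟨by simpa [one_div, mul_comm] using hs.symm, by norm_num, by linarith⟩
  have h := Real.Lr_rpow_le_Lp_mul_Lq_of_nonneg (S ×ˢ (Finset.univ : Finset (Fin d))) ht
    (f := fun e => √(ω e) * |fdiff φ e.2 e.1|) (g := fun e => √((ω e)⁻¹))
    (fun e _ => by positivity) (fun e _ => by positivity)
  have h1 : ∀ e : Bond d, (√(ω e) * |fdiff φ e.2 e.1| * √((ω e)⁻¹)) ^ s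
      = |fdiff φ e.2 e.1| ^ s := by
    intro e
    congr 1
    rw [Real.sqrt_inv]
    have := Real.sqrt_pos.2 (hω e)
    field_simp
  have h2 : ∀ e : Bond d, (√(ω e) * |fdiff φ e.2 e.1|) ^ (2 : ℝ)
      = ω e * fdiff φ e.2 e.1 ^ 2 := by
    intro e
    rw [Real.rpow_two, mul_pow, Real.sq_sqrt (hω _).le, sq_abs]
  have h3 : ∀ e : Bond d, √((ω e)⁻¹) ^ (2 * q) = (ω e)⁻¹ ^ q := by
    intro e
    rw [Real.sqrt_eq_rpow, ← Real.rpow_mul (inv_pos.2 (hω e)).le]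
    congr 1
    ring
  simp only [h1, h2, h3, Finset.sum_product] at h
  exact h

theorem four_mul_card_filter_lt_le (K : Finset ℕ) {A : ℕ → ℝ} (hA : ∀ k, 0 ≤ A k) {a : ℝ}
    (ha : ∑ k ∈ K, A k ≤ a) (hK : 0 < K.card) :
    4 * ((K.filter fun k => 4 * a / K.card < A k).card : ℝ) ≤ K.card := by
  have hK' : (0 : ℝ) < K.card := by exact_mod_cast hK
  have ha0 : 0 ≤ a := (Finset.sum_nonneg fun k _ => hA k).trans ha
  rcases ha0.eq_or_lt with h | h
  · have : K.filter (fun k => 4 * a / K.card < A k) = ∅ := by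
      refine Finset.filter_eq_empty_iff.2 fun {k} hk => ?_
      have h1 := Finset.single_le_sum (fun k _ => hA k) hk
      rw [← h]
      simp only [mul_zero, zero_div, not_lt]
      linarith
    rw [this]; simp
  · have h1 : ((K.filter fun k => 4 * a / K.card < A k).card : ℝ) * (4 * a / K.card) ≤ a := by
      rw [← nsmul_eq_mul]
      refine (Finset.card_nsmul_le_sum _ A _ fun k hk => (Finset.mem_filter.1 hk).2.le).trans ?_
      exact (Finset.sum_le_sum_of_subset_of_nonneg (Finset.filter_subset _ _)
        fun k _ _ => hA k).trans ha
    rw [mul_div_assoc', div_le_iff₀ hK'] at h1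
    have h2 : 4 * ((K.filter fun k => 4 * a / K.card < A k).card : ℝ) * a ≤ K.card * a := by
      linarith
    exact le_of_mul_le_mul_right h2 h

/-- Chebyshev selection: two nonnegative functions are simultaneously at most four times their
mean on at least half of the indices. -/
theorem exists_good_subset (K : Finset ℕ) {A T : ℕ → ℝ} (hA : ∀ k, 0 ≤ A k) (hT : ∀ k, 0 ≤ T k)
    {a t : ℝ} (ha : ∑ k ∈ K, A k ≤ a) (ht : ∑ k ∈ K, T k ≤ t) (hK : 0 < K.card) :
    ∃ G ⊆ K, (K.card : ℝ) ≤ 2 * G.card ∧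
      ∀ k ∈ G, A k ≤ 4 * a / K.card ∧ T k ≤ 4 * t / K.card := by
  classical
  have h1 := four_mul_card_filter_lt_le K hA ha hK
  have h2 := four_mul_card_filter_lt_le K hT ht hK
  set B₁ := K.filter fun k => 4 * a / K.card < A k with hB₁
  set B₂ := K.filter fun k => 4 * t / K.card < T k with hB₂
  refine ⟨(K \ B₁) \ B₂, ?_, ?_, ?_⟩
  · exact Finset.sdiff_subset.trans Finset.sdiff_subset
  · have e1 := Finset.le_card_sdiff B₁ K
    have e2 := Finset.le_card_sdiff B₂ (K \ B₁)
    have e3 : K.card ≤ ((K \ B₁) \ B₂).card + B₁.card + B₂.card := by omega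
    have e4 : (K.card : ℝ) ≤ ((K \ B₁) \ B₂).card + B₁.card + B₂.card := by exact_mod_cast e3
    linarith
  · intro k hk
    simp only [hB₁, hB₂, Finset.mem_sdiff, Finset.mem_filter, not_and, not_lt] at hk
    exact ⟨hk.1.2 hk.1.1, hk.2 hk.1.1⟩

/-- The bonds between the spheres of radius `k` and `k + 1`, with lower end-point in the cube of
radius `N`. -/
noncomputable def layer (N k : ℕ) : Finset (Bond d) :=
  (cube (0 : Vertex d) N ×ˢ Finset.univ).filter fun e =>
    min (supNorm e.1) (supNorm (e.1 + Pi.single e.2 1)) = k ∧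
      max (supNorm e.1) (supNorm (e.1 + Pi.single e.2 1)) = k + 1

/-- The radial cutoff that decreases by the same amount across each of the layers in `G`. -/
noncomputable def layerCutoff (G : Finset ℕ) (x : Vertex d) : ℝ :=
  ((G.filter fun k => supNorm x ≤ k).card : ℝ) / G.card

theorem layerCutoff_eq_one {G : Finset ℕ} (hG : 0 < G.card) {x : Vertex d}
    (h : ∀ k ∈ G, supNorm x ≤ k) : layerCutoff G x = 1 := by
  rw [layerCutoff, Finset.filter_true_of_mem h]
  have : (0 : ℝ) < G.card := by exact_mod_cast hG
  field_simp

theorem layerCutoff_eq_zero {G : Finset ℕ} {x : Vertex d}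
    (h : ∀ k ∈ G, k < supNorm x) : layerCutoff G x = 0 := by
  rw [layerCutoff, Finset.filter_false_of_mem fun k hk => not_le.2 (h k hk)]
  simp

theorem card_filter_le_eq (G : Finset ℕ) (j : ℕ) :
    ((G.filter fun k => j ≤ k).card : ℝ)
      = (G.filter fun k => j + 1 ≤ k).card + if j ∈ G then 1 else 0 := by
  split_ifs with h
  · have : G.filter (fun k => j ≤ k) = insert j (G.filter fun k => j + 1 ≤ k) := by
      ext k
      simp only [Finset.mem_filter, Finset.mem_insert]
      constructor
      · rintro ⟨h1, h2⟩
        rcases h2.eq_or_lt with h3 | h3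
        · exact Or.inl h3.symm
        · exact Or.inr ⟨h1, h3⟩
      · rintro (rfl | ⟨h1, h2⟩)
        · exact ⟨h, le_rfl⟩
        · exact ⟨h1, by omega⟩
    rw [this, Finset.card_insert_of_notMem (by simp)]
    push_cast; ring
  · have : G.filter (fun k => j ≤ k) = G.filter fun k => j + 1 ≤ k := by
      refine Finset.filter_congr fun k hk => ?_
      constructor
      · intro h2
        rcases h2.eq_or_lt with h3 | h3
        · exact absurd (h3 ▸ hk) h
        · exact h3
      · intro h2; omega
    rw [this, add_zero]

/-- One lattice step changes the maximum norm by at most one, so a bond crosses at most one layer,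
and the cutoff changes by `1 / |G|` if that layer is in `G` and not at all otherwise. -/
theorem fdiff_layerCutoff_sq_le (G : Finset ℕ) {N : ℕ} {x : Vertex d} (hx : x ∈ cube 0 N)
    (i : Fin d) : fdiff (layerCutoff G) i x ^ 2
      ≤ ((G.card : ℝ) ^ 2)⁻¹ * ∑ k ∈ G, if ((x, i) : Bond d) ∈ layer N k then 1 else 0 := by
  have h1 := supNorm_add_single_le x i
  have h2 := supNorm_le_add_single x i
  have key : ∀ j : ℕ, ((x, i) : Bond d) ∈ layer N j →
      ((if j ∈ G then (1 : ℝ) else 0) / G.card) ^ 2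
      ≤ ((G.card : ℝ) ^ 2)⁻¹ * ∑ k ∈ G, if ((x, i) : Bond d) ∈ layer N k then 1 else 0 := by
    intro j hj
    split_ifs with hjG
    · rw [div_pow, one_pow, one_div]
      refine le_mul_of_one_le_right (by positivity) ?_
      have := Finset.single_le_sum
        (f := fun k => if ((x, i) : Bond d) ∈ layer N k then (1 : ℝ) else 0)
        (fun k _ => by split_ifs <;> norm_num) hjG
      simpa [hj] using this
    · have : (0 : ℝ) ≤ ∑ k ∈ G, if ((x, i) : Bond d) ∈ layer N k then 1 else 0 :=
        Finset.sum_nonneg fun k _ => by split_ifs <;> norm_num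
      rw [zero_div, zero_pow two_ne_zero]
      exact mul_nonneg (by positivity) this
  rcases Nat.lt_trichotomy (supNorm x) (supNorm (x + Pi.single i 1)) with h | h | h
  · have e : supNorm (x + Pi.single i 1) = supNorm x + 1 := by omega
    refine le_trans (le_of_eq ?_) (key (supNorm x) ?_)
    · rw [fdiff, layerCutoff, layerCutoff, e, card_filter_le_eq G (supNorm x)]
      ring
    · simp [layer, hx, e]
  · refine le_trans (le_of_eq ?_) (mul_nonneg (by positivity)
      (Finset.sum_nonneg fun k _ => by split_ifs <;> norm_num))
    rw [fdiff, layerCutoff, layerCutoff, h]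
    simp
  · have e : supNorm x = supNorm (x + Pi.single i 1) + 1 := by omega
    refine le_trans (le_of_eq ?_) (key (supNorm (x + Pi.single i 1)) ?_)
    · rw [fdiff, layerCutoff, layerCutoff, e, card_filter_le_eq G (supNorm (x + Pi.single i 1))]
      ring
    · simp [layer, hx, e]

theorem sum_sum_layer_le (K : Finset ℕ) (N : ℕ) {F : Bond d → ℝ} (hF : ∀ e, 0 ≤ F e) :
    ∑ k ∈ K, ∑ e ∈ layer N k, F e ≤ ∑ x ∈ cube (0 : Vertex d) N, ∑ i, F (x, i) := by
  classical
  rw [← Finset.sum_product', ← Finset.sum_biUnion]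
  · refine Finset.sum_le_sum_of_subset_of_nonneg ?_ fun e _ _ => hF e
    intro e he
    obtain ⟨k, _, hk⟩ := Finset.mem_biUnion.1 he
    exact (Finset.mem_filter.1 hk).1
  · intro k _ l _ hkl
    refine Finset.disjoint_left.2 fun e he he' => hkl ?_
    have h1 := (Finset.mem_filter.1 he).2.1
    have h2 := (Finset.mem_filter.1 he').2.1
    omega

/-! ### Spheres, their faces and the Sobolev inequality on them -/

/-- The sphere of radius `k` in the maximum norm. -/
noncomputable def sphere (d k : ℕ) : Finset (Vertex d) := (cube (0 : Vertex d) k).filter fun x => supNorm x = k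

theorem mem_sphere {k : ℕ} {x : Vertex d} : x ∈ sphere d k ↔ supNorm x = k := by
  rw [sphere, Finset.mem_filter, mem_cube_iff_supNorm_le]
  omega

/-- A vertex of the two bounding spheres is the lower end-point of at most `d` bonds and the upper
end-point of at most `d`. -/
theorem sum_layer_le (N k : ℕ) {F : Vertex d → ℝ} (hF : ∀ x, 0 ≤ F x) :
    ∑ e ∈ layer N k, (F e.1 + F (e.1 + Pi.single e.2 1))
      ≤ 2 * d * (∑ x ∈ sphere d k, F x + ∑ x ∈ sphere d (k + 1), F x) := by
  classical
  have hdisj : Disjoint (sphere d k) (sphere d (k + 1)) := by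
    refine Finset.disjoint_left.2 fun x hx hx' => ?_
    rw [mem_sphere] at hx hx'
    omega
  rw [← Finset.sum_union hdisj, Finset.sum_add_distrib]
  set U := sphere d k ∪ sphere d (k + 1) with hU
  have hmem : ∀ e ∈ layer (d := d) N k, e.1 ∈ U ∧ e.1 + Pi.single e.2 1 ∈ U := by
    intro e he
    have := (Finset.mem_filter.1 he).2
    rw [hU, Finset.mem_union, Finset.mem_union, mem_sphere, mem_sphere, mem_sphere, mem_sphere]
    omega
  have h1 : ∑ e ∈ layer (d := d) N k, F e.1 ≤ d * ∑ x ∈ U, F x := by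
    calc ∑ e ∈ layer (d := d) N k, F e.1 ≤ ∑ e ∈ U ×ˢ (Finset.univ : Finset (Fin d)), F e.1 := by
          refine Finset.sum_le_sum_of_subset_of_nonneg (fun e he => ?_) fun e _ _ => hF _
          exact Finset.mem_product.2 ⟨(hmem e he).1, Finset.mem_univ _⟩
      _ = _ := by
          rw [Finset.sum_product]
          simp [Finset.mul_sum]
  have h2 : ∑ e ∈ layer (d := d) N k, F (e.1 + Pi.single e.2 1) ≤ d * ∑ x ∈ U, F x := by
    have hinj : Function.Injective
        (fun e : Bond d => ((e.1 + Pi.single e.2 1, e.2) : Bond d)) := by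
      rintro ⟨x, i⟩ ⟨y, j⟩ h
      simp only [Prod.mk.injEq] at h
      obtain ⟨h1, rfl⟩ := h
      rw [add_right_cancel h1]
    calc ∑ e ∈ layer (d := d) N k, F (e.1 + Pi.single e.2 1)
        = ∑ e ∈ (layer (d := d) N k).image
            (fun e : Bond d => ((e.1 + Pi.single e.2 1, e.2) : Bond d)), F e.1 := by
          rw [Finset.sum_image fun a _ b _ h => hinj h]
      _ ≤ ∑ e ∈ U ×ˢ (Finset.univ : Finset (Fin d)), F e.1 := by
          refine Finset.sum_le_sum_of_subset_of_nonneg (fun e he => ?_) fun e _ _ => hF _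
          obtain ⟨e', he', rfl⟩ := Finset.mem_image.1 he
          exact Finset.mem_product.2 ⟨(hmem e' he').2, Finset.mem_univ _⟩
      _ = _ := by
          rw [Finset.sum_product]
          simp [Finset.mul_sum]
  linarith

/-- The points of the cube of radius `k` whose coordinate `i` equals `c`. -/
noncomputable def slice (k : ℕ) (i : Fin d) (c : ℤ) : Finset (Vertex d) :=
  (cube (0 : Vertex d) k).filter fun x => x i = c

theorem sum_biUnion_le {α β : Type*} [Fintype α] [DecidableEq β] (t : α → Finset β) {F : β → ℝ}
    (hF : ∀ x, 0 ≤ F x) : ∑ x ∈ Finset.univ.biUnion t, F x ≤ ∑ i, ∑ x ∈ t i, F x := by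
  rw [Finset.sum_sigma']
  have h : Finset.univ.biUnion t = (Finset.univ.sigma t).image Sigma.snd := by
    ext x; simp
  rw [h]
  exact Finset.sum_image_le_of_nonneg fun _ _ => hF _

theorem sum_sphere_le (k : ℕ) {F : Vertex d → ℝ} (hF : ∀ x, 0 ≤ F x) (hd : 0 < d) :
    ∑ x ∈ sphere d k, F x
      ≤ ∑ i, (∑ x ∈ slice k i k, F x + ∑ x ∈ slice k i (-k : ℤ), F x) := by
  classical
  have hsub : sphere d k ⊆ Finset.univ.biUnion fun i => slice k i (k : ℤ) ∪ slice k i (-k : ℤ) := by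
    intro x hx
    have hx' := mem_sphere.1 hx
    have hxc : x ∈ cube (0 : Vertex d) k := mem_cube_iff_supNorm_le.2 hx'.le
    have : Nonempty (Fin d) := ⟨⟨0, hd⟩⟩
    obtain ⟨i, _, hi⟩ := Finset.exists_mem_eq_sup (Finset.univ : Finset (Fin d))
      Finset.univ_nonempty fun i => (x i).natAbs
    have hi' : (x i).natAbs = k := by rw [← hx', supNorm, hi]
    refine Finset.mem_biUnion.2 ⟨i, Finset.mem_univ i, ?_⟩
    rw [Finset.mem_union, slice, slice, Finset.mem_filter, Finset.mem_filter]
    rcases Int.natAbs_eq (x i) with h | h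
    · exact Or.inl ⟨hxc, by omega⟩
    · exact Or.inr ⟨hxc, by omega⟩
  refine (Finset.sum_le_sum_of_subset_of_nonneg hsub fun x _ _ => hF x).trans ?_
  refine (sum_biUnion_le _ hF).trans (Finset.sum_le_sum fun i _ => ?_)
  rw [← Finset.sum_union_inter]
  have := Finset.sum_nonneg fun x (_ : x ∈ slice k i (k : ℤ) ∩ slice k i (-k : ℤ)) => hF x
  linarith

theorem sum_slice_insertNth {m k : ℕ} (i : Fin (m + 1)) {c : ℤ} (hc : -(k : ℤ) ≤ c ∧ c ≤ k)
    (F : Vertex (m + 1) → ℝ) :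
    ∑ x ∈ slice k i c, F x = ∑ y ∈ cube (0 : Vertex m) k, F (i.insertNth c y) := by
  refine (Finset.sum_nbij' (fun y => i.insertNth c y) (fun x => i.removeNth x)
    ?_ ?_ ?_ ?_ ?_).symm
  · intro y hy
    rw [slice, Finset.mem_filter, mem_cube_zero]
    refine ⟨fun j => ?_, by simp⟩
    rcases Fin.eq_self_or_eq_succAbove i j with rfl | ⟨j, rfl⟩
    · simpa using hc
    · simpa using mem_cube_zero.1 hy j
  · intro x hx
    rw [slice, Finset.mem_filter, mem_cube_zero] at hx
    exact mem_cube_zero.2 fun j => hx.1 _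
  · intro y _
    simp
  · intro x hx
    rw [slice, Finset.mem_filter] at hx
    simp [← hx.2]
  · intro y _
    rfl

theorem insertNth_add_single {m : ℕ} (i : Fin (m + 1)) (c : ℤ) (y : Vertex m) (j : Fin m) :
    (i.insertNth c (y + Pi.single j 1) : Vertex (m + 1))
      = (i.insertNth c y : Vertex (m + 1)) + Pi.single (i.succAbove j) 1 := by
  funext l
  rcases Fin.eq_self_or_eq_succAbove i l with rfl | ⟨l, rfl⟩
  · simp
  · by_cases h : l = j
    · subst h; simp
    · have : i.succAbove l ≠ i.succAbove j := fun h' => h (Fin.succAbove_right_injective h')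
      simp [h]

/-- Differences within the face are the tangential differences of `f`; the normal one is discarded.
-/
theorem density_insertNth_le {m : ℕ} (n : ℕ) (s : ℝ) (f : Vertex (m + 1) → ℝ) (i : Fin (m + 1))
    (c : ℤ) (y : Vertex m) :
    density n s (fun y => f (i.insertNth c y)) y ≤ density n s f (i.insertNth c y) := by
  unfold density
  refine add_le_add_left (mul_le_mul_of_nonneg_left ?_ (by positivity)) _
  rw [Fin.sum_univ_succAbove _ i]
  have h : ∀ j, |fdiff (fun y => f (i.insertNth c y)) j y| ^ s
      = |fdiff f (i.succAbove j) (i.insertNth c y)| ^ s := by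
    intro j
    rw [fdiff, fdiff, insertNth_add_single]
  simp only [h]
  exact le_add_of_nonneg_left (by positivity)

/-- The sum of the energy density over the faces of the sphere of radius `k`. -/
noncomputable def faceEnergy (n : ℕ) (s : ℝ) (f : Vertex d → ℝ) (k : ℕ) : ℝ :=
  ∑ i, (∑ x ∈ slice k i k, density n s f x + ∑ x ∈ slice k i (-k : ℤ), density n s f x)

theorem faceEnergy_nonneg (n : ℕ) (s : ℝ) (f : Vertex d → ℝ) (k : ℕ) :
    0 ≤ faceEnergy n s f k :=
  Finset.sum_nonneg fun _ _ => add_nonneg (Finset.sum_nonneg fun _ _ => density_nonneg _ _ _ _)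
    (Finset.sum_nonneg fun _ _ => density_nonneg _ _ _ _)

theorem sum_slice_le_sum_cube (K : Finset ℕ) {N : ℕ} (hK : ∀ k ∈ K, k ≤ N) (i : Fin d)
    {c : ℕ → ℤ} (hc : Function.Injective c) {F : Vertex d → ℝ} (hF : ∀ x, 0 ≤ F x) :
    ∑ k ∈ K, ∑ x ∈ slice k i (c k), F x ≤ ∑ x ∈ cube (0 : Vertex d) N, F x := by
  classical
  rw [← Finset.sum_biUnion]
  · refine Finset.sum_le_sum_of_subset_of_nonneg ?_ fun e _ _ => hF e
    intro x hx
    obtain ⟨k, hk, hk'⟩ := Finset.mem_biUnion.1 hx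
    exact cube_mono (hK k hk) (Finset.mem_filter.1 hk').1
  · intro k _ l _ hkl
    refine Finset.disjoint_left.2 fun x hx hx' => hkl (hc ?_)
    rw [← (Finset.mem_filter.1 hx).2, (Finset.mem_filter.1 hx').2]

theorem sum_faceEnergy_le (n : ℕ) (s : ℝ) (f : Vertex d → ℝ) (K : Finset ℕ) {N : ℕ}
    (hK : ∀ k ∈ K, k ≤ N) :
    ∑ k ∈ K, faceEnergy n s f k ≤ 2 * d * ∑ x ∈ cube (0 : Vertex d) N, density n s f x := by
  unfold faceEnergy
  rw [Finset.sum_comm]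
  have h : ∀ i : Fin d, ∑ k ∈ K, (∑ x ∈ slice k i (k : ℤ), density n s f x
      + ∑ x ∈ slice k i (-k : ℤ), density n s f x)
      ≤ 2 * ∑ x ∈ cube (0 : Vertex d) N, density n s f x := by
    intro i
    rw [Finset.sum_add_distrib, two_mul]
    refine add_le_add ?_ ?_
    · exact sum_slice_le_sum_cube K hK i (c := fun k => (k : ℤ)) Nat.cast_injective
        (density_nonneg n s f)
    · exact sum_slice_le_sum_cube K hK i (c := fun k => -(k : ℤ))
        (fun a b h => Nat.cast_injective (neg_injective h)) (density_nonneg n s f)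
  refine (Finset.sum_le_sum fun i _ => h i).trans (le_of_eq ?_)
  rw [Finset.sum_const, Finset.card_univ, Fintype.card_fin, nsmul_eq_mul]
  ring

/-- The Sobolev inequality on spheres. -/
theorem sobolev_sphere {m : ℕ} (hm : 2 ≤ m) {r s : ℝ} (hr : 2 < r) (hs0 : 0 < s)
    (hs : 1 / s ≤ 1 / r + 1 / m) :
    ∃ C : ℝ, 0 < C ∧ ∀ n k : ℕ, 1 ≤ n → n ≤ k → k ≤ 2 * n → ∀ f : Vertex (m + 1) → ℝ,
      (∀ x, 0 ≤ f x) → ∑ x ∈ sphere (m + 1) k, f x ^ r ≤ C * (n : ℝ) ^ (m : ℝ) *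
        ((n : ℝ) ^ (-(m : ℝ)) * faceEnergy n s f k) ^ (r / s) := by
  obtain ⟨C, hC, h⟩ := sobolev_density hm hr hs0 hs
  refine ⟨2 * (m + 1) * C, by positivity, ?_⟩
  intro n k hn hnk hk f hf
  have hface : ∀ i : Fin (m + 1), ∀ c : ℤ, (-(k : ℤ) ≤ c ∧ c ≤ k) →
      ∑ x ∈ slice k i c, density n s f x ≤ faceEnergy n s f k →
      ∑ x ∈ slice k i c, f x ^ r ≤ C * (n : ℝ) ^ (m : ℝ) *
        ((n : ℝ) ^ (-(m : ℝ)) * faceEnergy n s f k) ^ (r / s) := by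
    intro i c hc hle
    rw [sum_slice_insertNth i hc fun x => f x ^ r]
    refine (h n k hn hnk hk (fun y => f (i.insertNth c y)) fun y => hf _).trans ?_
    refine mul_le_mul_of_nonneg_left (Real.rpow_le_rpow ?_ ?_ (by positivity)) (by positivity)
    · exact mul_nonneg (by positivity) (Finset.sum_nonneg fun x _ => density_nonneg _ _ _ _)
    · refine mul_le_mul_of_nonneg_left (le_trans ?_ hle) (by positivity)
      rw [sum_slice_insertNth i hc fun x => density n s f x]
      exact Finset.sum_le_sum fun y _ => density_insertNth_le n s f i c y
  have hnn : ∀ i : Fin (m + 1), ∀ c : ℤ, 0 ≤ ∑ x ∈ slice k i c, density n s f x := fun i c =>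
    Finset.sum_nonneg fun x _ => density_nonneg _ _ _ _
  have hle : ∀ i : Fin (m + 1), ∑ x ∈ slice k i (k : ℤ), density n s f x
      + ∑ x ∈ slice k i (-k : ℤ), density n s f x ≤ faceEnergy n s f k := fun i =>
    Finset.single_le_sum (f := fun i : Fin (m + 1) => ∑ x ∈ slice k i (k : ℤ), density n s f x
      + ∑ x ∈ slice k i (-k : ℤ), density n s f x)
      (fun i _ => add_nonneg (hnn i _) (hnn i _)) (Finset.mem_univ i)
  refine (sum_sphere_le k (fun x => Real.rpow_nonneg (hf x) r) (Nat.succ_pos m)).trans ?_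
  refine (Finset.sum_le_sum fun i _ => add_le_add
    (hface i k ⟨by omega, le_rfl⟩ (by linarith [hle i, hnn i (-k : ℤ)]))
    (hface i (-k : ℤ) ⟨le_rfl, by omega⟩ (by linarith [hle i, hnn i (k : ℤ)]))).trans (le_of_eq ?_)
  rw [Finset.sum_const, Finset.card_univ, Fintype.card_fin, nsmul_eq_mul]
  push_cast
  ring

/-! ### The optimized cutoff and the Moser step -/

/-- After Hölder's inequality, `(g g') ^ p' ≤ g ^ (2 p') + g' ^ (2 p')` passes from bonds to
vertices, so that `g` is needed only in `L^(2p')` of two spheres. -/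
theorem sum_layer_mul_le {ω : Bond d → ℝ} (hω : ∀ e, 0 < ω e) {g : Vertex d → ℝ}
    (hg : ∀ x, 0 ≤ g x) {p p' : ℝ} (hp : p.HolderConjugate p') (N k : ℕ) :
    ∑ e ∈ layer N k, ω e * (g e.1 * g (e.1 + Pi.single e.2 1))
      ≤ (∑ e ∈ layer N k, ω e ^ p) ^ (1 / p) *
        (2 * d * (∑ x ∈ sphere d k, g x ^ (2 * p') + ∑ x ∈ sphere d (k + 1), g x ^ (2 * p')))
          ^ (1 / p') := by
  have hp'0 : 0 < p' := hp.symm.pos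
  refine (Real.inner_le_Lp_mul_Lq_of_nonneg (layer N k) hp (fun e _ => (hω e).le)
    fun e _ => mul_nonneg (hg _) (hg _)).trans ?_
  refine mul_le_mul_of_nonneg_left ?_ (Real.rpow_nonneg
    (Finset.sum_nonneg fun e _ => Real.rpow_nonneg (hω e).le _) _)
  refine Real.rpow_le_rpow (Finset.sum_nonneg fun e _ =>
    Real.rpow_nonneg (mul_nonneg (hg _) (hg _)) _) ?_ (by positivity)
  refine le_trans (Finset.sum_le_sum fun e _ => ?_)
    (sum_layer_le N k fun x => Real.rpow_nonneg (hg x) (2 * p'))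
  have h1 : ∀ x, g x ^ (2 * p') = (g x ^ p') ^ 2 := fun x => by
    rw [← Real.rpow_mul_natCast (hg x)]; push_cast; ring_nf
  rw [Real.mul_rpow (hg _) (hg _), h1, h1]
  nlinarith [sq_nonneg (g e.1 ^ p' - g (e.1 + Pi.single e.2 1) ^ p'),
    Real.rpow_nonneg (hg e.1) p', Real.rpow_nonneg (hg (e.1 + Pi.single e.2 1)) p',
    sq_nonneg (g e.1 ^ p'), sq_nonneg (g (e.1 + Pi.single e.2 1) ^ p')]

/-- In the Caccioppoli inequality the squared slope is `|G|⁻²`, and each of the `|G|` layers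
contributes at most `a`. -/
theorem sum_layerCutoff_energy_le {ω : Bond d → ℝ} (hω : ∀ e, 0 < ω e) {g : Vertex d → ℝ}
    (hg : ∀ x, 0 ≤ g x) {G : Finset ℕ} {σ N : ℕ} (hσ : 1 ≤ σ) (hσN : σ ≤ N)
    (hG : ∀ k ∈ G, k < σ) (hGc : 0 < G.card)
    (hsub : ∀ x ∈ cube (0 : Vertex d) N, 0 ≤ generator ω g x) {a : ℝ}
    (ha : ∀ k ∈ G, ∑ e ∈ layer N k, ω e * (g e.1 * g (e.1 + Pi.single e.2 1)) ≤ a) :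
    ∑ x ∈ cube (0 : Vertex d) σ, ∑ i,
      ω (x, i) * fdiff (fun x => layerCutoff G x * g x) i x ^ 2 ≤ a / G.card := by
  have hGc' : (0 : ℝ) < G.card := by exact_mod_cast hGc
  have h1 := caccioppoli (ω := ω) (w := g) (η := layerCutoff G) (K := σ - 1) hg ?_ ?_
  · rw [Nat.sub_add_cancel hσ] at h1
    refine h1.trans ?_
    have h2 : ∀ x ∈ cube (0 : Vertex d) σ, ∀ i,
        ω (x, i) * (g x * g (x + Pi.single i 1) * fdiff (layerCutoff G) i x ^ 2)
        ≤ ((G.card : ℝ) ^ 2)⁻¹ * ∑ k ∈ G, if ((x, i) : Bond d) ∈ layer N k then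
          ω (x, i) * (g x * g (x + Pi.single i 1)) else 0 := by
      intro x hx i
      have e1 := fdiff_layerCutoff_sq_le G (cube_mono hσN hx) i
      have e2 := mul_le_mul_of_nonneg_left e1
        (mul_nonneg (hω (x, i)).le (mul_nonneg (hg x) (hg (x + Pi.single i 1))))
      calc _ = ω (x, i) * (g x * g (x + Pi.single i 1)) * fdiff (layerCutoff G) i x ^ 2 := by ring
        _ ≤ _ := e2
        _ = _ := by
          rw [mul_left_comm, Finset.mul_sum]
          simp only [mul_ite, mul_one, mul_zero]
    have h3 : ∀ k, ∑ x ∈ cube (0 : Vertex d) σ, ∑ i : Fin d,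
        (if ((x, i) : Bond d) ∈ layer N k then
          ω (x, i) * (g x * g (x + Pi.single i 1)) else 0)
        ≤ ∑ e ∈ layer N k, ω e * (g e.1 * g (e.1 + Pi.single e.2 1)) := by
      intro k
      have e1 : ∑ x ∈ cube (0 : Vertex d) σ, ∑ i : Fin d,
          (if ((x, i) : Bond d) ∈ layer N k then
          ω (x, i) * (g x * g (x + Pi.single i 1)) else 0)
          = ∑ e ∈ cube (0 : Vertex d) σ ×ˢ (Finset.univ : Finset (Fin d)),
            if e ∈ layer N k then ω e * (g e.1 * g (e.1 + Pi.single e.2 1)) else 0 := by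
        rw [Finset.sum_product]
      rw [e1, ← Finset.sum_filter]
      refine Finset.sum_le_sum_of_subset_of_nonneg (fun e he => (Finset.mem_filter.1 he).2)
        fun e _ _ => mul_nonneg (hω e).le (mul_nonneg (hg _) (hg _))
    calc _ ≤ ∑ x ∈ cube (0 : Vertex d) σ, ∑ i, ((G.card : ℝ) ^ 2)⁻¹ *
          ∑ k ∈ G, (if ((x, i) : Bond d) ∈ layer N k then
          ω (x, i) * (g x * g (x + Pi.single i 1)) else 0) :=
          Finset.sum_le_sum fun x hx => Finset.sum_le_sum fun i _ => h2 x hx i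
      _ = ((G.card : ℝ) ^ 2)⁻¹ * ∑ k ∈ G, ∑ x ∈ cube (0 : Vertex d) σ, ∑ i : Fin d,
          (if ((x, i) : Bond d) ∈ layer N k then
          ω (x, i) * (g x * g (x + Pi.single i 1)) else 0) := by
          simp only [← Finset.mul_sum]
          congr 1
          exact (Finset.sum_congr rfl fun x _ => Finset.sum_comm).trans Finset.sum_comm
      _ ≤ ((G.card : ℝ) ^ 2)⁻¹ * ∑ k ∈ G, a :=
          mul_le_mul_of_nonneg_left (Finset.sum_le_sum fun k hk => (h3 k).trans (ha k hk))
            (by positivity)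
      _ = _ := by
          rw [Finset.sum_const, nsmul_eq_mul]; field_simp
  · intro x hx
    refine layerCutoff_eq_zero fun k hk => ?_
    rw [mem_cube_iff_supNorm_le] at hx
    have := hG k hk
    omega
  · intro x hx
    exact hsub x (cube_mono (by omega) hx)

/-- The normalized energy of `f` in the cube of radius `ρ`, at scale `n`. -/
noncomputable def energy (n : ℕ) (s : ℝ) (f : Vertex d → ℝ) (ρ : ℕ) : ℝ :=
  (n : ℝ) ^ (-(d : ℝ)) * ∑ x ∈ cube (0 : Vertex d) ρ, density n s f x

theorem energy_nonneg (n : ℕ) (s : ℝ) (f : Vertex d → ℝ) (ρ : ℕ) : 0 ≤ energy n s f ρ :=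
  mul_nonneg (by positivity) (Finset.sum_nonneg fun _ _ => density_nonneg _ _ _ _)

/-- The Caccioppoli inequality with an optimized cutoff. -/
theorem exists_cutoff_energy_le {m : ℕ} (hm : 2 ≤ m) {p p' χ s : ℝ} (hp : p.HolderConjugate p')
    (hχ : 1 < χ) (hs0 : 0 < s) (hs : 1 / s ≤ 1 / (2 * p' * χ) + 1 / m) :
    ∃ C : ℝ, 0 < C ∧ ∀ n ρ σ : ℕ, 1 ≤ n → n ≤ ρ → ρ + 2 ≤ σ → σ ≤ 2 * n →
      ∀ ω : Bond (m + 1) → ℝ, (∀ e, 0 < ω e) → ∀ P : ℝ, 0 ≤ P →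
      ∑ x ∈ cube (0 : Vertex (m + 1)) (2 * n), ∑ i, ω (x, i) ^ p
        ≤ (n : ℝ) ^ ((m + 1 : ℕ) : ℝ) * P ^ p →
      ∀ f : Vertex (m + 1) → ℝ, (∀ x, 0 ≤ f x) →
      (∀ x ∈ cube (0 : Vertex (m + 1)) (2 * n), 0 ≤ generator ω (fun x => f x ^ χ) x) →
      ∃ η : Vertex (m + 1) → ℝ, (∀ x ∈ cube (0 : Vertex (m + 1)) (ρ + 1), η x = 1) ∧
        (∀ x, x ∉ cube (0 : Vertex (m + 1)) (σ - 1) → η x = 0) ∧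
        ∑ x ∈ cube (0 : Vertex (m + 1)) σ, ∑ i,
          ω (x, i) * fdiff (fun x => η x * f x ^ χ) i x ^ 2
          ≤ C * ((n : ℝ) ^ (m : ℝ) / n) * P * ((n : ℝ) / (σ - ρ)) ^ (1 + 1 / p + 2 * χ / s)
            * energy n s f σ ^ (2 * χ / s) := by
  have hp0 : 0 < p := hp.pos
  have hp'0 : 0 < p' := hp.symm.pos
  have hp'1 : 1 < p' := hp.symm.lt
  have hr : 2 < 2 * p' * χ := by nlinarith
  obtain ⟨C, hC, hsob⟩ := sobolev_sphere hm hr hs0 hs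
  set κ : ℝ := 1 + 1 / p + 2 * χ / s with hκ
  have hκ0 : 0 < κ := by positivity
  set c₁ : ℝ := 4 ^ (1 / p) * (4 * (m + 1) * C) ^ (1 / p') * (16 * (m + 1)) ^ (2 * χ / s) with hc₁
  have hc₁0 : 0 < c₁ := by positivity
  refine ⟨2 * c₁ * 2 ^ κ, by positivity, ?_⟩
  intro n ρ σ hn hρ hσ hσn ω hω P hP hPω f hf hsub
  have hn0 : (0 : ℝ) < n := by exact_mod_cast hn
  set Q := energy n s f σ with hQ
  have hQ0 : 0 ≤ Q := energy_nonneg n s f σ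
  -- Starting at `ρ + 1` keeps the cutoff equal to `1` at both ends of every forward bond from
  -- radius `ρ`. Since `ρ + 2 ≤ σ`, at least `(σ - ρ) / 2` layers are available.
  set K := Finset.Ico (ρ + 1) σ with hK
  have hKc : 0 < K.card := by rw [hK, Nat.card_Ico]; omega
  set l : ℝ := (K.card : ℝ) with hl
  have hl0 : 0 < l := by rw [hl]; exact_mod_cast hKc
  have hlL : ((σ : ℝ) - ρ) ≤ 2 * l := by
    have h1 : σ ≤ 2 * K.card + ρ := by rw [hK, Nat.card_Ico]; omega
    have h2 : (σ : ℝ) ≤ 2 * l + ρ := by rw [hl]; exact_mod_cast h1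
    linarith
  have hLpos : (0 : ℝ) < (σ : ℝ) - ρ := by
    have : (ρ + 2 : ℝ) ≤ σ := by exact_mod_cast hσ
    linarith
  have hA := (sum_sum_layer_le (d := m + 1) K (2 * n) (F := fun e => ω e ^ p)
    fun e => Real.rpow_nonneg (hω e).le _).trans hPω
  -- A layer is bounded by the spheres `k` and `k + 1`, so both face energies are selected together.
  have hT : ∑ k ∈ K, (faceEnergy n s f k + faceEnergy n s f (k + 1))
      ≤ 4 * (m + 1) * ((n : ℝ) ^ ((m + 1 : ℕ) : ℝ) * Q) := by
    have e1 := sum_faceEnergy_le n s f K (N := σ) fun k hk => (Finset.mem_Ico.1 hk).2.le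
    have e2 := sum_faceEnergy_le n s f (K.image (· + 1)) (N := σ) fun k hk => by
      obtain ⟨j, hj, rfl⟩ := Finset.mem_image.1 hk
      exact (Finset.mem_Ico.1 hj).2
    rw [Finset.sum_image fun a _ b _ h => Nat.succ_injective h] at e2
    have e3 : (n : ℝ) ^ ((m + 1 : ℕ) : ℝ) * Q
        = ∑ x ∈ cube (0 : Vertex (m + 1)) σ, density n s f x := by
      rw [hQ, energy, ← mul_assoc, ← Real.rpow_add hn0]
      simp
    rw [Finset.sum_add_distrib, e3]
    push_cast at e1 e2
    linarith
  obtain ⟨G, hGK, hGc, hG⟩ := exists_good_subset K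
    (A := fun k => ∑ e ∈ layer (2 * n) k, ω e ^ p)
    (fun k => Finset.sum_nonneg fun e _ => Real.rpow_nonneg (hω e).le _)
    (fun k => add_nonneg (faceEnergy_nonneg n s f k) (faceEnergy_nonneg n s f (k + 1)))
    hA hT hKc
  rw [← hl] at hGc
  have hGpos : (0 : ℝ) < G.card := by linarith
  have hGcard : 0 < G.card := by exact_mod_cast hGpos
  set N : ℝ := n / l with hN
  have hN0 : 0 < N := by positivity
  -- Bound for one good layer: averaging over `l` layers gives `N ^ (1 / p)` from the weight and `(N
  -- Q) ^ (2χ / s)` from the Sobolev inequality. Dividing by `|G| ≥ l / 2` later supplies one more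
  -- factor `N`, whence `κ`.
  set a : ℝ := c₁ * (n : ℝ) ^ (m : ℝ) * P * N ^ (1 / p + 2 * χ / s) * Q ^ (2 * χ / s) with ha
  have ha0 : 0 ≤ a := by positivity
  have hlayer : ∀ k ∈ G, ∑ e ∈ layer (2 * n) k,
      ω e * (f e.1 ^ χ * f (e.1 + Pi.single e.2 1) ^ χ) ≤ a := by
    intro k hk
    obtain ⟨hAk, hTk⟩ := hG k hk
    have hkK := Finset.mem_Ico.1 (hGK hk)
    refine (sum_layer_mul_le hω (g := fun x => f x ^ χ) (fun x => Real.rpow_nonneg (hf x) _) hp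
      (2 * n) k).trans ?_
    have e1 : ∀ j, ∑ x ∈ sphere (m + 1) j, (f x ^ χ) ^ (2 * p')
        = ∑ x ∈ sphere (m + 1) j, f x ^ (2 * p' * χ) := fun j =>
      Finset.sum_congr rfl fun x _ => by rw [← Real.rpow_mul (hf x), mul_comm]
    rw [e1, e1]
    have hface : (n : ℝ) ^ (-(m : ℝ)) * (faceEnergy n s f k + faceEnergy n s f (k + 1))
        ≤ 16 * (m + 1) * (N * Q) := by
      refine (mul_le_mul_of_nonneg_left hTk (by positivity)).trans (le_of_eq ?_)
      push_cast
      rw [Real.rpow_neg hn0.le, Real.rpow_add_one hn0.ne', hN, ← hl]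
      have := (Real.rpow_pos_of_pos hn0 (m : ℝ)).ne'
      field_simp
      ring
    have hsph : ∀ j, n ≤ j → j ≤ 2 * n → faceEnergy n s f j
        ≤ faceEnergy n s f k + faceEnergy n s f (k + 1) →
        ∑ x ∈ sphere (m + 1) j, f x ^ (2 * p' * χ)
        ≤ C * (n : ℝ) ^ (m : ℝ) * (16 * (m + 1) * (N * Q)) ^ (2 * p' * χ / s) := by
      intro j hj hj' hle
      refine (hsob n j hn hj hj' f hf).trans (mul_le_mul_of_nonneg_left ?_ (by positivity))
      refine Real.rpow_le_rpow (mul_nonneg (by positivity) (faceEnergy_nonneg _ _ _ _)) ?_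
        (by positivity)
      exact (mul_le_mul_of_nonneg_left hle (by positivity)).trans hface
    have hS := add_le_add
      (hsph k (by omega) (by omega) (le_add_of_nonneg_right (faceEnergy_nonneg _ _ _ _)))
      (hsph (k + 1) (by omega) (by omega) (le_add_of_nonneg_left (faceEnergy_nonneg _ _ _ _)))
    have hS0 : 0 ≤ ∑ x ∈ sphere (m + 1) k, f x ^ (2 * p' * χ)
        + ∑ x ∈ sphere (m + 1) (k + 1), f x ^ (2 * p' * χ) :=
      add_nonneg (Finset.sum_nonneg fun x _ => Real.rpow_nonneg (hf x) _)
        (Finset.sum_nonneg fun x _ => Real.rpow_nonneg (hf x) _)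
    have e2 : (∑ e ∈ layer (2 * n) k, ω e ^ p) ^ (1 / p)
        ≤ 4 ^ (1 / p) * ((n : ℝ) ^ (m : ℝ)) ^ (1 / p) * N ^ (1 / p) * P := by
      refine (Real.rpow_le_rpow (Finset.sum_nonneg fun e _ => Real.rpow_nonneg (hω e).le _) hAk
        (by positivity)).trans (le_of_eq ?_)
      have e3 : 4 * ((n : ℝ) ^ ((m + 1 : ℕ) : ℝ) * P ^ p) / (K.card : ℝ)
          = 4 * (n : ℝ) ^ (m : ℝ) * N * P ^ p := by
        push_cast
        rw [Real.rpow_add_one hn0.ne', hN, ← hl]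
        ring
      rw [e3, Real.mul_rpow (by positivity) (by positivity),
        Real.mul_rpow (by positivity) (by positivity),
        Real.mul_rpow (by positivity) (by positivity), ← Real.rpow_mul hP,
        mul_one_div_cancel hp0.ne', Real.rpow_one]
    have e3 : (2 * ((m + 1 : ℕ) : ℝ) * (∑ x ∈ sphere (m + 1) k, f x ^ (2 * p' * χ)
        + ∑ x ∈ sphere (m + 1) (k + 1), f x ^ (2 * p' * χ))) ^ (1 / p')
        ≤ (4 * (m + 1) * C) ^ (1 / p') * ((n : ℝ) ^ (m : ℝ)) ^ (1 / p') *
          ((16 * (m + 1)) ^ (2 * χ / s) * (N ^ (2 * χ / s) * Q ^ (2 * χ / s))) := by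
      refine (Real.rpow_le_rpow (mul_nonneg (by positivity) hS0)
        (mul_le_mul_of_nonneg_left hS (by positivity)) (by positivity)).trans (le_of_eq ?_)
      have e4 : 2 * ((m + 1 : ℕ) : ℝ) * (C * (n : ℝ) ^ (m : ℝ) *
          (16 * (m + 1) * (N * Q)) ^ (2 * p' * χ / s)
          + C * (n : ℝ) ^ (m : ℝ) * (16 * (m + 1) * (N * Q)) ^ (2 * p' * χ / s))
          = (4 * (m + 1) * C) * (n : ℝ) ^ (m : ℝ) *
            (16 * (m + 1) * (N * Q)) ^ (2 * p' * χ / s) := by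
        push_cast; ring
      rw [e4, Real.mul_rpow (by positivity) (by positivity),
        Real.mul_rpow (by positivity) (by positivity),
        ← Real.rpow_mul (x := 16 * ((m : ℝ) + 1) * (N * Q)) (by positivity)]
      have e5 : 2 * p' * χ / s * (1 / p') = 2 * χ / s := by field_simp
      rw [e5, Real.mul_rpow (x := 16 * ((m : ℝ) + 1)) (by positivity) (by positivity),
        Real.mul_rpow hN0.le hQ0]
    refine (mul_le_mul e2 e3 (Real.rpow_nonneg (mul_nonneg (by positivity) hS0) _)
      (by positivity)).trans (le_of_eq ?_)
    have e6 : ((n : ℝ) ^ (m : ℝ)) ^ (1 / p) * ((n : ℝ) ^ (m : ℝ)) ^ (1 / p')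
        = (n : ℝ) ^ (m : ℝ) := by
      rw [← Real.rpow_add (by positivity), one_div, one_div, hp.inv_add_inv_eq_one, Real.rpow_one]
    rw [ha, hc₁, Real.rpow_add hN0]
    calc _ = 4 ^ (1 / p) * (4 * (m + 1) * C) ^ (1 / p') * (16 * (m + 1)) ^ (2 * χ / s) *
          (((n : ℝ) ^ (m : ℝ)) ^ (1 / p) * ((n : ℝ) ^ (m : ℝ)) ^ (1 / p')) * P *
          (N ^ (1 / p) * N ^ (2 * χ / s)) * Q ^ (2 * χ / s) := by ring
      _ = _ := by rw [e6]
  refine ⟨layerCutoff G, ?_, ?_, ?_⟩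
  · intro x hx
    refine layerCutoff_eq_one hGcard fun k hk => ?_
    rw [mem_cube_iff_supNorm_le] at hx
    exact hx.trans (Finset.mem_Ico.1 (hGK hk)).1
  · intro x hx
    refine layerCutoff_eq_zero fun k hk => ?_
    rw [mem_cube_iff_supNorm_le] at hx
    have := (Finset.mem_Ico.1 (hGK hk)).2
    omega
  · refine (sum_layerCutoff_energy_le hω (g := fun x => f x ^ χ)
      (fun x => Real.rpow_nonneg (hf x) _) (by omega) hσn
      (fun k hk => (Finset.mem_Ico.1 (hGK hk)).2) hGcard hsub hlayer).trans ?_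
    have h1 : a / G.card ≤ a * (2 / l) := by
      rw [div_eq_mul_inv]
      refine mul_le_mul_of_nonneg_left ?_ ha0
      rw [inv_eq_one_div, div_le_div_iff₀ hGpos hl0]
      linarith
    have h2 : a * (2 / l) = 2 * c₁ * ((n : ℝ) ^ (m : ℝ) / n) * P * N ^ κ * Q ^ (2 * χ / s) := by
      have : N ^ κ = N * N ^ (1 / p + 2 * χ / s) := by
        rw [hκ, add_assoc, Real.rpow_add hN0, Real.rpow_one]
      rw [this, ha]
      have : (2 : ℝ) / l = 2 * N / n := by rw [hN]; field_simp
      rw [this]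
      ring
    have h3 : N ^ κ ≤ 2 ^ κ * ((n : ℝ) / (σ - ρ)) ^ κ := by
      rw [← Real.mul_rpow (by positivity) (by positivity)]
      refine Real.rpow_le_rpow hN0.le ?_ hκ0.le
      rw [hN, mul_div_assoc', div_le_div_iff₀ hl0 hLpos]
      nlinarith
    refine h1.trans (h2.le.trans ?_)
    calc _ ≤ 2 * c₁ * ((n : ℝ) ^ (m : ℝ) / n) * P * (2 ^ κ * ((n : ℝ) / (σ - ρ)) ^ κ)
          * Q ^ (2 * χ / s) := by gcongr
      _ = _ := by ring

/-- One step of the Moser iteration. -/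
theorem moser_step {m : ℕ} (hm : 2 ≤ m) {p p' q χ s : ℝ} (hp : p.HolderConjugate p') (hq : 1 ≤ q)
    (hχ : 1 < χ) (hsq : 1 / s = 1 / 2 + 1 / (2 * q))
    (hs : 1 / s ≤ 1 / (2 * p' * χ) + 1 / m) :
    ∃ C κ : ℝ, 0 < C ∧ 0 < κ ∧ ∀ n ρ σ : ℕ, 1 ≤ n → n ≤ ρ → ρ + 2 ≤ σ → σ ≤ 2 * n →
      ∀ ω : Bond (m + 1) → ℝ, (∀ e, 0 < ω e) → ∀ P R : ℝ, 0 ≤ P → 0 ≤ R →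
      ∑ x ∈ cube (0 : Vertex (m + 1)) (2 * n), ∑ i, ω (x, i) ^ p
        ≤ (n : ℝ) ^ ((m + 1 : ℕ) : ℝ) * P ^ p →
      ∑ x ∈ cube (0 : Vertex (m + 1)) (2 * n), ∑ i, (ω (x, i))⁻¹ ^ q
        ≤ (n : ℝ) ^ ((m + 1 : ℕ) : ℝ) * R ^ q →
      ∀ f : Vertex (m + 1) → ℝ, (∀ x, 0 ≤ f x) →
      (∀ x ∈ cube (0 : Vertex (m + 1)) (2 * n), 0 ≤ generator ω (fun x => f x ^ χ) x) →
      energy n s (fun x => f x ^ χ) ρ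
        ≤ C * ((n : ℝ) / (σ - ρ)) ^ κ * (P * R) ^ (s / 2) * energy n s f σ ^ χ := by
  have hs0 : 0 < s := by
    have : 0 < 1 / s := by rw [hsq]; positivity
    exact one_div_pos.1 this
  have hs1 : 1 ≤ s := by
    have h1 : 1 / (2 * q) ≤ 1 / 2 := one_div_le_one_div_of_le two_pos (by linarith)
    have h2 : 1 / s ≤ 1 / 1 := by rw [hsq]; linarith
    exact (one_div_le_one_div hs0 one_pos).1 h2
  obtain ⟨C, hC, h⟩ := exists_cutoff_energy_le hm hp hχ hs0 hs
  have hp0 : 0 < p := hp.pos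
  set κ : ℝ := 1 + 1 / p + 2 * χ / s with hκ
  have hκ0 : 0 < κ := by positivity
  refine ⟨(1 + 5 ^ s) * C ^ (s / 2), κ * (s / 2), by positivity, by positivity, ?_⟩
  intro n ρ σ hn hρ hσ hσn ω hω P R hP hR hPω hRω f hf hsub
  have hn0 : (0 : ℝ) < n := by exact_mod_cast hn
  have hLpos : (0 : ℝ) < (σ : ℝ) - ρ := by
    have : (ρ + 2 : ℝ) ≤ σ := by exact_mod_cast hσ
    linarith
  obtain ⟨η, hη1, hη0, hE⟩ := h n ρ σ hn hρ hσ hσn ω hω P hP hPω f hf hsub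
  set Q := energy n s f σ with hQ
  have hQ0 : 0 ≤ Q := energy_nonneg n s f σ
  set φ : Vertex (m + 1) → ℝ := fun x => η x * f x ^ χ with hφ
  have hR' : ∑ x ∈ cube (0 : Vertex (m + 1)) σ, ∑ i, (ω (x, i))⁻¹ ^ q
      ≤ (n : ℝ) ^ ((m + 1 : ℕ) : ℝ) * R ^ q :=
    (Finset.sum_le_sum_of_subset_of_nonneg (cube_mono hσn) fun x _ _ =>
      Finset.sum_nonneg fun i _ => Real.rpow_nonneg (inv_pos.2 (hω _)).le _).trans hRω
  set X := ∑ x ∈ cube (0 : Vertex (m + 1)) σ, ∑ i, |fdiff φ i x| ^ s with hX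
  have hX0 : 0 ≤ X := Finset.sum_nonneg fun x _ => Finset.sum_nonneg fun i _ => by positivity
  have h1 : X ≤ (C * ((n : ℝ) ^ (m : ℝ) / n) * P * ((n : ℝ) / (σ - ρ)) ^ κ
      * Q ^ (2 * χ / s)) ^ (s / 2) * ((n : ℝ) ^ ((m + 1 : ℕ) : ℝ) * R ^ q) ^ (s / (2 * q)) := by
    refine (sum_fdiff_rpow_le hω (cube 0 σ) φ (by linarith) hsq).trans (mul_le_mul ?_ ?_ ?_ ?_)
    · refine Real.rpow_le_rpow (Finset.sum_nonneg fun x _ => Finset.sum_nonneg fun i _ =>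
        mul_nonneg (hω _).le (sq_nonneg _)) hE (by positivity)
    · refine Real.rpow_le_rpow (Finset.sum_nonneg fun x _ => Finset.sum_nonneg fun i _ =>
        Real.rpow_nonneg (inv_pos.2 (hω _)).le _) hR' (by positivity)
    · exact Real.rpow_nonneg (Finset.sum_nonneg fun x _ => Finset.sum_nonneg fun i _ =>
        Real.rpow_nonneg (inv_pos.2 (hω _)).le _) _
    · positivity
  have h2 : (C * ((n : ℝ) ^ (m : ℝ) / n) * P * ((n : ℝ) / (σ - ρ)) ^ κ
      * Q ^ (2 * χ / s)) ^ (s / 2) * ((n : ℝ) ^ ((m + 1 : ℕ) : ℝ) * R ^ q) ^ (s / (2 * q))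
      = C ^ (s / 2) * ((n : ℝ) / (σ - ρ)) ^ (κ * (s / 2)) * (P * R) ^ (s / 2) * Q ^ χ
        * ((n : ℝ) ^ ((m + 1 : ℕ) : ℝ) * (n : ℝ) ^ (-s)) := by
    rw [Real.mul_rpow (by positivity) (by positivity), Real.mul_rpow (by positivity) (by positivity),
      Real.mul_rpow (by positivity) (by positivity), Real.mul_rpow (by positivity) (by positivity),
      Real.mul_rpow (by positivity) (by positivity), Real.mul_rpow hP hR,
      ← Real.rpow_mul hR, ← Real.rpow_mul hQ0,
      ← Real.rpow_mul (x := (n : ℝ) / (σ - ρ)) (by positivity)]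
    have e1 : 2 * χ / s * (s / 2) = χ := by field_simp
    have e2 : q * (s / (2 * q)) = s / 2 := by field_simp
    have e3 : ((n : ℝ) ^ (m : ℝ) / n) ^ (s / 2) * ((n : ℝ) ^ ((m + 1 : ℕ) : ℝ)) ^ (s / (2 * q))
        = (n : ℝ) ^ ((m + 1 : ℕ) : ℝ) * (n : ℝ) ^ (-s) := by
      rw [← Real.rpow_sub_one hn0.ne', ← Real.rpow_mul hn0.le, ← Real.rpow_mul hn0.le,
        ← Real.rpow_add hn0, ← Real.rpow_add hn0]
      congr 1
      have e4 : s / 2 + s / (2 * q) = 1 := by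
        have : s * (1 / s) = 1 := by field_simp
        rw [hsq] at this
        linarith [show s * (1 / 2 + 1 / (2 * q)) = s / 2 + s / (2 * q) by ring]
      have e5 : s / (2 * q) = 1 - s / 2 := by linarith
      rw [e5]
      push_cast
      ring
    rw [e1, e2]
    calc _ = C ^ (s / 2) * ((n : ℝ) / (σ - ρ)) ^ (κ * (s / 2)) * (P ^ (s / 2) * R ^ (s / 2)) * Q ^ χ
        * (((n : ℝ) ^ (m : ℝ) / n) ^ (s / 2) *
          ((n : ℝ) ^ ((m + 1 : ℕ) : ℝ)) ^ (s / (2 * q))) := by ring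
      _ = _ := by rw [e3]
  -- The cutoff vanishes outside radius `σ - 1`, so the gradient controls the zero-order term; the
  -- side length is `2σ + 1 ≤ 5n`.
  have h3 : ∑ x ∈ cube (0 : Vertex (m + 1)) σ, |φ x| ^ s ≤ (5 * n : ℝ) ^ s * X := by
    have e1 := sum_rpow_le_of_zero_boundary (f := φ) (k := σ - 1)
      (fun x hx => by simp [hφ, hη0 x hx]) 0 hs1
    rw [Nat.sub_add_cancel (by omega : 1 ≤ σ)] at e1
    refine e1.trans (mul_le_mul (Real.rpow_le_rpow (by positivity) ?_ hs0.le) ?_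
      (Finset.sum_nonneg fun x _ => by positivity) (by positivity))
    · have h1 : (σ : ℝ) ≤ 2 * n := by exact_mod_cast hσn
      have h2 : (1 : ℝ) ≤ n := by exact_mod_cast hn
      linarith
    · exact Finset.sum_le_sum fun x _ => Finset.single_le_sum
        (f := fun i => |fdiff φ i x| ^ s) (fun i _ => by positivity) (Finset.mem_univ 0)
  have h4 : ∑ x ∈ cube (0 : Vertex (m + 1)) ρ, density n s (fun x => f x ^ χ) x
      ≤ (n : ℝ) ^ s * X + (5 * n : ℝ) ^ s * X := by
    have e1 : ∑ x ∈ cube (0 : Vertex (m + 1)) ρ, density n s (fun x => f x ^ χ) x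
        = ∑ x ∈ cube (0 : Vertex (m + 1)) ρ, density n s φ x := by
      refine Finset.sum_congr rfl fun x hx => ?_
      have a1 := hη1 x (cube_mono (Nat.le_succ ρ) hx)
      have a2 := fun i => hη1 _ (add_single_mem_cube le_rfl hx i)
      simp [density, fdiff, hφ, a1, a2]
    rw [e1]
    refine (Finset.sum_le_sum_of_subset_of_nonneg (cube_mono (by omega : ρ ≤ σ))
      fun x _ _ => density_nonneg _ _ _ _).trans ?_
    simp only [density]
    rw [Finset.sum_add_distrib, ← Finset.mul_sum]
    exact add_le_add le_rfl h3
  rw [energy]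
  calc _ ≤ (n : ℝ) ^ (-((m + 1 : ℕ) : ℝ)) * ((n : ℝ) ^ s * X + (5 * n : ℝ) ^ s * X) :=
        mul_le_mul_of_nonneg_left h4 (by positivity)
    _ = (1 + 5 ^ s) * ((n : ℝ) ^ (-((m + 1 : ℕ) : ℝ)) * (n : ℝ) ^ s) * X := by
        rw [Real.mul_rpow (by positivity) hn0.le]; ring
    _ ≤ (1 + 5 ^ s) * ((n : ℝ) ^ (-((m + 1 : ℕ) : ℝ)) * (n : ℝ) ^ s) *
        (C ^ (s / 2) * ((n : ℝ) / (σ - ρ)) ^ (κ * (s / 2)) * (P * R) ^ (s / 2) * Q ^ χ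
        * ((n : ℝ) ^ ((m + 1 : ℕ) : ℝ) * (n : ℝ) ^ (-s))) :=
        mul_le_mul_of_nonneg_left (h1.trans h2.le) (by positivity)
    _ = _ := by
        rw [Real.rpow_neg hn0.le, Real.rpow_neg hn0.le]
        have a1 := (Real.rpow_pos_of_pos hn0 ((m + 1 : ℕ) : ℝ)).ne'
        have a2 := (Real.rpow_pos_of_pos hn0 s).ne'
        field_simp

/-! ### Moser iteration and local boundedness -/

/-- The series of `x ^ (j + 1)` and `j * x ^ (j + 1)` converge and all bases are at least `1`, so
the bound is uniform in `J`. -/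
theorem iterate_le {x c b Λ : ℝ} (hc : 1 ≤ c) (hb : 1 ≤ b) (hΛ : 1 ≤ Λ)
    (hx0 : 0 < x) (hx1 : x < 1) {y : ℕ → ℝ} (hy : ∀ j, 0 ≤ y j) {J : ℕ}
    (h : ∀ j < J, y (j + 1) ≤ (c * b ^ (j : ℝ) * Λ) ^ (x ^ (j + 1)) * y j) :
    y J ≤ c ^ (x / (1 - x)) * b ^ (∑' j : ℕ, (j : ℝ) * x ^ (j + 1)) * Λ ^ (x / (1 - x)) * y 0 := by
  have hc0 : 0 < c := by linarith
  have hb0 : 0 < b := by linarith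
  have hΛ0 : 0 < Λ := by linarith
  have hsum1 : HasSum (fun j : ℕ => x ^ (j + 1)) (x / (1 - x)) := by
    have := (hasSum_geometric_of_lt_one hx0.le hx1).mul_left x
    simpa [pow_succ', div_eq_mul_inv] using this
  have hsum2 : Summable (fun j : ℕ => (j : ℝ) * x ^ (j + 1)) := by
    have := (summable_pow_mul_geometric_of_norm_lt_one 1
      (r := x) (by rwa [Real.norm_of_nonneg hx0.le])).mul_left x
    refine this.congr fun j => ?_
    ring
  have key : ∀ j ≤ J, y j ≤ (c * Λ) ^ (∑ i ∈ Finset.range j, x ^ (i + 1)) *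
      b ^ (∑ i ∈ Finset.range j, (i : ℝ) * x ^ (i + 1)) * y 0 := by
    intro j
    induction j with
    | zero => intro _; simp
    | succ j ih =>
      intro hj
      have h1 := ih (by omega)
      refine (h j (by omega)).trans ((mul_le_mul_of_nonneg_left h1 (by positivity)).trans
        (le_of_eq ?_))
      rw [Finset.sum_range_succ, Finset.sum_range_succ, Real.rpow_add (by positivity),
        Real.rpow_add hb0, show c * b ^ (j : ℝ) * Λ = (c * Λ) * b ^ (j : ℝ) by ring,
        Real.mul_rpow (by positivity) (by positivity), ← Real.rpow_mul hb0.le]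
      ring
  refine (key J le_rfl).trans (mul_le_mul_of_nonneg_right ?_ (hy 0))
  have e1 : (c * Λ) ^ (∑ i ∈ Finset.range J, x ^ (i + 1)) ≤ (c * Λ) ^ (x / (1 - x)) :=
    Real.rpow_le_rpow_of_exponent_le (one_le_mul_of_one_le_of_one_le hc hΛ)
      (sum_le_hasSum _ (fun i _ => by positivity) hsum1)
  have e2 : b ^ (∑ i ∈ Finset.range J, (i : ℝ) * x ^ (i + 1))
      ≤ b ^ (∑' j : ℕ, (j : ℝ) * x ^ (j + 1)) :=
    Real.rpow_le_rpow_of_exponent_le hb (hsum2.sum_le_tsum _ fun i _ => by positivity)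
  refine (mul_le_mul e1 e2 (by positivity) (by positivity)).trans (le_of_eq ?_)
  rw [Real.mul_rpow hc0.le hΛ0.le]
  ring

/-- The radii `n + n / 2 ^ j` may be used only while consecutive ones differ by at least `2`, as
`moser_step` requires. The iteration stops after finitely many steps, when `2 ^ J` exceeds `n / 4`.
-/
theorem exists_dyadic_steps (n : ℕ) : ∃ J : ℕ, n < 2 ^ (J + 2) ∧ ∀ j < J, 2 ^ (j + 2) ≤ n := by
  classical
  have hex : ∃ J : ℕ, n < 2 ^ (J + 2) :=
    ⟨n, lt_of_lt_of_le Nat.lt_two_pow_self (Nat.pow_le_pow_right two_pos (by omega))⟩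
  exact ⟨Nat.find hex, Nat.find_spec hex, fun j hj => not_lt.1 (Nat.find_min hex hj)⟩

theorem dyadic_radius_step {n j : ℕ} (h : 2 ^ (j + 2) ≤ n) :
    n + n / 2 ^ (j + 1) + 2 ≤ n + n / 2 ^ j ∧
      n ≤ 2 ^ (j + 2) * (n + n / 2 ^ j - (n + n / 2 ^ (j + 1))) := by
  have h1 : n / 2 ^ (j + 1) = n / 2 ^ j / 2 := by rw [pow_succ, Nat.div_div_eq_div_mul]
  have h2 : 4 ≤ n / 2 ^ j := by
    rw [Nat.le_div_iff_mul_le (by positivity)]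
    rw [pow_add] at h; linarith
  have h3 : n < 2 ^ j * (n / 2 ^ j + 1) := Nat.lt_mul_div_succ n (by positivity)
  rw [h1]
  set a := n / 2 ^ j with ha
  refine ⟨by omega, ?_⟩
  have h4 : a + 1 ≤ 4 * (n + a - (n + a / 2)) := by omega
  calc n ≤ 2 ^ j * (a + 1) := h3.le
    _ ≤ 2 ^ j * (4 * (n + a - (n + a / 2))) := Nat.mul_le_mul_left _ h4
    _ = _ := by rw [pow_add]; ring

/-- Local boundedness of nonnegative subharmonic functions. -/
theorem local_boundedness {m : ℕ} (hm : 2 ≤ m) {p p' q χ s : ℝ} (hp : p.HolderConjugate p')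
    (hq : 1 ≤ q) (hχ : 1 < χ) (hsq : 1 / s = 1 / 2 + 1 / (2 * q))
    (hs : 1 / s ≤ 1 / (2 * p' * χ) + 1 / m) :
    ∃ C : ℝ, 0 < C ∧ ∀ n : ℕ, 1 ≤ n →
      ∀ ω : Bond (m + 1) → ℝ, (∀ e, 0 < ω e) → ∀ P R : ℝ, 0 ≤ P → 0 ≤ R → 1 ≤ P * R →
      ∑ x ∈ cube (0 : Vertex (m + 1)) (2 * n), ∑ i, ω (x, i) ^ p
        ≤ (n : ℝ) ^ ((m + 1 : ℕ) : ℝ) * P ^ p →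
      ∑ x ∈ cube (0 : Vertex (m + 1)) (2 * n), ∑ i, (ω (x, i))⁻¹ ^ q
        ≤ (n : ℝ) ^ ((m + 1 : ℕ) : ℝ) * R ^ q →
      ∀ v : Vertex (m + 1) → ℝ, (∀ x, 0 ≤ v x) →
      (∀ x ∈ cube (0 : Vertex (m + 1)) (2 * n), 0 ≤ generator ω v x) →
      ∀ x ∈ cube (0 : Vertex (m + 1)) n,
        v x ≤ C * (P * R) ^ (1 / (2 * (χ - 1))) * energy n s v (2 * n) ^ (1 / s) := by
  have hs0 : 0 < s := by
    have : 0 < 1 / s := by rw [hsq]; positivity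
    exact one_div_pos.1 this
  obtain ⟨C₀, κ, hC₀, hκ, hstep⟩ := moser_step hm hp hq hχ hsq hs
  set C₁ := max 1 C₀ with hC₁
  have hC₁1 : 1 ≤ C₁ := le_max_left _ _
  have hχ0 : 0 < χ := by linarith
  set x₀ := χ⁻¹ with hx₀
  have hx0 : 0 < x₀ := inv_pos.2 hχ0
  have hx1 : x₀ < 1 := inv_lt_one_of_one_lt₀ hχ
  set T := ∑' j : ℕ, (j : ℝ) * x₀ ^ (j + 1) with hT
  have hsum2 : Summable (fun j : ℕ => (j : ℝ) * x₀ ^ (j + 1)) := by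
    have := (summable_pow_mul_geometric_of_norm_lt_one 1
      (r := x₀) (by rwa [Real.norm_of_nonneg hx0.le])).mul_left x₀
    refine this.congr fun j => ?_
    ring
  -- The first factor pays for passing from the normalized energy to a point value after the last
  -- step; the others come from `iterate_le`.
  set D : ℝ := 2 ^ (((m + 1 : ℕ) : ℝ) * (2 + χ * T)) *
    ((C₁ * 4 ^ κ) ^ (x₀ / (1 - x₀)) * (2 ^ κ) ^ T) with hD
  have hD0 : 0 < D := by positivity
  refine ⟨D ^ (1 / s), by positivity, ?_⟩
  intro n hn ω hω P R hP hR hPR hPω hRω v hv hsub x hx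
  have hn0 : (0 : ℝ) < n := by exact_mod_cast hn
  obtain ⟨J, hJ, hJ'⟩ := exists_dyadic_steps n
  set E : ℕ → ℝ := fun j => energy n s (fun x => v x ^ (χ ^ j)) (n + n / 2 ^ j) with hE
  have hE0 : ∀ j, 0 ≤ E j := fun j => energy_nonneg _ _ _ _
  set Λ := (P * R) ^ (s / 2) with hΛ
  have hΛ1 : 1 ≤ Λ := Real.one_le_rpow hPR (by positivity)
  -- The step is applied to `f = v ^ (χ ^ j)`. Its constants do not depend on the power, so `j`
  -- enters only through the gap between the radii.
  have h1 : ∀ j < J, E (j + 1) ≤ (C₁ * 4 ^ κ * (2 ^ κ) ^ (j : ℝ) * Λ) * E j ^ χ := by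
    intro j hj
    obtain ⟨e1, e2⟩ := dyadic_radius_step (hJ' j hj)
    have hone : (1 : ℝ) ≤ χ ^ j := one_le_pow₀ hχ.le
    have e3 := hstep n (n + n / 2 ^ (j + 1)) (n + n / 2 ^ j) hn (Nat.le_add_right _ _) e1
      (by have := Nat.div_le_self n (2 ^ j); omega) ω hω P R hP hR hPω hRω
      (fun x => v x ^ (χ ^ j)) (fun x => Real.rpow_nonneg (hv x) _) (fun x hx =>
        generator_rpow_nonneg hω (fun x => Real.rpow_nonneg (hv x) _) hχ.le
          (generator_rpow_nonneg hω hv hone (hsub x hx)))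
    have e4 : (fun x => (v x ^ (χ ^ j)) ^ χ) = fun x => v x ^ (χ ^ (j + 1)) := by
      funext x
      rw [← Real.rpow_mul (hv x), pow_succ]
    rw [e4] at e3
    have hgap : (0 : ℝ) < ((n + n / 2 ^ j : ℕ) : ℝ) - ((n + n / 2 ^ (j + 1) : ℕ) : ℝ) := by
      have : ((n + n / 2 ^ (j + 1) : ℕ) : ℝ) + 2 ≤ ((n + n / 2 ^ j : ℕ) : ℝ) := by
        exact_mod_cast e1
      linarith
    have e5 : (n : ℝ) / (((n + n / 2 ^ j : ℕ) : ℝ) - ((n + n / 2 ^ (j + 1) : ℕ) : ℝ))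
        ≤ 4 * 2 ^ (j : ℝ) := by
      rw [div_le_iff₀ hgap]
      have : (n : ℝ) ≤ 2 ^ (j + 2) *
          (((n + n / 2 ^ j : ℕ) : ℝ) - ((n + n / 2 ^ (j + 1) : ℕ) : ℝ)) := by
        rw [← Nat.cast_sub (by omega)]
        exact_mod_cast e2
      rw [Real.rpow_natCast]
      calc (n : ℝ) ≤ _ := this
        _ = _ := by ring
    have e6 : ((n : ℝ) / (((n + n / 2 ^ j : ℕ) : ℝ) - ((n + n / 2 ^ (j + 1) : ℕ) : ℝ))) ^ κ
        ≤ 4 ^ κ * (2 ^ κ) ^ (j : ℝ) := by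
      refine (Real.rpow_le_rpow (by positivity) e5 hκ.le).trans (le_of_eq ?_)
      rw [Real.mul_rpow (by positivity) (by positivity), ← Real.rpow_mul (by positivity),
        ← Real.rpow_mul (by positivity), mul_comm κ]
    refine e3.trans ?_
    have : C₀ ≤ C₁ := le_max_right _ _
    have hEχ : 0 ≤ E j ^ χ := Real.rpow_nonneg (hE0 j) _
    calc _ ≤ C₁ * (4 ^ κ * (2 ^ κ) ^ (j : ℝ)) * Λ * E j ^ χ := by gcongr
      _ = _ := by ring
  have h2 := iterate_le (x := x₀) (c := C₁ * 4 ^ κ) (b := 2 ^ κ) (Λ := Λ)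
    (y := fun j => E j ^ (x₀ ^ j)) (J := J)
    (one_le_mul_of_one_le_of_one_le hC₁1 (Real.one_le_rpow (by norm_num) hκ.le))
    (Real.one_le_rpow (by norm_num) hκ.le) hΛ1 hx0 hx1 (fun j => Real.rpow_nonneg (hE0 j) _) ?_
  · have h3 : v x ^ s ≤ D * Λ ^ (x₀ / (1 - x₀)) * energy n s v (2 * n) := by
      have hχJ : (0 : ℝ) < χ ^ J := by positivity
      have a1 : (v x ^ (χ ^ J)) ^ s ≤ (n : ℝ) ^ ((m + 1 : ℕ) : ℝ) * E J := by
        have b1 : (n : ℝ) ^ ((m + 1 : ℕ) : ℝ) * E J = ∑ x ∈ cube (0 : Vertex (m + 1))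
            (n + n / 2 ^ J), density n s (fun x => v x ^ (χ ^ J)) x := by
          simp only [hE, energy]
          rw [← mul_assoc, ← Real.rpow_add hn0, add_neg_cancel, Real.rpow_zero, one_mul]
        rw [b1]
        refine le_trans ?_ (Finset.single_le_sum (fun x _ => density_nonneg n s _ x)
          (cube_mono (Nat.le_add_right n _) hx))
        have b2 : 0 ≤ (n : ℝ) ^ s * ∑ i, |fdiff (fun x => v x ^ (χ ^ J)) i x| ^ s :=
          mul_nonneg (by positivity) (Finset.sum_nonneg fun i _ => by positivity)
        rw [density, abs_of_nonneg (Real.rpow_nonneg (hv x) _)]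
        linarith
      have a2 : v x ^ s ≤ ((n : ℝ) ^ ((m + 1 : ℕ) : ℝ)) ^ (x₀ ^ J) * E J ^ (x₀ ^ J) := by
        have b1 := Real.rpow_le_rpow (Real.rpow_nonneg (Real.rpow_nonneg (hv x) _) _) a1
          (by positivity : 0 ≤ x₀ ^ J)
        rw [Real.mul_rpow (by positivity) (hE0 J), ← Real.rpow_mul (Real.rpow_nonneg (hv x) _),
          ← Real.rpow_mul (hv x)] at b1
        have b2 : χ ^ J * (s * x₀ ^ J) = s := by
          rw [hx₀, inv_pow]; field_simp
        rwa [b2] at b1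
      -- From `n < 2 ^ (J + 2)` the exponent of `2` is at most `(m + 1)(J + 2) x₀ ^ J`, and `J * x₀
      -- ^ (J + 1)` is one term of the series `T`.
      have a3 : ((n : ℝ) ^ ((m + 1 : ℕ) : ℝ)) ^ (x₀ ^ J)
          ≤ 2 ^ (((m + 1 : ℕ) : ℝ) * (2 + χ * T)) := by
        have b1 : (n : ℝ) ≤ 2 ^ ((J : ℝ) + 2) := by
          have : (n : ℝ) ≤ 2 ^ (J + 2) := by exact_mod_cast hJ.le
          calc (n : ℝ) ≤ 2 ^ (J + 2) := this
            _ = 2 ^ ((J : ℝ) + 2) := by rw [← Real.rpow_natCast]; push_cast; rfl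
        rw [← Real.rpow_mul hn0.le]
        refine (Real.rpow_le_rpow hn0.le b1 (by positivity)).trans ?_
        rw [← Real.rpow_mul (by norm_num)]
        refine Real.rpow_le_rpow_of_exponent_le (by norm_num) ?_
        have b2 : (J : ℝ) * x₀ ^ (J + 1) ≤ T := hsum2.le_tsum J fun j _ => by positivity
        have b3 : (J : ℝ) * x₀ ^ J ≤ χ * T := by
          have : (J : ℝ) * x₀ ^ J = χ * (J * x₀ ^ (J + 1)) := by
            rw [pow_succ, hx₀]; field_simp
          rw [this]
          exact mul_le_mul_of_nonneg_left b2 hχ0.le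
        have b4 : x₀ ^ J ≤ 1 := pow_le_one₀ hx0.le hx1.le
        calc ((J : ℝ) + 2) * (((m + 1 : ℕ) : ℝ) * x₀ ^ J)
            = ((m + 1 : ℕ) : ℝ) * (J * x₀ ^ J + 2 * x₀ ^ J) := by ring
          _ ≤ _ := mul_le_mul_of_nonneg_left (by linarith) (by positivity)
      have a4 : E 0 ^ (x₀ ^ 0) = energy n s v (2 * n) := by
        simp [hE, two_mul]
      simp only [a4] at h2
      calc v x ^ s ≤ _ := a2
        _ ≤ 2 ^ (((m + 1 : ℕ) : ℝ) * (2 + χ * T)) * ((C₁ * 4 ^ κ) ^ (x₀ / (1 - x₀)) *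
          (2 ^ κ) ^ T * Λ ^ (x₀ / (1 - x₀)) * energy n s v (2 * n)) :=
          mul_le_mul a3 h2 (Real.rpow_nonneg (hE0 J) _) (by positivity)
        _ = _ := by rw [hD]; ring
    have hEn := energy_nonneg n s v (2 * n)
    have h4 := Real.rpow_le_rpow (Real.rpow_nonneg (hv x) _) h3 (by positivity : 0 ≤ 1 / s)
    rw [← Real.rpow_mul (hv x), mul_one_div_cancel hs0.ne', Real.rpow_one,
      Real.mul_rpow (by positivity) hEn, Real.mul_rpow hD0.le (by positivity), hΛ,
      ← Real.rpow_mul (by positivity), ← Real.rpow_mul (by positivity)] at h4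
    refine h4.trans (le_of_eq ?_)
    congr 3
    have : χ - 1 ≠ 0 := by linarith
    -- The power `s / 2` from the step, the sum `1 / (χ - 1)` of the exponents and the root `1 / s`
    -- combine to `1 / (2 * (χ - 1))`.
    have e : x₀ / (1 - x₀) = 1 / (χ - 1) := by
      rw [hx₀]; field_simp
    rw [e]
    field_simp
  · intro j hj
    have hx' : (0 : ℝ) ≤ x₀ ^ (j + 1) := by positivity
    refine (Real.rpow_le_rpow (hE0 _) (h1 j hj) hx').trans (le_of_eq ?_)
    have hΛ0 : 0 ≤ Λ := by linarith
    rw [Real.mul_rpow (by positivity) (Real.rpow_nonneg (hE0 j) _), ← Real.rpow_mul (hE0 j)]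
    congr 2
    rw [pow_succ, hx₀]; field_simp

/-! ### Normalized norms and the ellipticity ratio -/

theorem avgNorm_ofReal {p : ℝ} (hp : 0 < p) (S : Finset (Vertex d)) (F : Bond d → ℝ) :
    avgNorm (ENNReal.ofReal p) S F
      = (((bondsIn S).card : ℝ)⁻¹ * ∑ e ∈ bondsIn S, |F e| ^ p) ^ (1 / p) := by
  rw [avgNorm, if_neg ENNReal.ofReal_ne_top, ENNReal.toReal_ofReal hp.le]

theorem avgNorm_nonneg (p : ℝ≥0∞) (S : Finset (Vertex d)) (F : Bond d → ℝ) :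
    0 ≤ avgNorm p S F := by
  unfold avgNorm
  split_ifs
  · exact NNReal.coe_nonneg _
  · exact Real.rpow_nonneg (mul_nonneg (by positivity)
      (Finset.sum_nonneg fun e _ => by positivity)) _

theorem sum_rpow_eq_card_mul_avgNorm {p : ℝ} (hp : 0 < p) {S : Finset (Vertex d)}
    (hS : 0 < (bondsIn S).card) {F : Bond d → ℝ} (hF : ∀ e, 0 ≤ F e) :
    ∑ e ∈ bondsIn S, F e ^ p = (bondsIn S).card * avgNorm (ENNReal.ofReal p) S F ^ p := by
  have hM : (0 : ℝ) < (bondsIn S).card := by exact_mod_cast hS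
  have h0 : 0 ≤ ((bondsIn S).card : ℝ)⁻¹ * ∑ e ∈ bondsIn S, |F e| ^ p :=
    mul_nonneg (by positivity) (Finset.sum_nonneg fun e _ => by positivity)
  rw [avgNorm_ofReal hp, ← Real.rpow_mul h0, one_div_mul_cancel hp.ne', Real.rpow_one, ← mul_assoc,
    mul_inv_cancel₀ hM.ne', one_mul]
  exact Finset.sum_congr rfl fun e _ => by rw [abs_of_nonneg (hF e)]

/-- The power mean inequality. It lets the analysis use finite real exponents only; `∞` enters
through this comparison. -/
theorem avgNorm_mono {p : ℝ} (hp : 0 < p) {p' : ℝ≥0∞} (h : ENNReal.ofReal p ≤ p')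
    {S : Finset (Vertex d)} (hS : 0 < (bondsIn S).card) (F : Bond d → ℝ) :
    avgNorm (ENNReal.ofReal p) S F ≤ avgNorm p' S F := by
  have hM : (0 : ℝ) < (bondsIn S).card := by exact_mod_cast hS
  by_cases hp' : p' = ∞
  · rw [avgNorm_ofReal hp]
    have h0 := avgNorm_nonneg p' S F
    have h1 : ∀ e ∈ bondsIn S, |F e| ≤ avgNorm p' S F := by
      intro e he
      rw [avgNorm, if_pos hp']
      have := Finset.le_sup (f := fun e => ‖F e‖₊) he
      exact_mod_cast this
    calc _ ≤ (((bondsIn S).card : ℝ)⁻¹ * ∑ e ∈ bondsIn S, avgNorm p' S F ^ p) ^ (1 / p) := by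
          refine Real.rpow_le_rpow (mul_nonneg (by positivity)
            (Finset.sum_nonneg fun e _ => by positivity)) ?_ (by positivity)
          exact mul_le_mul_of_nonneg_left (Finset.sum_le_sum fun e he =>
            Real.rpow_le_rpow (abs_nonneg _) (h1 e he) hp.le) (by positivity)
      _ = _ := by
          rw [Finset.sum_const, nsmul_eq_mul, ← mul_assoc, inv_mul_cancel₀ hM.ne', one_mul,
            ← Real.rpow_mul h0, mul_one_div_cancel hp.ne', Real.rpow_one]
  · obtain ⟨r, hr0, rfl⟩ : ∃ r : ℝ, 0 ≤ r ∧ ENNReal.ofReal r = p' :=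
      ⟨p'.toReal, ENNReal.toReal_nonneg, ENNReal.ofReal_toReal hp'⟩
    have hpr : p ≤ r := (ENNReal.ofReal_le_ofReal_iff hr0).1 h
    have hr : 0 < r := hp.trans_le hpr
    rw [avgNorm_ofReal hp, avgNorm_ofReal hr]
    have h1 := rpow_sum_rpow_le (bondsIn S) (a := fun e => |F e|) (fun e _ => abs_nonneg _) hp hpr
    have hs : ∀ p : ℝ, 0 ≤ ∑ e ∈ bondsIn S, |F e| ^ p := fun p =>
      Finset.sum_nonneg fun e _ => by positivity
    rw [Real.mul_rpow (by positivity) (hs p), Real.mul_rpow (by positivity) (hs r)]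
    refine (mul_le_mul_of_nonneg_left h1 (by positivity)).trans (le_of_eq ?_)
    rw [← mul_assoc]
    congr 1
    rw [Real.inv_rpow hM.le, Real.inv_rpow hM.le, ← Real.rpow_neg hM.le, ← Real.rpow_neg hM.le,
      ← Real.rpow_add hM]
    congr 1
    ring

theorem ellipticity_mono {p q : ℝ} (hp : 0 < p) (hq : 0 < q) {p' q' : ℝ≥0∞}
    (hpp : ENNReal.ofReal p ≤ p') (hqq : ENNReal.ofReal q ≤ q') {S : Finset (Vertex d)}
    (hS : 0 < (bondsIn S).card) (ω : Bond d → ℝ) :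
    ellipticity ω (ENNReal.ofReal p) (ENNReal.ofReal q) S ≤ ellipticity ω p' q' S :=
  mul_le_mul (avgNorm_mono hp hpp hS _) (avgNorm_mono hq hqq hS _) (avgNorm_nonneg _ _ _)
    (avgNorm_nonneg _ _ _)

theorem ellipticity_nonneg (ω : Bond d → ℝ) (p q : ℝ≥0∞) (S : Finset (Vertex d)) :
    0 ≤ ellipticity ω p q S := mul_nonneg (avgNorm_nonneg _ _ _) (avgNorm_nonneg _ _ _)

/-- Cauchy–Schwarz for `1 = ω · ω⁻¹`. The iteration needs a ratio that is at least `1`. -/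
theorem one_le_ellipticity_one {ω : Bond d → ℝ} (hω : ∀ e, 0 < ω e) {S : Finset (Vertex d)}
    (hS : 0 < (bondsIn S).card) :
    1 ≤ ellipticity ω (ENNReal.ofReal 1) (ENNReal.ofReal 1) S := by
  have hM : (0 : ℝ) < (bondsIn S).card := by exact_mod_cast hS
  have h1 := sum_rpow_eq_card_mul_avgNorm one_pos hS (F := ω) fun e => (hω e).le
  have h2 := sum_rpow_eq_card_mul_avgNorm one_pos hS (F := fun e => (ω e)⁻¹)
    fun e => (inv_pos.2 (hω e)).le
  simp only [Real.rpow_one] at h1 h2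
  have h3 := Finset.sum_sq_le_sum_mul_sum_of_sq_le_mul (bondsIn S) (r := fun _ => (1 : ℝ))
    (f := ω) (g := fun e => (ω e)⁻¹) (fun e _ => (hω e).le) (fun e _ => (inv_pos.2 (hω e)).le)
    (fun e _ => by rw [mul_inv_cancel₀ (hω e).ne', one_pow])
  rw [h1, h2, Finset.sum_const, nsmul_eq_mul, mul_one] at h3
  have h4 : ((bondsIn S).card : ℝ) ^ 2 * 1 ≤ ((bondsIn S).card : ℝ) ^ 2 *
      ellipticity ω (ENNReal.ofReal 1) (ENNReal.ofReal 1) S := by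
    rw [ellipticity]
    calc _ = ((bondsIn S).card : ℝ) ^ 2 := mul_one _
      _ ≤ _ := h3
      _ = _ := by ring
  exact le_of_mul_le_mul_left h4 (by positivity)

theorem card_bondsIn_cube_pos (hd : 0 < d) {k : ℕ} (hk : 1 ≤ k) :
    0 < (bondsIn (cube (0 : Vertex d) k)).card := by
  refine Finset.card_pos.2 ⟨((0 : Vertex d), (⟨0, hd⟩ : Fin d)), ?_⟩
  simp only [bondsIn, Finset.mem_filter, Finset.mem_product]
  exact ⟨⟨zero_mem_cube k, Finset.mem_univ _⟩, add_single_mem_cube (by omega) (zero_mem_cube 0) _⟩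

theorem card_bondsIn_cube_le {n : ℕ} (hn : 1 ≤ n) :
    ((bondsIn (cube (0 : Vertex d) (4 * n))).card : ℝ) ≤ d * 9 ^ d * (n : ℝ) ^ (d : ℝ) := by
  have h1 : (bondsIn (cube (0 : Vertex d) (4 * n))).card ≤ (2 * (4 * n) + 1) ^ d * d := by
    refine (Finset.card_filter_le _ _).trans (le_of_eq ?_)
    rw [Finset.card_product, card_cube_zero, Finset.card_univ, Fintype.card_fin]
  have h2 : (2 * (4 * n) + 1) ^ d ≤ (9 * n) ^ d := Nat.pow_le_pow_left (by omega) d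
  have h3 : (bondsIn (cube (0 : Vertex d) (4 * n))).card ≤ d * 9 ^ d * n ^ d := by
    calc _ ≤ _ := h1
      _ ≤ (9 * n) ^ d * d := Nat.mul_le_mul_right _ h2
      _ = _ := by rw [mul_pow]; ring
  rw [Real.rpow_natCast]
  exact_mod_cast h3

/-- The factor `d * 9 ^ d` from counting bonds is at least `1` and may therefore be moved inside the
`p`-th power. -/
theorem sum_cube_rpow_le (hd : 0 < d) {n : ℕ} (hn : 1 ≤ n) {F : Bond d → ℝ} (hF : ∀ e, 0 ≤ F e)
    {p : ℝ} (hp : 1 ≤ p) :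
    ∑ x ∈ cube (0 : Vertex d) (2 * n), ∑ i, F (x, i) ^ p ≤ (n : ℝ) ^ (d : ℝ) *
      (d * 9 ^ d * avgNorm (ENNReal.ofReal p) (cube 0 (4 * n)) F) ^ p := by
  have hN := avgNorm_nonneg (ENNReal.ofReal p) (cube 0 (4 * n)) F
  refine (sum_cube_le_sum_bondsIn (L := 4 * n) (by omega) (F := fun e => F e ^ p)
    fun e => Real.rpow_nonneg (hF e) _).trans ?_
  rw [sum_rpow_eq_card_mul_avgNorm (by linarith) (card_bondsIn_cube_pos hd (by omega)) hF,
    Real.mul_rpow (by positivity) hN]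
  have h1 : (1 : ℝ) ≤ d * 9 ^ d := by
    have : 1 ≤ d * 9 ^ d := Nat.one_le_iff_ne_zero.2 (by positivity)
    exact_mod_cast this
  have h2 : (d * 9 ^ d : ℝ) ≤ (d * 9 ^ d : ℝ) ^ p := by
    calc (d * 9 ^ d : ℝ) = (d * 9 ^ d : ℝ) ^ (1 : ℝ) := (Real.rpow_one _).symm
      _ ≤ _ := Real.rpow_le_rpow_of_exponent_le h1 hp
  calc _ ≤ (d * 9 ^ d * (n : ℝ) ^ (d : ℝ)) * avgNorm (ENNReal.ofReal p) (cube 0 (4 * n)) F ^ p :=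
        mul_le_mul_of_nonneg_right (card_bondsIn_cube_le hn) (by positivity)
    _ ≤ ((d * 9 ^ d : ℝ) ^ p * (n : ℝ) ^ (d : ℝ)) *
        avgNorm (ENNReal.ofReal p) (cube 0 (4 * n)) F ^ p := by gcongr
    _ = _ := by ring

/-! ### The energy of the logarithm -/

/-- The gradient bound for the logarithm of a positive superharmonic function. -/
theorem sum_fdiff_logDefect_rpow_le (hd : 0 < d) {ω : Bond d → ℝ} (hω : ∀ e, 0 < ω e) {n : ℕ}
    (hn : 1 ≤ n) {w : Vertex d → ℝ} (hw : ∀ x ∈ cube (0 : Vertex d) (4 * n), 0 < w x)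
    (hsup : IsSuperharmonicOn ω w (cube 0 (4 * n))) (ε : ℝ) {q s : ℝ} (hq : 1 ≤ q)
    (hsq : 1 / s = 1 / 2 + 1 / (2 * q)) :
    ∑ x ∈ cube (0 : Vertex d) (2 * n), ∑ i, |fdiff (logDefect ε w) i x| ^ s
      ≤ 6 ^ (s / 2) * (d * 9 ^ d) * ((n : ℝ) ^ (d : ℝ) * (n : ℝ) ^ (-s)) *
        ellipticity ω (ENNReal.ofReal 1) (ENNReal.ofReal q) (cube 0 (4 * n)) ^ (s / 2) := by
  have hn0 : (0 : ℝ) < n := by exact_mod_cast hn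
  have hs0 : 0 < s := by
    have : 0 < 1 / s := by rw [hsq]; positivity
    exact one_div_pos.1 this
  have hMc := card_bondsIn_cube_pos hd (k := 4 * n) (by omega)
  set M : ℝ := ((bondsIn (cube (0 : Vertex d) (4 * n))).card : ℝ) with hM
  have hM0 : 0 < M := by rw [hM]; exact_mod_cast hMc
  set a := avgNorm (ENNReal.ofReal 1) (cube (0 : Vertex d) (4 * n)) ω with ha
  set b := avgNorm (ENNReal.ofReal q) (cube (0 : Vertex d) (4 * n)) (fun e => (ω e)⁻¹) with hb
  have ha0 : 0 ≤ a := avgNorm_nonneg _ _ _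
  have hb0 : 0 ≤ b := avgNorm_nonneg _ _ _
  have h1 : ∑ x ∈ cube (0 : Vertex d) (2 * n), ∑ i, ω (x, i) * fdiff (logDefect ε w) i x ^ 2
      ≤ 6 / (n : ℝ) ^ 2 * (M * a) := by
    have e1 := sum_log_sq_le hω hn hw hsup
    have e2 := sum_rpow_eq_card_mul_avgNorm one_pos hMc (F := ω) fun e => (hω e).le
    simp only [Real.rpow_one] at e2
    rw [e2] at e1
    refine le_trans (Finset.sum_le_sum fun x _ => Finset.sum_le_sum fun i _ => ?_) e1
    exact mul_le_mul_of_nonneg_left (fdiff_logDefect_sq_le ε w i x) (hω _).le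
  have h2 : ∑ x ∈ cube (0 : Vertex d) (2 * n), ∑ i, (ω (x, i))⁻¹ ^ q ≤ M * b ^ q := by
    refine (sum_cube_le_sum_bondsIn (L := 4 * n) (by omega) (F := fun e => (ω e)⁻¹ ^ q)
      fun e => Real.rpow_nonneg (inv_pos.2 (hω e)).le _).trans (le_of_eq ?_)
    exact sum_rpow_eq_card_mul_avgNorm (by linarith) hMc (F := fun e => (ω e)⁻¹)
      fun e => (inv_pos.2 (hω e)).le
  refine (sum_fdiff_rpow_le hω _ _ (by linarith) hsq).trans ?_
  have h3 : (6 / (n : ℝ) ^ 2 * (M * a)) ^ (s / 2) * (M * b ^ q) ^ (s / (2 * q))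
      = 6 ^ (s / 2) * M * (n : ℝ) ^ (-s) * (a * b) ^ (s / 2) := by
    have e0 : 6 / (n : ℝ) ^ 2 = 6 * (n : ℝ) ^ (-2 : ℝ) := by
      rw [Real.rpow_neg hn0.le, Real.rpow_two]; rfl
    rw [e0, Real.mul_rpow (by positivity) (by positivity),
      Real.mul_rpow (by positivity) (by positivity), Real.mul_rpow hM0.le ha0,
      Real.mul_rpow hM0.le (by positivity), Real.mul_rpow ha0 hb0, ← Real.rpow_mul hn0.le,
      ← Real.rpow_mul hb0]
    have e1 : q * (s / (2 * q)) = s / 2 := by field_simp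
    have e2 : (-2 : ℝ) * (s / 2) = -s := by ring
    have e3 : M ^ (s / 2) * M ^ (s / (2 * q)) = M := by
      rw [← Real.rpow_add hM0]
      have e4 : s / 2 + s / (2 * q) = 1 := by
        have : s * (1 / s) = 1 := by field_simp
        rw [hsq] at this
        linarith [show s * (1 / 2 + 1 / (2 * q)) = s / 2 + s / (2 * q) by ring]
      rw [e4, Real.rpow_one]
    rw [e1, e2]
    calc _ = 6 ^ (s / 2) * (M ^ (s / 2) * M ^ (s / (2 * q))) * (n : ℝ) ^ (-s) *
          (a ^ (s / 2) * b ^ (s / 2)) := by ring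
      _ = _ := by rw [e3]
  calc _ ≤ (6 / (n : ℝ) ^ 2 * (M * a)) ^ (s / 2) * (M * b ^ q) ^ (s / (2 * q)) := by
        refine mul_le_mul (Real.rpow_le_rpow (Finset.sum_nonneg fun x _ => Finset.sum_nonneg
          fun i _ => mul_nonneg (hω _).le (sq_nonneg _)) h1 (by positivity))
          (Real.rpow_le_rpow (Finset.sum_nonneg fun x _ => Finset.sum_nonneg
          fun i _ => Real.rpow_nonneg (inv_pos.2 (hω _)).le _) h2 (by positivity))
          (Real.rpow_nonneg (Finset.sum_nonneg fun x _ => Finset.sum_nonneg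
          fun i _ => Real.rpow_nonneg (inv_pos.2 (hω _)).le _) _) (by positivity)
    _ = _ := h3
    _ ≤ 6 ^ (s / 2) * (d * 9 ^ d * (n : ℝ) ^ (d : ℝ)) * (n : ℝ) ^ (-s) * (a * b) ^ (s / 2) := by
        have := card_bondsIn_cube_le (d := d) hn
        gcongr
    _ = _ := by rw [ellipticity]; ring

/-- The Poincaré inequality is used with the zero set `{ε ≤ w}`. It produces `l⁻¹ ^ (1 / s)`, which
is at most `l⁻¹` because `s ≥ 1` and `l < 1`. -/
theorem energy_logDefect_le (hd : 0 < d) {q s : ℝ} (hq : 1 ≤ q)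
    (hsq : 1 / s = 1 / 2 + 1 / (2 * q)) :
    ∃ C : ℝ, 0 < C ∧ ∀ ω : Bond d → ℝ, (∀ e, 0 < ω e) → ∀ n : ℕ, 1 ≤ n →
      ∀ w : Vertex d → ℝ, (∀ x ∈ cube (0 : Vertex d) (4 * n), 0 < w x) →
      IsSuperharmonicOn ω w (cube 0 (4 * n)) → ∀ ε : ℝ, 0 < ε → ∀ l : ℝ, 0 < l → l < 1 →
      l * ((cube (0 : Vertex d) (2 * n)).card : ℝ)
        ≤ (((cube 0 (2 * n)).filter fun x => ε ≤ w x).card : ℝ) →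
      energy n s (logDefect ε w) (2 * n) ^ (1 / s) ≤ C * l⁻¹ *
        ellipticity ω (ENNReal.ofReal 1) (ENNReal.ofReal q) (cube 0 (4 * n)) ^ (1 / 2 : ℝ) := by
  have hs0 : 0 < s := by
    have : 0 < 1 / s := by rw [hsq]; positivity
    exact one_div_pos.1 this
  have hs1 : 1 ≤ s := by
    have h1 : 1 / (2 * q) ≤ 1 / 2 := one_div_le_one_div_of_le two_pos (by linarith)
    have h2 : 1 / s ≤ 1 / 1 := by rw [hsq]; linarith
    exact (one_div_le_one_div hs0 one_pos).1 h2
  set D : ℝ := (1 + (d : ℝ) ^ (s - 1) * 5 ^ s) * (6 ^ (s / 2) * (d * 9 ^ d)) with hD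
  have hd0 : (0 : ℝ) < d := by exact_mod_cast hd
  have hD0 : 0 < D := by positivity
  refine ⟨D ^ (1 / s), by positivity, ?_⟩
  intro ω hω n hn w hw hsup ε hε l hl hl1 hcard
  have hn0 : (0 : ℝ) < n := by exact_mod_cast hn
  set Λ := ellipticity ω (ENNReal.ofReal 1) (ENNReal.ofReal q) (cube (0 : Vertex d) (4 * n)) with hΛ
  have hΛ0 : 0 ≤ Λ := ellipticity_nonneg _ _ _ _
  set v := logDefect ε w with hv
  set X := ∑ x ∈ cube (0 : Vertex d) (2 * n), ∑ i, |fdiff v i x| ^ s with hX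
  have hX0 : 0 ≤ X := Finset.sum_nonneg fun x _ => Finset.sum_nonneg fun i _ => by positivity
  have h1 := sum_fdiff_logDefect_rpow_le hd hω hn hw hsup ε hq hsq
  have hl' : 1 ≤ l⁻¹ := (one_le_inv₀ hl).2 hl1.le
  have h2 : ∑ x ∈ cube (0 : Vertex d) (2 * n), |v x| ^ s
      ≤ l⁻¹ * ((d : ℝ) ^ (s - 1) * ((5 * n : ℝ) ^ s * X)) := by
    refine (poincare_of_zero_set hs1 hl (Finset.filter_subset _ _)
      (fun x hx => logDefect_eq_zero hε (Finset.mem_filter.1 hx).2) hcard).trans ?_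
    have : (2 * (2 * n : ℕ) + 1 : ℝ) ≤ 5 * n := by
      have : (1 : ℝ) ≤ n := by exact_mod_cast hn
      push_cast; linarith
    gcongr
  have h3 : energy n s v (2 * n) ≤ l⁻¹ * (D * Λ ^ (s / 2)) := by
    rw [energy]
    simp only [density]
    rw [Finset.sum_add_distrib, ← Finset.mul_sum]
    have e1 : (n : ℝ) ^ s * X + ∑ x ∈ cube (0 : Vertex d) (2 * n), |v x| ^ s
        ≤ l⁻¹ * ((1 + (d : ℝ) ^ (s - 1) * 5 ^ s) * (n : ℝ) ^ s * X) := by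
      have e2 : (n : ℝ) ^ s * X ≤ l⁻¹ * ((n : ℝ) ^ s * X) :=
        le_mul_of_one_le_left (by positivity) hl'
      rw [Real.mul_rpow (by positivity) hn0.le] at h2
      calc _ ≤ _ := add_le_add e2 h2
        _ = _ := by ring
    calc _ ≤ (n : ℝ) ^ (-(d : ℝ)) * (l⁻¹ * ((1 + (d : ℝ) ^ (s - 1) * 5 ^ s) * (n : ℝ) ^ s *
          (6 ^ (s / 2) * (d * 9 ^ d) * ((n : ℝ) ^ (d : ℝ) * (n : ℝ) ^ (-s)) * Λ ^ (s / 2)))) := by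
          refine mul_le_mul_of_nonneg_left (e1.trans ?_) (by positivity)
          gcongr
      _ = _ := by
          rw [Real.rpow_neg hn0.le, Real.rpow_neg hn0.le, hD]
          have a1 := (Real.rpow_pos_of_pos hn0 (d : ℝ)).ne'
          have a2 := (Real.rpow_pos_of_pos hn0 s).ne'
          field_simp
  refine (Real.rpow_le_rpow (energy_nonneg _ _ _ _) h3 (by positivity)).trans ?_
  rw [Real.mul_rpow (by positivity) (by positivity), Real.mul_rpow hD0.le (by positivity),
    ← Real.rpow_mul hΛ0]
  have e1 : s / 2 * (1 / s) = 1 / 2 := by field_simp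
  have e2 : l⁻¹ ^ (1 / s) ≤ l⁻¹ := by
    calc l⁻¹ ^ (1 / s) ≤ l⁻¹ ^ (1 : ℝ) := Real.rpow_le_rpow_of_exponent_le hl'
          ((div_le_one hs0).2 hs1)
      _ = l⁻¹ := Real.rpow_one _
  rw [e1]
  calc _ ≤ l⁻¹ * (D ^ (1 / s) * Λ ^ (1 / 2 : ℝ)) :=
        mul_le_mul_of_nonneg_right e2 (by positivity)
    _ = _ := by ring

/-! ### The maximum principle and the planar case -/

/-- The maximum principle: a subharmonic function on a cube is maximal on the boundary sphere. -/
theorem exists_mem_sphere_le (hd : 0 < d) {ω : Bond d → ℝ} (hω : ∀ e, 0 < ω e) {k : ℕ}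
    {v : Vertex d → ℝ} (hsub : ∀ x ∈ cube (0 : Vertex d) k, 0 ≤ generator ω v x) {x : Vertex d}
    (hx : x ∈ cube 0 k) : ∃ z ∈ sphere d k, v x ≤ v z := by
  classical
  set i₀ : Fin d := ⟨0, hd⟩ with hi₀
  set S := (cube (0 : Vertex d) k).filter fun z => ∀ y ∈ cube (0 : Vertex d) k, v y ≤ v z with hS
  have hne : S.Nonempty := by
    obtain ⟨z, hz, hmax⟩ := Finset.exists_max_image (cube (0 : Vertex d) k) v ⟨x, hx⟩
    exact ⟨z, Finset.mem_filter.2 ⟨hz, hmax⟩⟩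
  -- Among the maximizers, one with the largest coordinate `i₀` is taken. If it were interior,
  -- subharmonicity would make `z + e_{i₀}` a maximizer too.
  obtain ⟨z, hz, hmax⟩ := Finset.exists_max_image S (fun z => z i₀) hne
  obtain ⟨hzc, hzm⟩ := Finset.mem_filter.1 hz
  refine ⟨z, ?_, hzm x hx⟩
  rw [mem_sphere]
  by_contra hne'
  have hlt : supNorm z + 1 ≤ k := by
    have := mem_cube_iff_supNorm_le.1 hzc
    omega
  have hz' : z ∈ cube (0 : Vertex d) (supNorm z) := mem_cube_iff_supNorm_le.2 le_rfl
  have hp := fun i => hzm _ (add_single_mem_cube hlt hz' i)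
  have hm := fun i => hzm _ (sub_single_mem_cube hlt hz' i)
  have hterm : ∀ i ∈ (Finset.univ : Finset (Fin d)),
      ω (z, i) * (v (z + Pi.single i 1) - v z)
      + ω (z - Pi.single i 1, i) * (v (z - Pi.single i 1) - v z) ≤ 0 := by
    intro i _
    have h1 := mul_nonpos_of_nonneg_of_nonpos (hω (z, i)).le (sub_nonpos.2 (hp i))
    have h2 := mul_nonpos_of_nonneg_of_nonpos (hω (z - Pi.single i 1, i)).le (sub_nonpos.2 (hm i))
    linarith
  have hzero : generator ω v z = 0 := le_antisymm (Finset.sum_nonpos hterm) (hsub z hzc)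
  have h0 := (Finset.sum_eq_zero_iff_of_nonpos hterm).1 hzero i₀ (Finset.mem_univ _)
  have h1 := mul_nonpos_of_nonneg_of_nonpos (hω (z, i₀)).le (sub_nonpos.2 (hp i₀))
  have h2 := mul_nonpos_of_nonneg_of_nonpos (hω (z - Pi.single i₀ 1, i₀)).le
    (sub_nonpos.2 (hm i₀))
  have h3 : ω (z, i₀) * (v (z + Pi.single i₀ 1) - v z) = 0 := by linarith
  have h4 : v (z + Pi.single i₀ 1) = v z := by
    rcases mul_eq_zero.1 h3 with h | h
    · exact absurd h (hω _).ne'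
    · linarith
  have h5 : z + Pi.single i₀ 1 ∈ S := by
    refine Finset.mem_filter.2 ⟨add_single_mem_cube hlt hz' i₀, ?_⟩
    rw [h4]
    exact hzm
  have := hmax _ h5
  simp at this

/-- The one-dimensional Sobolev inequality on a side of the square through `z`: a coordinate of
modulus `k` stays fixed and the other one varies. -/
theorem le_sum_sphere_two {n k : ℕ} (hn : 1 ≤ n) (hk : n ≤ k) {v : Vertex 2 → ℝ}
    (hv : ∀ x, 0 ≤ v x) {z : Vertex 2} (hz : z ∈ sphere 2 k) :
    v z ≤ ∑ x ∈ sphere 2 k, (n : ℝ)⁻¹ * density n 1 v x := by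
  classical
  have hn0 : (0 : ℝ) < n := by exact_mod_cast hn
  have hzk := mem_sphere.1 hz
  have hzc : z ∈ cube (0 : Vertex 2) k := mem_cube_iff_supNorm_le.2 hzk.le
  obtain ⟨i, _, hi⟩ := Finset.exists_mem_eq_sup (Finset.univ : Finset (Fin 2))
    Finset.univ_nonempty fun i => (z i).natAbs
  have hi' : (z i).natAbs = k := by rw [← hzk, supNorm, hi]
  obtain ⟨j, hj⟩ := exists_ne i
  have hmem : ∀ t ∈ Finset.Icc (-(k : ℤ)) k, Function.update z j t ∈ sphere 2 k := by
    intro t ht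
    rw [mem_sphere]
    refine le_antisymm (mem_cube_iff_supNorm_le.1 (update_mem_cube hzc j ht)) ?_
    have := Finset.le_sup (f := fun l => (Function.update z j t l).natAbs) (Finset.mem_univ i)
    simp only [Function.update_of_ne hj.symm, hi'] at this
    exact this
  have hle : ∀ t, |fdiff v j (Function.update z j t)| + (2 * k + 1 : ℝ)⁻¹ * v (Function.update z j t)
      ≤ (n : ℝ)⁻¹ * density n 1 v (Function.update z j t) := by
    intro t
    simp only [density, Real.rpow_one]
    rw [mul_add, ← mul_assoc, inv_mul_cancel₀ hn0.ne', one_mul, abs_of_nonneg (hv _)]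
    refine add_le_add (Finset.single_le_sum (f := fun i => |fdiff v i (Function.update z j t)|)
      (fun i _ => abs_nonneg _) (Finset.mem_univ j)) (mul_le_mul_of_nonneg_right ?_ (hv _))
    refine inv_anti₀ hn0 ?_
    have : (n : ℝ) ≤ k := by exact_mod_cast hk
    linarith
  calc v z ≤ _ := le_line_sum v hzc j
    _ ≤ ∑ t ∈ Finset.Icc (-(k : ℤ)) k, (|fdiff v j (Function.update z j t)|
        + (2 * k + 1 : ℝ)⁻¹ * v (Function.update z j t)) := by
        rw [Finset.sum_add_distrib, ← Finset.mul_sum]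
        exact add_le_add (sum_Ico_le_sum_Icc k _ fun t => abs_nonneg _) le_rfl
    _ ≤ ∑ t ∈ Finset.Icc (-(k : ℤ)) k, (n : ℝ)⁻¹ * density n 1 v (Function.update z j t) :=
        Finset.sum_le_sum fun t _ => hle t
    _ = ∑ x ∈ (Finset.Icc (-(k : ℤ)) k).image (Function.update z j), (n : ℝ)⁻¹ * density n 1 v x :=
        (Finset.sum_image (f := fun x => (n : ℝ)⁻¹ * density n 1 v x)
          fun a _ b _ h => Function.update_injective z j h).symm
    _ ≤ _ := by
        refine Finset.sum_le_sum_of_subset_of_nonneg (fun x hx => ?_)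
          fun x _ _ => mul_nonneg (by positivity) (density_nonneg _ _ _ _)
        obtain ⟨t, ht, rfl⟩ := Finset.mem_image.1 hx
        exact hmem t ht

/-- Local boundedness of nonnegative subharmonic functions in the plane. -/
theorem le_energy_two {ω : Bond 2 → ℝ} (hω : ∀ e, 0 < ω e) {n : ℕ} (hn : 1 ≤ n)
    {v : Vertex 2 → ℝ} (hv : ∀ x, 0 ≤ v x)
    (hsub : ∀ x ∈ cube (0 : Vertex 2) (2 * n), 0 ≤ generator ω v x)
    {x : Vertex 2} (hx : x ∈ cube 0 n) : v x ≤ energy n 1 v (2 * n) := by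
  classical
  have hn0 : (0 : ℝ) < n := by exact_mod_cast hn
  -- The bound holds on each of `n` disjoint spheres; summing it and dividing by `n` gives the
  -- energy of the cube.
  have h1 : ∀ k ∈ Finset.Ioc n (2 * n),
      v x ≤ ∑ x ∈ sphere 2 k, (n : ℝ)⁻¹ * density n 1 v x := by
    intro k hk
    obtain ⟨hk1, hk2⟩ := Finset.mem_Ioc.1 hk
    obtain ⟨z, hz, hxz⟩ := exists_mem_sphere_le two_pos hω (k := k)
      (fun y hy => hsub y (cube_mono hk2 hy)) (cube_mono hk1.le hx)
    exact hxz.trans (le_sum_sphere_two hn hk1.le hv hz)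
  have h2 := Finset.sum_le_sum h1
  rw [Finset.sum_const, Nat.card_Ioc, nsmul_eq_mul, ← Finset.sum_biUnion] at h2
  · have h3 : ∑ x ∈ (Finset.Ioc n (2 * n)).biUnion (sphere 2), (n : ℝ)⁻¹ * density n 1 v x
        ≤ ∑ x ∈ cube (0 : Vertex 2) (2 * n), (n : ℝ)⁻¹ * density n 1 v x := by
      refine Finset.sum_le_sum_of_subset_of_nonneg (fun x hx => ?_)
        fun x _ _ => mul_nonneg (by positivity) (density_nonneg _ _ _ _)
      obtain ⟨k, hk, hk'⟩ := Finset.mem_biUnion.1 hx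
      exact cube_mono (Finset.mem_Ioc.1 hk).2 (Finset.mem_filter.1 hk').1
    have h4 := h2.trans h3
    rw [← Finset.mul_sum, show 2 * n - n = n by omega] at h4
    rw [energy, Real.rpow_neg hn0.le, Real.rpow_natCast]
    refine le_of_mul_le_mul_left (h4.trans (le_of_eq ?_)) hn0
    field_simp
  · intro k _ l _ hkl
    refine Finset.disjoint_left.2 fun x hx hx' => hkl ?_
    rw [← mem_sphere.1 hx, mem_sphere.1 hx']

/-! ### Pointwise bounds for the logarithm -/

theorem generator_logDefect_nonneg_of_mem {ω : Bond d → ℝ} (hω : ∀ e, 0 < ω e) {n : ℕ}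
    (hn : 1 ≤ n) {w : Vertex d → ℝ} (hw : ∀ x ∈ cube (0 : Vertex d) (4 * n), 0 < w x)
    (hsup : IsSuperharmonicOn ω w (cube 0 (4 * n))) (ε : ℝ) :
    ∀ x ∈ cube (0 : Vertex d) (2 * n), 0 ≤ generator ω (logDefect ε w) x := fun x hx =>
  generator_logDefect_nonneg hω ε (hw x (cube_mono (by omega) hx))
    (fun i => hw _ (add_single_mem_cube (by omega) hx i))
    (fun i => hw _ (sub_single_mem_cube (by omega) hx i)) (hsup x (cube_mono (by omega) hx))

theorem logDefect_le_two :
    ∃ C : ℝ, 0 < C ∧ ∀ ω : Bond 2 → ℝ, (∀ e, 0 < ω e) → ∀ n : ℕ, 1 ≤ n →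
      ∀ w : Vertex 2 → ℝ, (∀ x ∈ cube (0 : Vertex 2) (4 * n), 0 < w x) →
      IsSuperharmonicOn ω w (cube 0 (4 * n)) → ∀ ε : ℝ, 0 < ε → ∀ l : ℝ, 0 < l → l < 1 →
      l * ((cube (0 : Vertex 2) (2 * n)).card : ℝ)
        ≤ (((cube 0 (2 * n)).filter fun x => ε ≤ w x).card : ℝ) →
      ∀ x ∈ cube (0 : Vertex 2) n, logDefect ε w x
        ≤ C * l⁻¹ * ellipticity ω 1 1 (cube 0 (4 * n)) ^ (1 / 2 : ℝ) := by
  obtain ⟨C, hC, h⟩ := energy_logDefect_le (d := 2) two_pos (q := 1) (s := 1) le_rfl (by norm_num)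
  refine ⟨C, hC, ?_⟩
  intro ω hω n hn w hw hsup ε hε l hl hl1 hcard x hx
  have h1 := h ω hω n hn w hw hsup ε hε l hl hl1 hcard
  rw [ENNReal.ofReal_one, div_one, Real.rpow_one] at h1
  exact (le_energy_two hω hn (logDefect_nonneg ε w)
    (generator_logDefect_nonneg_of_mem hω hn hw hsup ε) hx).trans h1

/-- The power `1/2` comes from the energy of the logarithm and `1 / (2 * (χ - 1))` from the
iteration. -/
theorem logDefect_le {m : ℕ} (hm : 2 ≤ m) {p p' q χ s : ℝ} (hp : p.HolderConjugate p')
    (hq : 1 ≤ q) (hχ : 1 < χ) (hsq : 1 / s = 1 / 2 + 1 / (2 * q))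
    (hs : 1 / s ≤ 1 / (2 * p' * χ) + 1 / m) :
    ∃ C : ℝ, 0 < C ∧ ∀ ω : Bond (m + 1) → ℝ, (∀ e, 0 < ω e) → ∀ n : ℕ, 1 ≤ n →
      ∀ w : Vertex (m + 1) → ℝ, (∀ x ∈ cube (0 : Vertex (m + 1)) (4 * n), 0 < w x) →
      IsSuperharmonicOn ω w (cube 0 (4 * n)) → ∀ ε : ℝ, 0 < ε → ∀ l : ℝ, 0 < l → l < 1 →
      l * ((cube (0 : Vertex (m + 1)) (2 * n)).card : ℝ)
        ≤ (((cube 0 (2 * n)).filter fun x => ε ≤ w x).card : ℝ) →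
      ∀ x ∈ cube (0 : Vertex (m + 1)) n, logDefect ε w x
        ≤ C * l⁻¹ * ellipticity ω (ENNReal.ofReal p) (ENNReal.ofReal q) (cube 0 (4 * n)) ^
          (1 / 2 + 1 / (2 * (χ - 1))) := by
  have hp1 : 1 < p := hp.lt
  have hd : 0 < m + 1 := Nat.succ_pos m
  obtain ⟨C₁, hC₁, h₁⟩ := local_boundedness hm hp hq hχ hsq hs
  obtain ⟨C₂, hC₂, h₂⟩ := energy_logDefect_le hd hq hsq
  set D : ℝ := ((m + 1 : ℕ) : ℝ) * 9 ^ (m + 1) with hD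
  have hD1 : 1 ≤ D := by
    have : 1 ≤ (m + 1) * 9 ^ (m + 1) := Nat.one_le_iff_ne_zero.2 (by positivity)
    rw [hD]
    exact_mod_cast this
  have hD0 : 0 < D := by linarith
  set e : ℝ := 1 / (2 * (χ - 1)) with he
  have he0 : 0 ≤ e := by
    have : 0 < χ - 1 := by linarith
    rw [he]; positivity
  refine ⟨C₁ * (D * D) ^ e * C₂, by positivity, ?_⟩
  intro ω hω n hn w hw hsup ε hε l hl hl1 hcard x hx
  have hMc := card_bondsIn_cube_pos hd (k := 4 * n) (by omega)
  set P := avgNorm (ENNReal.ofReal p) (cube (0 : Vertex (m + 1)) (4 * n)) ω with hP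
  set R := avgNorm (ENNReal.ofReal q) (cube (0 : Vertex (m + 1)) (4 * n)) (fun e => (ω e)⁻¹)
    with hR
  have hP0 : 0 ≤ P := avgNorm_nonneg _ _ _
  have hR0 : 0 ≤ R := avgNorm_nonneg _ _ _
  set Λ := ellipticity ω (ENNReal.ofReal p) (ENNReal.ofReal q) (cube (0 : Vertex (m + 1)) (4 * n))
    with hΛ
  have hPR : P * R = Λ := rfl
  have hΛ1 : 1 ≤ Λ := (one_le_ellipticity_one hω hMc).trans (ellipticity_mono one_pos one_pos
    (ENNReal.ofReal_le_ofReal hp1.le) (ENNReal.ofReal_le_ofReal hq) hMc ω)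
  have hΛ0 : 0 < Λ := by linarith
  have hprod : D * P * (D * R) = D * D * Λ := by rw [← hPR]; ring
  have hb := h₁ n hn ω hω (D * P) (D * R) (by positivity) (by positivity)
    (by rw [hprod]; exact one_le_mul_of_one_le_of_one_le
          (one_le_mul_of_one_le_of_one_le hD1 hD1) hΛ1)
    (sum_cube_rpow_le hd hn (fun e => (hω e).le) hp1.le)
    (sum_cube_rpow_le hd hn (F := fun e => (ω e)⁻¹) (fun e => (inv_pos.2 (hω e)).le) hq)
    (logDefect ε w) (logDefect_nonneg ε w)
    (generator_logDefect_nonneg_of_mem hω hn hw hsup ε) x hx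
  rw [hprod, Real.mul_rpow (by positivity) hΛ0.le] at hb
  have hen := h₂ ω hω n hn w hw hsup ε hε l hl hl1 hcard
  have hΛ' : ellipticity ω (ENNReal.ofReal 1) (ENNReal.ofReal q)
      (cube (0 : Vertex (m + 1)) (4 * n)) ≤ Λ :=
    ellipticity_mono one_pos (by linarith) (ENNReal.ofReal_le_ofReal hp1.le) le_rfl hMc ω
  have hen' : energy n s (logDefect ε w) (2 * n) ^ (1 / s) ≤ C₂ * l⁻¹ * Λ ^ (1 / 2 : ℝ) :=
    hen.trans (mul_le_mul_of_nonneg_left (Real.rpow_le_rpow (ellipticity_nonneg _ _ _ _) hΛ'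
      (by norm_num)) (by positivity))
  calc _ ≤ _ := hb
    _ ≤ C₁ * ((D * D) ^ e * Λ ^ e) * (C₂ * l⁻¹ * Λ ^ (1 / 2 : ℝ)) :=
        mul_le_mul_of_nonneg_left hen' (by positivity)
    _ = _ := by rw [Real.rpow_add hΛ0]; ring

/-! ### Choice of exponents and conclusion -/

/-- The choice of the Moser exponent and of finite integrability exponents. -/
theorem exists_exponents {d a b : ℝ} (hd : 3 ≤ d) (ha0 : 0 ≤ a) (ha1 : a < 1) (hb0 : 0 ≤ b)
    (hb1 : b < 1) (hab : a + b < 2 / (d - 1)) :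
    ∃ a' b' χ : ℝ, a < a' ∧ a' < 1 ∧ b < b' ∧ b' < 1 ∧ 1 < χ ∧
      1 / 2 + b' / 2 ≤ (1 - a') / (2 * χ) + 1 / (d - 1) ∧
      1 / (2 * (χ - 1)) = (1 / (d - 1) - 1 / 2 * a - 1 / 2 * b + 1) /
        (1 / (d - 1) - 1 / 2 * a - 1 / 2 * b) * (1 / (1 - a)) * (1 / 2 + b - 1 / d) := by
  set μ := 1 / (d - 1) with hμ
  have hd1 : 0 < d - 1 := by linarith
  have hab' : a + b < 2 * μ := by rw [hμ]; rwa [mul_one_div]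
  set ν := 1 / d with hν
  have hν3 : ν ≤ 1 / 3 := one_div_le_one_div_of_le (by norm_num) hd
  have hνμ : ν ≤ μ := one_div_le_one_div_of_le hd1 (by linarith)
  set δ := μ - 1 / 2 * a - 1 / 2 * b with hδ
  have hδ0 : 0 < δ := by rw [hδ]; linarith
  set B := 1 / 2 + b - ν with hB
  have hB0 : 0 < B := by rw [hB]; linarith
  set y := 1 - a with hy
  have hy0 : 0 < y := by rw [hy]; linarith
  have hy1 : y ≤ 1 := by rw [hy]; linarith
  -- `G` is the required power, and `χ` is defined by `1 / (2 * (χ - 1)) = G`.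
  set G := (δ + 1) / δ * (1 / y) * B with hG
  have hG0 : 0 < G := by positivity
  set χ := 1 + 1 / (2 * G) with hχ
  have hχ1 : 1 < χ := by
    have : 0 < 1 / (2 * G) := by positivity
    linarith
  have hχ0 : 0 < χ := by linarith
  -- The Sobolev condition holds strictly: after clearing denominators it reads `y (y / 2 - δ) < 2
  -- (δ + 1) B`, which follows from `0 < y ≤ 1` and `y / 2 - δ < 2 B`.
  have hgap : 0 < y / (2 * χ) + μ - (1 / 2 + b / 2) := by
    have e1 : y / (2 * χ) = y * G / (2 * G + 1) := by rw [hχ]; field_simp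
    have e2 : 1 / 2 + b / 2 - μ = y / 2 - δ := by rw [hy, hδ]; ring
    have e3 : δ * (y * G) = (δ + 1) * B := by rw [hG]; field_simp
    have e4 : (y / 2 - δ) * (2 * G + 1) < y * G := by
      have e5 : y * (y / 2 - δ) < 2 * B := by
        have e6 : y / 2 - δ < 2 * B := by rw [← e2, hB]; linarith
        rcases le_total 0 (y / 2 - δ) with h | h
        · nlinarith
        · nlinarith
      have e7 : y * ((y / 2 - δ) * (2 * G + 1)) < y * (y * G) := by
        have : y * ((y / 2 - δ) * (2 * G + 1))
          = y * (y * G) + y * (y / 2 - δ) - 2 * (δ * (y * G)) := by ring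
        rw [this, e3]
        nlinarith [mul_pos hδ0 hB0]
      exact lt_of_mul_lt_mul_left e7 hy0.le
    have e8 : y / 2 - δ < y * G / (2 * G + 1) := by
      rw [lt_div_iff₀ (by positivity)]; exact e4
    rw [e1]
    linarith
  set g := y / (2 * χ) + μ - (1 / 2 + b / 2) with hg
  -- Raising `a` and `b` by `τ` costs `τ / (2χ) + τ / 2 ≤ τ ≤ g` in the condition; the other two
  -- bounds keep `a + τ` and `b + τ` below `1`.
  set τ := min g (min (y / 2) ((1 - b) / 2)) with hτ
  have hτ0 : 0 < τ := lt_min hgap (lt_min (by linarith) (by linarith))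
  have hτg : τ ≤ g := min_le_left _ _
  have hτy : τ ≤ y / 2 := (min_le_right _ _).trans (min_le_left _ _)
  have hτb : τ ≤ (1 - b) / 2 := (min_le_right _ _).trans (min_le_right _ _)
  refine ⟨a + τ, b + τ, χ, by linarith, by linarith, by linarith, by linarith, hχ1, ?_, ?_⟩
  · have e1 : (1 - (a + τ)) / (2 * χ) = y / (2 * χ) - τ / (2 * χ) := by rw [hy]; ring
    have e2 : τ / (2 * χ) ≤ τ / 2 :=
      div_le_div_of_nonneg_left hτ0.le two_pos (by linarith)
    rw [e1]
    linarith
  · have : χ - 1 = 1 / (2 * G) := by rw [hχ]; ring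
    rw [this]
    field_simp

theorem ofReal_inv_le {p : ℝ≥0∞} (hp : 1 < p) {a : ℝ} (ha : (p⁻¹).toReal ≤ a) (ha0 : 0 < a) :
    ENNReal.ofReal a⁻¹ ≤ p := by
  have h : p⁻¹ ≤ ENNReal.ofReal a := by
    rw [← ENNReal.ofReal_toReal (ENNReal.inv_ne_top.2 (by positivity : p ≠ 0))]
    exact ENNReal.ofReal_le_ofReal ha
  rw [ENNReal.ofReal_inv_of_pos ha0]
  exact ENNReal.inv_le_iff_inv_le.1 h

theorem toReal_inv_lt_one {p : ℝ≥0∞} (hp : 1 < p) : (p⁻¹).toReal < 1 := by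
  have := ENNReal.inv_lt_one.2 hp
  exact (ENNReal.toReal_lt_toReal this.ne_top ENNReal.one_ne_top).2 this

/-- The finite exponents `a⁻¹ ≤ p` and `b⁻¹ ≤ q` are used in the iteration, and monotonicity of the
ellipticity ratio returns to `p` and `q`. -/
theorem logDefect_le_of_three_le (hd : 3 ≤ d) {p q : ℝ≥0∞} (hp : 1 < p) (hq : 1 < q)
    (hpq : (p⁻¹).toReal + (q⁻¹).toReal < 2 / ((d : ℝ) - 1)) :
    ∃ C : ℝ, 0 < C ∧ ∀ ω : Bond d → ℝ, (∀ e, 0 < ω e) → ∀ n : ℕ, 1 ≤ n →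
      ∀ w : Vertex d → ℝ, (∀ x ∈ cube (0 : Vertex d) (4 * n), 0 < w x) →
      IsSuperharmonicOn ω w (cube 0 (4 * n)) → ∀ ε : ℝ, 0 < ε → ∀ l : ℝ, 0 < l → l < 1 →
      l * ((cube (0 : Vertex d) (2 * n)).card : ℝ)
        ≤ (((cube 0 (2 * n)).filter fun x => ε ≤ w x).card : ℝ) →
      ∀ x ∈ cube (0 : Vertex d) n, logDefect ε w x
        ≤ C * l⁻¹ * ellipticity ω p q (cube 0 (4 * n)) ^
          (1 / 2 + (1 / ((d : ℝ) - 1) - 1 / 2 * (p⁻¹).toReal - 1 / 2 * (q⁻¹).toReal + 1) /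
            (1 / ((d : ℝ) - 1) - 1 / 2 * (p⁻¹).toReal - 1 / 2 * (q⁻¹).toReal) *
            (1 / (1 - (p⁻¹).toReal)) * (1 / 2 + (q⁻¹).toReal - 1 / (d : ℝ))) := by
  have hd' : (3 : ℝ) ≤ d := by exact_mod_cast hd
  obtain ⟨a, b, χ, ha, ha1, hb, hb1, hχ, hle, hexp⟩ := exists_exponents hd'
    ENNReal.toReal_nonneg (toReal_inv_lt_one hp) ENNReal.toReal_nonneg (toReal_inv_lt_one hq) hpq
  have ha0 : 0 < a := lt_of_le_of_lt ENNReal.toReal_nonneg ha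
  have hb0 : 0 < b := lt_of_le_of_lt ENNReal.toReal_nonneg hb
  have hp0 := ofReal_inv_le hp ha.le ha0
  have hq0 := ofReal_inv_le hq hb.le hb0
  rw [← hexp]
  obtain ⟨m, rfl⟩ : ∃ m, d = m + 1 := ⟨d - 1, by omega⟩
  have hconj : Real.HolderConjugate a⁻¹ (1 - a)⁻¹ :=
    Real.holderConjugate_iff.2 ⟨(one_lt_inv₀ ha0).2 ha1, by rw [inv_inv, inv_inv]; ring⟩
  have h1a : 0 < 1 - a := by linarith
  obtain ⟨C, hC, h⟩ := logDefect_le (m := m) (by omega) hconj (q := b⁻¹) (χ := χ)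
    (s := (1 / 2 + b / 2)⁻¹) ((one_lt_inv₀ hb0).2 hb1).le hχ
    (by rw [one_div, inv_inv]; field_simp)
    (by
      rw [one_div, inv_inv]
      refine hle.trans (le_of_eq ?_)
      push_cast
      rw [add_sub_cancel_right]
      field_simp)
  refine ⟨C, hC, ?_⟩
  intro ω hω n hn w hw hsup ε hε l hl hl1 hcard x hx
  refine (h ω hω n hn w hw hsup ε hε l hl hl1 hcard x hx).trans ?_
  have he : 0 ≤ 1 / 2 + 1 / (2 * (χ - 1)) := by
    have : 0 < χ - 1 := by linarith
    positivity
  refine mul_le_mul_of_nonneg_left (Real.rpow_le_rpow (ellipticity_nonneg _ _ _ _) ?_ he)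
    (by positivity)
  exact ellipticity_mono (by positivity) (by positivity) hp0 hq0
    (card_bondsIn_cube_pos (by omega) (by omega)) ω

theorem generator_add_const (ω : Bond d → ℝ) (u : Vertex d → ℝ) (κ : ℝ) (x : Vertex d) :
    generator ω (fun y => u y + κ) x = generator ω u x := by
  simp only [generator, add_sub_add_right_eq_sub]

/-- A bound on the logarithm of positive superharmonic functions yields a lower bound for
nonnegative ones. -/
theorem mul_exp_le_of_logDefect_le {ω : Bond d → ℝ} {n : ℕ} {u : Vertex d → ℝ}
    (hu : ∀ x ∈ cube (0 : Vertex d) (4 * n), 0 ≤ u x)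
    (hsup : IsSuperharmonicOn ω u (cube 0 (4 * n))) {ε l B : ℝ} (hε : 0 < ε)
    (hcard : l * ((cube (0 : Vertex d) (2 * n)).card : ℝ)
      ≤ (((cube 0 (2 * n)).filter fun x => ε ≤ u x).card : ℝ))
    {x : Vertex d} (hx : x ∈ cube 0 n)
    (h : ∀ w : Vertex d → ℝ, (∀ x ∈ cube (0 : Vertex d) (4 * n), 0 < w x) →
      IsSuperharmonicOn ω w (cube 0 (4 * n)) →
      l * ((cube (0 : Vertex d) (2 * n)).card : ℝ)
        ≤ (((cube 0 (2 * n)).filter fun x => ε ≤ w x).card : ℝ) → logDefect ε w x ≤ B) :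
    ε * Real.exp (-B) ≤ u x := by
  -- `u` may vanish, so the logarithm is taken of `u + κ`, which is superharmonic and has a larger
  -- superlevel set; the bound `B` does not depend on `κ`.
  refine le_of_forall_pos_le_add fun κ hκ => ?_
  have hx' : x ∈ cube (0 : Vertex d) (4 * n) := cube_mono (by omega) hx
  have hw : ∀ x ∈ cube (0 : Vertex d) (4 * n), 0 < u x + κ := fun x hx => by
    linarith [hu x hx]
  have h1 := h (fun y => u y + κ) hw (fun y hy => by
    rw [generator_add_const]; exact hsup y hy) (hcard.trans (by
      refine Nat.cast_le.2 (Finset.card_le_card fun y hy => ?_)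
      rw [Finset.mem_filter] at hy ⊢
      exact ⟨hy.1, by linarith [hy.2]⟩))
  calc ε * Real.exp (-B) ≤ ε * Real.exp (-logDefect ε (fun y => u y + κ) x) :=
        mul_le_mul_of_nonneg_left (Real.exp_le_exp.2 (by linarith)) hε.le
    _ ≤ u x + κ := mul_exp_neg_logDefect_le (w := fun y => u y + κ) hε (hw x hx')

end RandomConductance

theorem theorem7 (d : ℕ) (hd : 2 ≤ d) (p q : ℝ≥0∞) (hp : 1 < p) (hq : 1 < q)
    (hpq : (p⁻¹).toReal + (q⁻¹).toReal < 2 / ((d : ℝ) - 1)) :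
    ∃ c : ℝ, 1 ≤ c ∧
      ∀ ω : Bond d → ℝ, (∀ e, 0 < ω e) →
      ∀ n : ℕ, 1 ≤ n →
      ∀ u : Vertex d → ℝ, (∀ x ∈ cube 0 (4 * n), 0 ≤ u x) →
      IsSuperharmonicOn ω u (cube 0 (4 * n)) →
      ∀ ε : ℝ, 0 < ε → ∀ l : ℝ, 0 < l → l < 1 →
      l * ((cube (0 : Vertex d) (2 * n)).card : ℝ)
        ≤ (((cube 0 (2 * n)).filter fun x => ε ≤ u x).card : ℝ) →
      -- `δ` and the dual exponent `p' = p / (p - 1)`, where `1 / ∞ = 0`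
      let δ : ℝ := 1 / ((d : ℝ) - 1) - 1 / 2 * (p⁻¹).toReal - 1 / 2 * (q⁻¹).toReal
      let p' : ℝ := 1 / (1 - (p⁻¹).toReal)
      let γ : ℝ := ε *
        if d = 2 then
          Real.exp (-c * l⁻¹ * ellipticity ω 1 1 (cube 0 (4 * n)) ^ (1 / 2 : ℝ))
        else
          Real.exp (-c * l⁻¹ * ellipticity ω p q (cube 0 (4 * n)) ^
            (1 / 2 + (δ + 1) / δ * p' * (1 / 2 + (q⁻¹).toReal - 1 / (d : ℝ))))
      ∀ x ∈ cube (0 : Vertex d) n, γ ≤ u x := by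
  by_cases h2 : d = 2
  · subst h2
    obtain ⟨C, -, h⟩ := logDefect_le_two
    refine ⟨max 1 C, le_max_left _ _, ?_⟩
    intro ω hω n hn u hu hsup ε hε l hl hl1 hcard δ p' γ x hx
    simp only [γ, if_true, neg_mul]
    refine mul_exp_le_of_logDefect_le hu hsup hε hcard hx fun w hw hws hwc => ?_
    refine (h ω hω n hn w hw hws ε hε l hl hl1 hwc x hx).trans ?_
    have := Real.rpow_nonneg (ellipticity_nonneg ω 1 1 (cube 0 (4 * n))) (1 / 2)
    gcongr
    exact le_max_right _ _
  · obtain ⟨C, -, h⟩ := logDefect_le_of_three_le (by omega) hp hq hpq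
    refine ⟨max 1 C, le_max_left _ _, ?_⟩
    intro ω hω n hn u hu hsup ε hε l hl hl1 hcard δ p' γ x hx
    simp only [γ, if_neg h2, neg_mul]
    refine mul_exp_le_of_logDefect_le hu hsup hε hcard hx fun w hw hws hwc => ?_
    refine (h ω hω n hn w hw hws ε hε l hl hl1 hwc x hx).trans ?_
    have := fun e : ℝ => Real.rpow_nonneg (ellipticity_nonneg ω p q (cube 0 (4 * n))) e
    refine mul_le_mul_of_nonneg_right ?_ (this _)
    exact mul_le_mul_of_nonneg_right (le_max_right _ _) (inv_pos.2 hl).le
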